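/- Let $n\in\mathbb N$ and let $X=\mathbb R^{2n}/\mathbb Z^{2n}$ be the torus with periodic coordinates $(x,y)$, $x,y\in\mathbb R^n$, and symplectic form $\omega=\sum_{i=1}^n dy^i\wedge dx^i$; identify $C^\infty(X,\mathbb C)$ with the smooth $\mathbb Z^{2n}$-periodic functions on $\mathbb R^{2n}$. For $k\in\mathbb N=\{1,2,\dots\}$ put $\hbar=1/k$. **Sections.** Smooth sections of $L^{\otimes k}$ are the smooth $s:\mathbb R^{2n}\to\mathbb C$ with $s(u+\lambda)=\alpha(\lambda)^k e^{-k\pi\sqrt{-1}\,\omega(u,\lambda)}s(u)$ for all $\lambda\in\mathbb Z^{2n}$, where $\alpha(\lambda)=(-1)^{\sum_i\lambda_i\lambda_{n+i}}$ and $\omega(u,v)=\sum_i(u_{n+i}v_i-u_iv_{n+i})$. The connection is $\nabla=d-k\pi\sqrt{-1}\sum_i(y^idx^i-x^idy^i)$. A distributional section $s$ is a continuous conjugate-linear functional $t\mapsto\langle s,t\rangle$ on the smooth sections; for $f\in C^\infty(X,\mathbb C)$, $\langle fs,t\rangle=\langle s,\bar f t\rangle$ and $\langle\nabla_{\partial_i}s,t\rangle=-\langle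 s,\nabla_{\partial_i}t\rangle$ for each coordinate field $\partial_i$. **Quantum Hilbert spaces.** $\mathcal H^\hbar$ (respectively $\check{\mathcal H}^\hbar$) consists of the distributional sections annihilated by all $\nabla_{\partial_{x^i}}$ (respectively all $\nabla_{\partial_{y^i}}$), tensored with the line $\mathbb C\rho$ (respectively $\mathbb C\check\rho$) of half-forms, where $\langle\rho,\check\rho\rangle=\langle\check\rho,\rho\rangle=(2/k)^{n/2}$. For $m\in\mathbb Z_k^n=(\mathbb Z/k\mathbb Z)^n$ (with any representatives in $\mathbb Z^n$) put $$\langle\vartheta^m,t\rangle=(2k)^{-n/2}\int_{[0,1]^n}e^{\pi\sqrt{-1}\,m\cdot x}\,\overline{t(x,m/k)}\,dx,$$ $$\langle\check\vartheta^m,t\rangle=2^{-n/2}k^{-n}\sum_{j\in\mathbb Z_k^n}e^{2\pi\sqrt{-1}\,m\cdot j/k}\int_{[0,1]^n}e^{-\pi\sqrt{-1}\,j\cdot y}\,\overline{t(j/k,y)}\,dy,$$ and $\sigma^m=2^{n/4}k^{n/2}\vartheta^m\otimes\rho\in\mathcal H^\hbar$, $\check\sigma^m=2^{n/4}k^{n/2}\check\vartheta^m\otimes\check\rho\in\check{\mathcal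 H}^\hbar$. The inner products on $\mathcal H^\hbar$ and $\check{\mathcal H}^\hbar$ are those for which $(\sigma^m)_m$ and $(\check\sigma^m)_m$ are orthonormal bases. **Toeplitz operators.** For distributional sections $u,v$ with suitably transversal wavefront sets let $\langle u,v\rangle=\int_X u\bar v$ be the sesquilinear extension of the $L^2$ pairing, computed by Parseval's formula on localizations: $\langle u,v\rangle=\int_{\mathbb R^{2n}}\widehat{\chi u}\,\overline{\widehat{\psi v}}$ for all $\chi,\psi\in C_c^\infty(\mathbb R^{2n})$ with $\sum_{\lambda\in\mathbb Z^{2n}}(\chi\bar\psi)(\cdot+\lambda)=1$. Combined with the half-form pairing it pairs sections twisted by $\rho$ with sections twisted by $\check\rho$. For $f\in C^\infty(X,\mathbb C)$ set $$Q_f^\hbar s=\sum_{m\in\mathbb Z_k^n}\langle fs,\check\sigma^m\rangle\,\sigma^m\quad(s\in\mathcal H^\hbar),\qquad \check Q_f^\hbar s=\sum_{m\in\mathbb Z_k^n}\langle fs,\sigma^m\rangle\,\check\sigma^m\quad(s\in\check{\mathcal H}^\hbar).$$ **Fourier-type transforms.** Let $B^\hbar:\check{\mathcal H}^\hbar\to\mathcal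 H^\hbar$ be the linear isomorphism (BKS pairing map) with $B^\hbar\check\sigma^m=\sigma^m$ for all $m$, and let $\mathcal F^{\mathrm{GQ}}(A)=B^\hbar A(B^\hbar)^{-1}$. With $\Delta=\frac{\sqrt{-1}}{2\pi}\sum_{i=1}^n\frac{\partial^2}{\partial x^i\partial y^i}$ let $\mathcal F^{\mathrm{DQ}}_N=\sum_{i=0}^N\frac1{i!}(-\hbar\Delta)^i$ be the $N$-th order truncation of $\mathcal F^{\mathrm{DQ}}=e^{-\hbar\Delta}$. **Theorem 1.2.** All these objects are well defined (for every $k$, every $g\in C^\infty(X,\mathbb C)$ and every state $s$ the pairings in $Q_g^\hbar s$ and $\check Q_g^\hbar s$ exist, and $B^\hbar$ exists and is unique), and for every $f\in C^\infty(X,\mathbb C)$ and every $N\in\mathbb N\cup\{0\}$ there is a constant $K>0$ such that, for all $k\in\mathbb N$ and $\hbar=1/k$, in the operator norm on $\mathcal H^\hbar$, $$\bigl\lVert B^\hbar\,\check Q_f^\hbar\,(B^\hbar)^{-1}-Q^\hbar_{\mathcal F_N^{\mathrm{DQ}}f}\bigr\rVert\le K\,\hbar^{N+1}.$$ -/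

import Mathlib

open scoped ContDiff ComplexConjugate Matrix
open MeasureTheory

noncomputable section

namespace TorusQuant

/-! ### The symplectic torus -/

/-- Coordinates `x` on `T`, or `y` on the dual torus. -/
abbrev Vec (n : ℕ) := Fin n → ℝ

/-- The universal cover `ℝ²ⁿ` of `X = ℝ²ⁿ / ℤ²ⁿ`, with points `(x, y)`. -/
abbrev Phase (n : ℕ) := Vec n × Vec n

/-- The lattice `ℤ²ⁿ = ℤⁿ × ℤⁿ`. -/
abbrev Lattice (n : ℕ) := (Fin n → ℤ) × (Fin n → ℤ)

/-- A lattice element as a vector of `ℝ²ⁿ`. -/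
def latVec {n : ℕ} (l : Lattice n) : Phase n :=
  (fun i => (l.1 i : ℝ), fun i => (l.2 i : ℝ))

/-- The symplectic form `ω = ∑ dyⁱ ∧ dxⁱ` as a bilinear form on `ℝ²ⁿ`. -/
def symp {n : ℕ} (u v : Phase n) : ℝ := u.2 ⬝ᵥ v.1 - u.1 ⬝ᵥ v.2

/-- The coordinate vector field `∂/∂xⁱ`. -/
def dirX {n : ℕ} (i : Fin n) : Phase n := (Pi.single i 1, 0)

/-- The coordinate vector field `∂/∂yⁱ`. -/
def dirY {n : ℕ} (i : Fin n) : Phase n := (0, Pi.single i 1)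

/-- `C^∞(X, ℂ)`, as the algebra of smooth `ℤ²ⁿ`-periodic functions on `ℝ²ⁿ`. -/
def SmoothFn (n : ℕ) : Subalgebra ℂ (Phase n → ℂ) where
  carrier := {f | ContDiff ℝ ∞ f ∧ ∀ (p : Phase n) (l : Lattice n), f (p + latVec l) = f p}
  mul_mem' := fun ha hb => ⟨ha.1.mul hb.1, fun p l => by simp [ha.2, hb.2]⟩
  add_mem' := fun ha hb => ⟨ha.1.add hb.1, fun p l => by simp [ha.2, hb.2]⟩
  algebraMap_mem' := fun c => ⟨contDiff_const, fun _ _ => rfl⟩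

/-- Complex conjugation on `C^∞(X, ℂ)`. -/
def conjFn {n : ℕ} (f : SmoothFn n) : SmoothFn n :=
  ⟨fun p => conj (f.1 p),
    Complex.conjCLE.contDiff.comp f.2.1, fun p l => congrArg conj (f.2.2 p l)⟩

/-- The derivation of `C^∞(X, ℂ)` along the constant vector field `v`. -/
def derivFn {n : ℕ} (v : Phase n) : SmoothFn n →ₗ[ℂ] SmoothFn n where
  toFun f := ⟨fun p => fderiv ℝ f.1 p v,
    (f.2.1.fderiv_right (m := ∞) (by simp)).clm_apply contDiff_const, fun p l => by
      have h : (fun q => f.1 (q + latVec l)) = f.1 := funext fun q => f.2.2 q l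
      change fderiv ℝ f.1 (p + latVec l) v = fderiv ℝ f.1 p v
      rw [← fderiv_comp_add_right, h]⟩
  map_add' f g := by
    ext p
    have hf := (f.2.1.differentiable (by simp)) p
    have hg := (g.2.1.differentiable (by simp)) p
    simp [fderiv_add hf hg]
  map_smul' c f := by
    ext p
    have hf := (f.2.1.differentiable (by simp)) p
    simp [fderiv_const_smul hf]

/-- The operator `Δ = (√-1 / 2π) ∑ᵢ ∂²/∂xⁱ∂yⁱ` on `C^∞(X, ℂ)`. -/
def laplace (n : ℕ) : Module.End ℂ (SmoothFn n) :=
  (Complex.I / (2 * Real.pi)) • ∑ i : Fin n, (derivFn (dirX i)) ∘ₗ (derivFn (dirY i))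

/-- The truncation `∑_{i ≤ N} (-ħΔ)ⁱ / i!` of the formal operator `e^{-ħΔ}`,
evaluated at the number `ħ`. -/
def truncDQ (n N : ℕ) (hbar : ℝ) : Module.End ℂ (SmoothFn n) :=
  ∑ i ∈ Finset.range (N + 1), ((i.factorial : ℂ)⁻¹) • ((-(hbar : ℂ)) • laplace n) ^ i

/-! ### The prequantum line bundle -/

/-- The canonical semi-character `α(λ) = (-1)^{∑ λᵢ λₙ₊ᵢ}`. -/
def semiChar {n : ℕ} (l : Lattice n) : ℂ := (-1 : ℂ) ^ (∑ i, l.1 i * l.2 i)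

/-- The multiplier `α(λ)ᵏ exp(-kπ√-1 ω(u, λ))` of the line bundle `L^{⊗k}`. -/
def multiplier {n : ℕ} (k : ℕ) (l : Lattice n) (u : Phase n) : ℂ :=
  semiChar l ^ k * Complex.exp (-(k * Real.pi * Complex.I * symp u (latVec l)))

theorem contDiff_dot {n : ℕ} {f g : Phase n → Vec n} (hf : ContDiff ℝ ∞ f)
    (hg : ContDiff ℝ ∞ g) : ContDiff ℝ ∞ fun p => f p ⬝ᵥ g p := by
  unfold dotProduct
  exact ContDiff.sum fun i _ => ((contDiff_pi.1 hf) i).mul ((contDiff_pi.1 hg) i)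

theorem contDiff_symp {n : ℕ} (v : Phase n) : ContDiff ℝ ∞ fun p : Phase n => symp p v :=
  (contDiff_dot contDiff_snd contDiff_const).sub (contDiff_dot contDiff_fst contDiff_const)

theorem symp_add_left {n : ℕ} (u u' v : Phase n) : symp (u + u') v = symp u v + symp u' v := by
  simp [symp, add_dotProduct]; ring

theorem symp_smul_left {n : ℕ} (c : ℝ) (u v : Phase n) : symp (c • u) v = c * symp u v := by
  simp [symp, smul_dotProduct]; ring

theorem symp_swap {n : ℕ} (u v : Phase n) : symp u v = - symp v u := by
  simp [symp, dotProduct_comm]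

theorem hasFDerivAt_symp {n : ℕ} (v p : Phase n) :
    ∃ A : Phase n →L[ℝ] ℝ, HasFDerivAt (fun q : Phase n => symp q v) A p ∧
      ∀ w, A w = symp w v := by
  let A : Phase n →ₗ[ℝ] ℝ :=
    { toFun := fun q => symp q v
      map_add' := fun a b => symp_add_left a b v
      map_smul' := fun c a => symp_smul_left c a v }
  exact ⟨LinearMap.toContinuousLinearMap A,
    (LinearMap.toContinuousLinearMap A).hasFDerivAt, fun w => rfl⟩

theorem contDiff_multiplier {n : ℕ} (k : ℕ) (l : Lattice n) :
    ContDiff ℝ ∞ (multiplier k l) := by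
  unfold multiplier
  refine contDiff_const.mul (ContDiff.cexp ?_)
  exact (contDiff_const.mul (Complex.ofRealCLM.contDiff.comp (contDiff_symp _))).neg

theorem semiChar_ne_zero {n : ℕ} (l : Lattice n) : semiChar l ≠ 0 :=
  zpow_ne_zero _ (by norm_num)

theorem multiplier_ne_zero {n : ℕ} (k : ℕ) (l : Lattice n) (u : Phase n) :
    multiplier k l u ≠ 0 :=
  mul_ne_zero (pow_ne_zero _ (semiChar_ne_zero l)) (Complex.exp_ne_zero _)

theorem latVec_add {n : ℕ} (l m : Lattice n) : latVec (l + m) = latVec l + latVec m := by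
  ext i <;> simp [latVec]

theorem multiplier_add {n : ℕ} (k : ℕ) (l m : Lattice n) (u : Phase n) :
    multiplier k (l + m) u = multiplier k l (u + latVec m) * multiplier k m u := by
  have hE : ∀ l : Lattice n, semiChar l =
      Complex.exp (((∑ i, l.1 i * l.2 i : ℤ) : ℂ) * (Real.pi * Complex.I)) := by
    intro l
    rw [semiChar, Complex.exp_int_mul, Complex.exp_pi_mul_I]
  simp only [multiplier, hE, ← Complex.exp_nat_mul, ← Complex.exp_add]
  rw [Complex.exp_eq_exp_iff_exists_int]
  refine ⟨k * ∑ i, l.1 i * m.2 i, ?_⟩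
  simp only [symp, dotProduct, latVec, Prod.fst_add, Prod.snd_add, Pi.add_apply]
  push_cast
  simp only [add_mul, mul_add, Finset.sum_add_distrib]
  have : ∀ a b : Fin n → ℤ, ∑ i, (a i : ℂ) * b i = ∑ i, (b i : ℂ) * a i :=
    fun a b => Finset.sum_congr rfl fun i _ => mul_comm _ _
  rw [this l.1 m.2]
  ring

/-- `Γ^∞(X, L^{⊗k})`, as the space of smooth quasi-periodic functions on `ℝ²ⁿ`. -/
def SmoothSec (n k : ℕ) : Submodule ℂ (Phase n → ℂ) where
  carrier := {s | ContDiff ℝ ∞ s ∧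
    ∀ (u : Phase n) (l : Lattice n), s (u + latVec l) = multiplier k l u * s u}
  add_mem' := fun ha hb => ⟨ha.1.add hb.1, fun p l => by simp [ha.2, hb.2, mul_add]⟩
  zero_mem' := ⟨contDiff_const, fun _ _ => by simp⟩
  smul_mem' := fun c s hs => ⟨contDiff_const.smul hs.1, fun p l => by
    simp [hs.2]; ring⟩

/-- Multiplication of smooth sections by smooth functions. -/
def mulSec {n k : ℕ} (f : SmoothFn n) : SmoothSec n k →ₗ[ℂ] SmoothSec n k where
  toFun t := ⟨fun p => f.1 p * t.1 p, f.2.1.mul t.2.1, fun u l => by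
    change f.1 (u + latVec l) * t.1 (u + latVec l) = multiplier k l u * (f.1 u * t.1 u)
    rw [f.2.2, t.2.2]; ring⟩
  map_add' a b := by ext p; simp [mul_add]
  map_smul' c a := by ext p; simp; ring

/-- The connection `∇ = d - kπ√-1 ∑ (yⁱ dxⁱ - xⁱ dyⁱ)` of `L^{⊗k}`, along the constant vector
field `v`. -/
def covDeriv {n k : ℕ} (v : Phase n) : SmoothSec n k →ₗ[ℂ] SmoothSec n k where
  toFun t := ⟨fun p => fderiv ℝ t.1 p v
      - k * Real.pi * Complex.I * ((p.2 ⬝ᵥ v.1 - p.1 ⬝ᵥ v.2 : ℝ) : ℂ) * t.1 p, by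
    refine ⟨?_, ?_⟩
    · refine ((t.2.1.fderiv_right (m := ∞) (by simp)).clm_apply contDiff_const).sub ?_
      exact (contDiff_const.mul (Complex.ofRealCLM.contDiff.comp (contDiff_symp v))).mul t.2.1
    · intro p l
      have h : (fun q => t.1 (q + latVec l)) = fun q => multiplier k l q * t.1 q :=
        funext fun q => t.2.2 q l
      have ht := ((t.2.1.differentiable (by simp)) p).hasFDerivAt
      obtain ⟨A, hA, hA'⟩ := hasFDerivAt_symp (latVec l) p
      have h1 : HasFDerivAt (fun q : Phase n => ((symp q (latVec l) : ℝ) : ℂ))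
          (Complex.ofRealCLM.comp A) p := Complex.ofRealCLM.hasFDerivAt.comp p hA
      have h2 := (((h1.const_mul ((k : ℂ) * Real.pi * Complex.I)).neg.cexp).const_mul
        (semiChar l ^ k)).mul ht
      have h3 := h2.fderiv
      have h4 : fderiv ℝ t.1 (p + latVec l) = fderiv ℝ (fun q => multiplier k l q * t.1 q) p := by
        rw [← fderiv_comp_add_right, h]
      have h5 := h4.trans h3
      have hs := symp_swap (latVec l) v
      change fderiv ℝ t.1 (p + latVec l) v
        - k * Real.pi * Complex.I * ((symp (p + latVec l) v : ℝ) : ℂ) * t.1 (p + latVec l)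
        = multiplier k l p * (fderiv ℝ t.1 p v
          - k * Real.pi * Complex.I * ((symp p v : ℝ) : ℂ) * t.1 p)
      rw [h5, t.2.2, symp_add_left, hs]
      simp [multiplier, hA']
      ring⟩
  map_add' a b := by
    ext p
    have ha := (a.2.1.differentiable (by simp)) p
    have hb := (b.2.1.differentiable (by simp)) p
    simp [fderiv_add ha hb]
    ring
  map_smul' c a := by
    ext p
    have ha := (a.2.1.differentiable (by simp)) p
    simp [fderiv_const_smul ha]
    ring

/-! ### Distributional sections -/

/-- `Γ^{-∞}(X, L^{⊗k})`: a distributional section `s` is given by its values `⟨s, t⟩` on smooth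
sections `t`, conjugate-linear in `t` and continuous for the `C^∞` topology, that is, bounded by
the suprema over the fundamental domain `[0,1]²ⁿ` of finitely many derivatives of `t`. -/
def DistSec (n k : ℕ) : Submodule ℂ (SmoothSec n k →ₗ⋆[ℂ] ℂ) where
  carrier := {s | ∃ (N : ℕ) (C : ℝ), ∀ (t : SmoothSec n k) (M : ℝ),
    (∀ j ≤ N, ∀ p ∈ Set.Icc (0 : Phase n) 1, ‖iteratedFDeriv ℝ j t.1 p‖ ≤ M) →
      ‖s t‖ ≤ C * M}
  add_mem' := by
    rintro a b ⟨N, C, h⟩ ⟨N', C', h'⟩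
    refine ⟨max N N', C + C', fun t M hM => ?_⟩
    have h1 := h t M fun j hj => hM j (hj.trans (le_max_left _ _))
    have h2 := h' t M fun j hj => hM j (hj.trans (le_max_right _ _))
    calc ‖(a + b) t‖ ≤ ‖a t‖ + ‖b t‖ := norm_add_le _ _
      _ ≤ (C + C') * M := by linarith
  zero_mem' := ⟨0, 0, fun t M _ => by simp⟩
  smul_mem' := by
    rintro c a ⟨N, C, h⟩
    refine ⟨N, ‖c‖ * C, fun t M hM => ?_⟩
    rw [LinearMap.smul_apply, norm_smul, mul_assoc]
    exact mul_le_mul_of_nonneg_left (h t M hM) (norm_nonneg c)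

/-- The product `f s` of a smooth function and a distributional section,
`⟨f s, t⟩ = ⟨s, f̄ t⟩`. -/
def mulDist {n k : ℕ} (f : SmoothFn n) (s : DistSec n k) : DistSec n k :=
  ⟨s.1.comp (mulSec (conjFn f)), by
    obtain ⟨N, C, h⟩ := s.2
    have hb : ∃ A : ℝ, ∀ j ≤ N, ∀ p ∈ Set.Icc (0 : Phase n) 1,
        ‖iteratedFDeriv ℝ j (conjFn f).1 p‖ ≤ A := by
      have h1 : ∀ j : ℕ, ∃ A : ℝ, ∀ p ∈ Set.Icc (0 : Phase n) 1,
          ‖iteratedFDeriv ℝ j (conjFn f).1 p‖ ≤ A := fun j =>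
        isCompact_Icc.exists_bound_of_continuousOn
          ((conjFn f).2.1.continuous_iteratedFDeriv (by exact_mod_cast le_top)).continuousOn
      choose A hA using h1
      refine ⟨∑ j ∈ Finset.range (N + 1), |A j|, fun j hj p hp => ?_⟩
      exact (hA j p hp).trans ((le_abs_self _).trans
        (Finset.single_le_sum (f := fun j => |A j|) (fun i _ => abs_nonneg _)
          (Finset.mem_range.2 (by omega))))
    obtain ⟨A, hA⟩ := hb
    have hA0 : 0 ≤ A := (norm_nonneg _).trans (hA 0 (Nat.zero_le _) 0 ⟨le_rfl, zero_le_one⟩)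
    refine ⟨N, C * (2 ^ N * A), fun t M hM => ?_⟩
    have hM0 : 0 ≤ M := (norm_nonneg _).trans (hM 0 (Nat.zero_le _) 0 ⟨le_rfl, zero_le_one⟩)
    rw [mul_assoc]
    refine h _ _ fun j hj p hp => ?_
    refine (norm_iteratedFDeriv_mul_le (N := ∞) (conjFn f).2.1 t.2.1 p
      (by exact_mod_cast le_top)).trans ?_
    calc _ ≤ ∑ i ∈ Finset.range (j + 1), (j.choose i : ℝ) * A * M := by
          refine Finset.sum_le_sum fun i hi => ?_
          have hi' : i ≤ j := by simpa [Nat.lt_succ_iff] using hi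
          gcongr
          · exact hA i (hi'.trans hj) p hp
          · exact hM (j - i) ((Nat.sub_le _ _).trans hj) p hp
      _ = 2 ^ j * A * M := by
          rw [← Finset.sum_mul, ← Finset.sum_mul]
          congr 2
          exact_mod_cast Nat.sum_range_choose j
      _ ≤ 2 ^ N * A * M := by
          gcongr
          norm_num⟩

/-! ### Quantum states in the two real polarizations -/

/-- The quantum Hilbert space `H^ħ` (`ħ = 1/k`) in the polarization spanned by the `∂/∂xⁱ`:
the distributional sections `s` with `⟨∇_ξ s, t⟩ = -⟨s, ∇_ξ t⟩ = 0` for all `t` and all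
`ξ = ∂/∂xⁱ`. A section `s` stands for the state `s ⊗ ρ`, where `ρ` is the
chosen generator of the half-forms of this polarization. -/
def HX (n k : ℕ) : Submodule ℂ (DistSec n k) where
  carrier := {s | ∀ (i : Fin n) (t : SmoothSec n k), s.1 (covDeriv (dirX i) t) = 0}
  add_mem' := fun ha hb i t => by simp [ha i t, hb i t]
  zero_mem' := fun i t => by simp
  smul_mem' := fun c a ha i t => by simp [ha i t]

/-- The quantum Hilbert space `Ȟ^ħ` in the polarization spanned by the `∂/∂yⁱ`. A section `s`
stands for the state `s ⊗ ρ̌`, where `ρ̌` is the chosen generator of the half-forms of this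
polarization. -/
def HY (n k : ℕ) : Submodule ℂ (DistSec n k) where
  carrier := {s | ∀ (i : Fin n) (t : SmoothSec n k), s.1 (covDeriv (dirY i) t) = 0}
  add_mem' := fun ha hb i t => by simp [ha i t, hb i t]
  zero_mem' := fun i t => by simp
  smul_mem' := fun c a ha i t => by simp [ha i t]

/-- The vector in `[0,k)ⁿ` of the representatives of a residue class `m ∈ (ℤ/k)ⁿ`. -/
def rep {n k : ℕ} (m : Fin n → ZMod k) : Vec n := fun i => ((m i).val : ℝ)

theorem rep_mem {n k : ℕ} [NeZero k] (m : Fin n → ZMod k) :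
    (k : ℝ)⁻¹ • rep m ∈ Set.Icc (0 : Vec n) 1 := by
  have hk : (0 : ℝ) < k := by exact_mod_cast Nat.pos_of_ne_zero (NeZero.ne k)
  refine ⟨fun i => ?_, fun i => ?_⟩
  · simp only [Pi.zero_apply, Pi.smul_apply, rep, smul_eq_mul]; positivity
  · simp only [Pi.one_apply, Pi.smul_apply, rep, smul_eq_mul]
    rw [inv_mul_le_iff₀ hk, mul_one]
    exact_mod_cast (ZMod.val_lt (m i)).le

/-- The integral over `[0,1]ⁿ` of a derivative of a periodic function vanishes. -/
theorem integral_fderiv_periodic {n : ℕ} (g : Vec n → ℂ) (hg : ContDiff ℝ 1 g) (i : Fin n)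
    (hper : ∀ x, g (x + Pi.single i 1) = g x) :
    ∫ x in Set.Icc (0 : Vec n) 1, fderiv ℝ g x (Pi.single i 1) = 0 := by
  obtain _ | n := n
  · exact i.elim0
  have hc : Continuous fun x => fderiv ℝ g x (Pi.single i 1) :=
    (hg.continuous_fderiv (by simp)).clm_apply continuous_const
  have h := integral_divergence_of_hasFDerivAt_off_countable' (0 : Vec (n + 1)) 1
    zero_le_one (fun j => if j = i then g else 0)
    (fun j => if j = i then fderiv ℝ g else 0) ∅ Set.countable_empty
    (fun j => by
      by_cases hj : j = i
      · simpa [hj] using hg.continuous.continuousOn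
      · simp only [hj, if_false]
        exact continuousOn_const (c := (0 : ℂ)))
    (fun x _ j => by
      by_cases hj : j = i
      · simpa [hj] using (hg.differentiable (by simp) x).hasFDerivAt
      · simp only [hj, if_false]
        exact hasFDerivAt_const (0 : ℂ) x)
    (by
      refine Continuous.integrableOn_Icc ?_
      refine continuous_finsetSum _ fun j _ => ?_
      by_cases hj : j = i
      · subst hj; simpa using hc
      · simpa [hj] using continuous_const)
  have h1 : ∀ x, (∑ j, (if j = i then fderiv ℝ g else 0 : Vec (n+1) → Vec (n+1) →L[ℝ] ℂ) x
      (Pi.single j 1)) = fderiv ℝ g x (Pi.single i 1) := by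
    intro x
    rw [Finset.sum_eq_single i]
    · simp
    · intro j _ hj; simp [hj]
    · simp
  simp only [h1] at h
  rw [h]
  refine Finset.sum_eq_zero fun j _ => ?_
  by_cases hj : j = i
  · subst hj
    simp only [if_true, Pi.one_apply, Pi.zero_apply]
    rw [sub_eq_zero]
    refine integral_congr_ae (Filter.Eventually.of_forall fun x => ?_)
    simp only
    rw [← hper (j.insertNth (0 : ℝ) x)]
    congr 1
    ext l
    induction l using Fin.succAboveCases j with
    | x => simp
    | p l => simp
  · simp [hj]

/-- The distributional section `t ↦ ∫_{[0,1]ⁿ} w(z) conj(t(γ(z))) dz`, for a unitary weight `w`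
and a map `γ` of `[0,1]ⁿ` into the fundamental domain. -/
def fibreDist {n : ℕ} (k : ℕ) (w : Vec n → ℂ) (γ : Vec n → Phase n) (hw : Continuous w)
    (hw1 : ∀ z, ‖w z‖ = 1) (hγ : Continuous γ)
    (hγ1 : ∀ z ∈ Set.Icc (0 : Vec n) 1, γ z ∈ Set.Icc (0 : Phase n) 1) : DistSec n k :=
  ⟨{ toFun := fun t => ∫ z in Set.Icc (0 : Vec n) 1, w z * conj (t.1 (γ z))
     map_add' := fun a b => by
      have hi : ∀ t : SmoothSec n k,
          IntegrableOn (fun z => w z * conj (t.1 (γ z))) (Set.Icc (0 : Vec n) 1) := fun t =>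
        (hw.mul (Complex.continuous_conj.comp (t.2.1.continuous.comp hγ))).integrableOn_Icc
      rw [← integral_add (hi a) (hi b)]
      congr 1; ext z; simp [mul_add]
     map_smul' := fun c a => by
      rw [smul_eq_mul, ← integral_const_mul]
      congr 1; ext z; simp; ring }, by
    refine ⟨0, 1, fun t M hM => ?_⟩
    have h := norm_setIntegral_le_of_norm_le_const (μ := (volume : Measure (Vec n)))
      (s := Set.Icc (0 : Vec n) 1) (f := fun z => w z * conj (t.1 (γ z))) (C := M)
      isCompact_Icc.measure_lt_top (fun z hz => by
        have := hM 0 le_rfl (γ z) (hγ1 z hz)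
        simpa [hw1] using this)
    refine h.trans (le_of_eq ?_)
    rw [measureReal_def, Real.volume_Icc_pi]
    simp⟩

/-- The unit section `e^{π√-1 m·x}` of the level-`ħ` Bohr-Sommerfeld fibre `{y = m/k}`, as a
distributional section: `t ↦ ∫_{[0,1]ⁿ} e^{π√-1 m·x} conj(t(x, m/k)) dx`. -/
def fibreX {n : ℕ} (k : ℕ) [NeZero k] (m : Fin n → ZMod k) : DistSec n k :=
  fibreDist k (fun x => Complex.exp ((Real.pi * (rep m ⬝ᵥ x) : ℝ) * Complex.I))
    (fun x => (x, (k : ℝ)⁻¹ • rep m))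
    (by unfold dotProduct; fun_prop)
    (fun x => Complex.norm_exp_ofReal_mul_I _)
    (by fun_prop)
    (fun x hx => ⟨⟨hx.1, (rep_mem m).1⟩, ⟨hx.2, (rep_mem m).2⟩⟩)

/-- The unit section `e^{-π√-1 m·y}` of the level-`ħ` Bohr-Sommerfeld fibre `{x = m/k}`, as a
distributional section: `t ↦ ∫_{[0,1]ⁿ} e^{-π√-1 m·y} conj(t(m/k, y)) dy`. -/
def fibreY {n : ℕ} (k : ℕ) [NeZero k] (m : Fin n → ZMod k) : DistSec n k :=
  fibreDist k (fun y => Complex.exp ((-(Real.pi * (rep m ⬝ᵥ y)) : ℝ) * Complex.I))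
    (fun y => ((k : ℝ)⁻¹ • rep m, y))
    (by unfold dotProduct; fun_prop)
    (fun x => Complex.norm_exp_ofReal_mul_I _)
    (by fun_prop)
    (fun x hx => ⟨⟨(rep_mem m).1, hx.1⟩, ⟨(rep_mem m).2, hx.2⟩⟩)

theorem hasFDerivAt_dot {n : ℕ} (a x : Vec n) :
    ∃ A : Vec n →L[ℝ] ℝ, HasFDerivAt (fun z : Vec n => a ⬝ᵥ z) A x ∧ ∀ w, A w = a ⬝ᵥ w := by
  let A : Vec n →ₗ[ℝ] ℝ :=
    { toFun := fun q => a ⬝ᵥ q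
      map_add' := fun u v => dotProduct_add a u v
      map_smul' := fun c u => by simp }
  exact ⟨LinearMap.toContinuousLinearMap A,
    (LinearMap.toContinuousLinearMap A).hasFDerivAt, fun w => rfl⟩

theorem exp_half_period {n k : ℕ} (m : Fin n → ZMod k) (i : Fin n) :
    Complex.exp ((Real.pi * (m i).val : ℝ) * Complex.I) *
      conj (Complex.exp ((-(Real.pi * (m i).val) : ℝ) * Complex.I)) = 1 := by
  rw [← Complex.exp_conj, ← Complex.exp_add, Complex.exp_eq_one_iff]
  refine ⟨(m i).val, ?_⟩
  simp
  ring

theorem fibreX_mem {n : ℕ} (k : ℕ) [NeZero k] (m : Fin n → ZMod k) : fibreX k m ∈ HX n k := by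
  intro i t
  have hk : (k : ℂ) ≠ 0 := by exact_mod_cast NeZero.ne k
  let q : Vec n := (k : ℝ)⁻¹ • rep m
  let g : Vec n → ℂ := fun x =>
    Complex.exp ((Real.pi * (rep m ⬝ᵥ x) : ℝ) * Complex.I) * conj (t.1 (x, q))
  have hd : ∀ x, HasFDerivAt g (fderiv ℝ g x) x ∧ fderiv ℝ g x (Pi.single i 1) =
      Complex.exp ((Real.pi * (rep m ⬝ᵥ x) : ℝ) * Complex.I) *
        conj ((covDeriv (dirX i) t).1 (x, q)) := by
    intro x
    obtain ⟨A, hA, hA'⟩ := hasFDerivAt_dot (rep m) x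
    have h1 := ((Complex.ofRealCLM.hasFDerivAt.comp x (hA.const_mul Real.pi)).mul_const
      Complex.I).cexp
    have ht := (t.2.1.differentiable (by simp) (x, q)).hasFDerivAt
    have h2 := Complex.conjCLE.toContinuousLinearMap.hasFDerivAt.comp x
      (ht.comp x ((hasFDerivAt_id x).prodMk (hasFDerivAt_const q x)))
    have h3 := h1.mul h2
    refine ⟨h3.differentiableAt.hasFDerivAt, ?_⟩
    have h4 : fderiv ℝ g x = _ := h3.fderiv
    rw [h4]
    simp [covDeriv, hA', dirX, q, rep]
    field_simp
  have hg : ContDiff ℝ 1 g := by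
    refine ContDiff.mul (ContDiff.cexp ?_) ?_
    · refine ContDiff.mul (Complex.ofRealCLM.contDiff.comp (contDiff_const.mul ?_)) contDiff_const
      unfold dotProduct
      exact ContDiff.sum fun i _ => contDiff_const.mul (contDiff_apply ℝ ℝ i)
    · exact Complex.conjCLE.contDiff.comp
        ((t.2.1.of_le (by exact_mod_cast le_top)).comp (contDiff_id.prodMk contDiff_const))
  have hper : ∀ x, g (x + Pi.single i 1) = g x := by
    intro x
    have h1 := t.2.2 (x, q) (Pi.single i 1, 0)
    have h2 : ((x, q) : Phase n) + latVec (Pi.single i 1, 0) = (x + Pi.single i 1, q) := by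
      ext j
      · simp [latVec, Pi.single_apply]
      · simp [latVec]
    rw [h2] at h1
    have h3 : multiplier k (Pi.single i 1, 0) ((x, q) : Phase n)
        = Complex.exp ((-(Real.pi * (m i).val) : ℝ) * Complex.I) := by
      have : (fun j => ((Pi.single i (1 : ℤ) : Fin n → ℤ) j : ℝ)) = Pi.single i 1 := by
        ext j; simp [Pi.single_apply]
      have h0 : (fun _ : Fin n => (0 : ℝ)) = 0 := rfl
      simp [multiplier, semiChar, symp, latVec, q, rep, this, h0]
      congr 1
      field_simp
    have h4 := exp_half_period m i
    change Complex.exp ((Real.pi * (rep m ⬝ᵥ (x + Pi.single i 1)) : ℝ) * Complex.I)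
      * conj (t.1 (x + Pi.single i 1, q)) = _
    rw [h1, h3, dotProduct_add, map_mul]
    have h5 : Complex.exp ((Real.pi * (rep m ⬝ᵥ x + rep m ⬝ᵥ Pi.single i 1) : ℝ) * Complex.I)
        = Complex.exp ((Real.pi * (rep m ⬝ᵥ x) : ℝ) * Complex.I)
          * Complex.exp ((Real.pi * (m i).val : ℝ) * Complex.I) := by
      rw [← Complex.exp_add]; congr 1; simp [rep]; ring
    rw [h5]
    linear_combination (Complex.exp ((Real.pi * (rep m ⬝ᵥ x) : ℝ) * Complex.I)
      * conj (t.1 (x, q))) * h4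
  have h := integral_fderiv_periodic g hg i hper
  simp only [fun x => (hd x).2] at h
  exact h

theorem fibreY_mem {n : ℕ} (k : ℕ) [NeZero k] (m : Fin n → ZMod k) : fibreY k m ∈ HY n k := by
  intro i t
  have hk : (k : ℂ) ≠ 0 := by exact_mod_cast NeZero.ne k
  let q : Vec n := (k : ℝ)⁻¹ • rep m
  let g : Vec n → ℂ := fun x =>
    Complex.exp ((-(Real.pi * (rep m ⬝ᵥ x)) : ℝ) * Complex.I) * conj (t.1 (q, x))
  have hd : ∀ x, HasFDerivAt g (fderiv ℝ g x) x ∧ fderiv ℝ g x (Pi.single i 1) =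
      Complex.exp ((-(Real.pi * (rep m ⬝ᵥ x)) : ℝ) * Complex.I) *
        conj ((covDeriv (dirY i) t).1 (q, x)) := by
    intro x
    obtain ⟨A, hA, hA'⟩ := hasFDerivAt_dot (rep m) x
    have h1 := ((Complex.ofRealCLM.hasFDerivAt.comp x (hA.const_mul Real.pi).neg).mul_const
      Complex.I).cexp
    have ht := (t.2.1.differentiable (by simp) (q, x)).hasFDerivAt
    have h2 := Complex.conjCLE.toContinuousLinearMap.hasFDerivAt.comp x
      (ht.comp x ((hasFDerivAt_const q x).prodMk (hasFDerivAt_id x)))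
    have h3 := h1.mul h2
    refine ⟨h3.differentiableAt.hasFDerivAt, ?_⟩
    have h4 : fderiv ℝ g x = _ := h3.fderiv
    rw [h4]
    simp [covDeriv, hA', dirY, q, rep]
    field_simp
  have hg : ContDiff ℝ 1 g := by
    refine ContDiff.mul (ContDiff.cexp ?_) ?_
    · refine ContDiff.mul (Complex.ofRealCLM.contDiff.comp (contDiff_const.mul ?_).neg)
        contDiff_const
      unfold dotProduct
      exact ContDiff.sum fun i _ => contDiff_const.mul (contDiff_apply ℝ ℝ i)
    · exact Complex.conjCLE.contDiff.comp
        ((t.2.1.of_le (by exact_mod_cast le_top)).comp (contDiff_const.prodMk contDiff_id))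
  have hper : ∀ x, g (x + Pi.single i 1) = g x := by
    intro x
    have h1 := t.2.2 (q, x) (0, Pi.single i 1)
    have h2 : ((q, x) : Phase n) + latVec (0, Pi.single i 1) = (q, x + Pi.single i 1) := by
      ext j
      · simp [latVec]
      · simp [latVec, Pi.single_apply]
    rw [h2] at h1
    have h3 : multiplier k (0, Pi.single i 1) ((q, x) : Phase n)
        = Complex.exp ((Real.pi * (m i).val : ℝ) * Complex.I) := by
      have : (fun j => ((Pi.single i (1 : ℤ) : Fin n → ℤ) j : ℝ)) = Pi.single i 1 := by
        ext j; simp [Pi.single_apply]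
      have h0 : (fun _ : Fin n => (0 : ℝ)) = 0 := rfl
      simp [multiplier, semiChar, symp, latVec, q, rep, this, h0]
      congr 1
      field_simp
    have h4 := congrArg conj (exp_half_period m i)
    rw [map_mul, Complex.conj_conj, map_one] at h4
    change Complex.exp ((-(Real.pi * (rep m ⬝ᵥ (x + Pi.single i 1))) : ℝ) * Complex.I)
      * conj (t.1 (q, x + Pi.single i 1)) = _
    rw [h1, h3, dotProduct_add, map_mul]
    have h5 : Complex.exp ((-(Real.pi * (rep m ⬝ᵥ x + rep m ⬝ᵥ Pi.single i 1)) : ℝ) * Complex.I)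
        = Complex.exp ((-(Real.pi * (rep m ⬝ᵥ x)) : ℝ) * Complex.I)
          * Complex.exp ((-(Real.pi * (m i).val) : ℝ) * Complex.I) := by
      rw [← Complex.exp_add]; congr 1; simp [rep]; ring
    rw [h5]
    linear_combination (Complex.exp ((-(Real.pi * (rep m ⬝ᵥ x)) : ℝ) * Complex.I)
      * conj (t.1 (q, x))) * h4
  have h := integral_fderiv_periodic g hg i hper
  simp only [fun x => (hd x).2] at h
  exact h

/-- `ϑ^m`, the polarized section all of whose Weil-Brezin coefficients vanish except the `m`-th,
which is `(2k)^{-n/2}` times the Dirac distribution at `0`. -/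
def thetaX {n : ℕ} (k : ℕ) [NeZero k] (m : Fin n → ZMod k) : HX n k :=
  (((2 * k : ℝ) ^ (-(n : ℝ) / 2) : ℝ) : ℂ) • ⟨fibreX k m, fibreX_mem k m⟩

/-- `ϑ̌^m`, the polarized section all of whose Weil-Brezin coefficients vanish except the `m`-th,
which is the constant `2^{-n/2}`. This is the section
`2^{-n/2} e^{-kπ√-1 x·y} ∑_{p ≡ m mod k} e^{2π√-1 p·x}`, and by Poisson summation the sum is the
discrete Fourier transform `k^{-n} ∑_{j ∈ (ℤ/k)ⁿ} e^{2π√-1 m·j/k} δ_{x = j/k}` of the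
Bohr-Sommerfeld fibres. -/
def thetaY {n : ℕ} (k : ℕ) [NeZero k] (m : Fin n → ZMod k) : HY n k :=
  (((2 : ℝ) ^ (-(n : ℝ) / 2) : ℝ) : ℂ) • ((k : ℂ) ^ n)⁻¹ • ∑ j : Fin n → ZMod k,
    Complex.exp (2 * Real.pi * Complex.I * ((rep m ⬝ᵥ rep j : ℝ) : ℂ) / k) •
      (⟨fibreY k j, fibreY_mem k j⟩ : HY n k)

/-- The basis states `σ^m = 2^{n/4} k^{n/2} ϑ^m ⊗ ρ` of `H^ħ`. -/
def sigmaX {n : ℕ} (k : ℕ) [NeZero k] (m : Fin n → ZMod k) : HX n k :=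
  (((2 : ℝ) ^ ((n : ℝ) / 4) * (k : ℝ) ^ ((n : ℝ) / 2) : ℝ) : ℂ) • thetaX k m

/-- The basis states `σ̌^m = 2^{n/4} k^{n/2} ϑ̌^m ⊗ ρ̌` of `Ȟ^ħ`. -/
def sigmaY {n : ℕ} (k : ℕ) [NeZero k] (m : Fin n → ZMod k) : HY n k :=
  (((2 : ℝ) ^ ((n : ℝ) / 4) * (k : ℝ) ^ ((n : ℝ) / 2) : ℝ) : ℂ) • thetaY k m

/-! ### The pairing of distributional sections -/

/-- Compactly supported smooth functions on `ℝ²ⁿ`. -/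
structure Cutoff (n : ℕ) where
  /-- the underlying function -/
  toFun : Phase n → ℂ
  smooth : ContDiff ℝ ∞ toFun
  compact : HasCompactSupport toFun

theorem finite_latVec_bounded {n : ℕ} (R : ℝ) : {l : Lattice n | ‖latVec l‖ ≤ R}.Finite := by
  have hf := Set.finite_Icc (fun _ : Fin n => -⌈R⌉) (fun _ => ⌈R⌉)
  refine Set.Finite.subset (hf.prod hf) ?_
  intro l hl
  have hl' : ‖latVec l‖ ≤ R := hl
  have h1 : ∀ i, |(l.1 i : ℝ)| ≤ R := fun i =>
    ((norm_le_pi_norm (latVec l).1 i).trans (norm_fst_le (latVec l))).trans hl'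
  have h2 : ∀ i, |(l.2 i : ℝ)| ≤ R := fun i =>
    ((norm_le_pi_norm (latVec l).2 i).trans (norm_snd_le (latVec l))).trans hl'
  have h3 : ∀ z : ℤ, |(z : ℝ)| ≤ R → -⌈R⌉ ≤ z ∧ z ≤ ⌈R⌉ := by
    intro z hz
    have h4 := abs_le.1 (hz.trans (Int.le_ceil R))
    exact ⟨by exact_mod_cast h4.1, by exact_mod_cast h4.2⟩
  exact ⟨⟨fun i => (h3 _ (h1 i)).1, fun i => (h3 _ (h1 i)).2⟩,
    ⟨fun i => (h3 _ (h2 i)).1, fun i => (h3 _ (h2 i)).2⟩⟩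

/-- The smooth section of `L^{⊗k}` obtained from a compactly supported function `φ` on `ℝ²ⁿ` by
summation over the action of `ℤ²ⁿ`; it satisfies `∫_X s · conj(periodize φ) = ∫_{ℝ²ⁿ} s · conj φ`
for smooth sections `s`. -/
def periodize {n : ℕ} (k : ℕ) (φ : Cutoff n) : SmoothSec n k :=
  ⟨fun u => ∑' l : Lattice n, (multiplier k l u)⁻¹ * φ.toFun (u + latVec l), by
    refine ⟨contDiff_iff_contDiffAt.2 fun u₀ => ?_, fun u m => ?_⟩
    · obtain ⟨R, hR⟩ := φ.compact.isCompact.isBounded.exists_norm_le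
      have hfin := finite_latVec_bounded (n := n) (R + (‖u₀‖ + 1))
      have hev : (fun u => ∑' l : Lattice n, (multiplier k l u)⁻¹ * φ.toFun (u + latVec l))
          =ᶠ[nhds u₀] fun u => ∑ l ∈ hfin.toFinset,
            (multiplier k l u)⁻¹ * φ.toFun (u + latVec l) := by
        filter_upwards [Metric.ball_mem_nhds u₀ one_pos] with u hu
        refine tsum_eq_sum fun l hl => ?_
        have h0 : φ.toFun (u + latVec l) = 0 := by
          by_contra h
          apply hl
          have h1 := hR _ (subset_tsupport _ h)
          have h2 : ‖u‖ ≤ ‖u₀‖ + 1 := by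
            have h3 : ‖u - u₀‖ < 1 := by simpa [dist_eq_norm] using hu
            have h4 := norm_add_le (u - u₀) u₀
            rw [sub_add_cancel] at h4
            linarith
          have h5 : ‖latVec l‖ ≤ ‖u + latVec l‖ + ‖u‖ := by
            have := norm_sub_le (u + latVec l) u
            rwa [add_sub_cancel_left] at this
          simp only [Set.Finite.mem_toFinset, Set.mem_ofPred_eq]
          linarith
        rw [h0, mul_zero]
      refine ContDiffAt.congr_of_eventuallyEq ?_ hev
      refine ContDiff.contDiffAt (ContDiff.sum fun l _ => ?_)
      exact ((contDiff_multiplier k l).inv (multiplier_ne_zero k l)).mul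
        (φ.smooth.comp (contDiff_id.add contDiff_const))
    · change ∑' l : Lattice n, (multiplier k l (u + latVec m))⁻¹
          * φ.toFun (u + latVec m + latVec l)
        = multiplier k m u * ∑' l : Lattice n, (multiplier k l u)⁻¹ * φ.toFun (u + latVec l)
      rw [← (Equiv.addRight m).tsum_eq
        (fun l : Lattice n => (multiplier k l u)⁻¹ * φ.toFun (u + latVec l)), ← tsum_mul_left]
      refine tsum_congr fun l => ?_
      have h1 := multiplier_ne_zero k m u
      have h2 := multiplier_ne_zero k l (u + latVec m)
      rw [Equiv.coe_addRight, multiplier_add, latVec_add, add_assoc u, add_comm (latVec m)]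
      field_simp⟩

/-- The function `conj(χ) e^{2π√-1 ζ·p}` of `p ∈ ℝ²ⁿ`. -/
def waveCutoff {n : ℕ} (χ : Cutoff n) (ζ : Phase n) : Cutoff n where
  toFun p := conj (χ.toFun p) *
    Complex.exp (2 * Real.pi * Complex.I * ((ζ.1 ⬝ᵥ p.1 + ζ.2 ⬝ᵥ p.2 : ℝ) : ℂ))
  smooth := by
    refine (Complex.conjCLE.contDiff.comp χ.smooth).mul (ContDiff.cexp (contDiff_const.mul ?_))
    exact Complex.ofRealCLM.contDiff.comp
      ((contDiff_dot contDiff_const contDiff_fst).add (contDiff_dot contDiff_const contDiff_snd))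
  compact := by
    have h : HasCompactSupport fun p => conj (χ.toFun p) :=
      χ.compact.comp_left (g := fun z : ℂ => conj z) (map_zero _)
    exact h.mul_right

/-- The Fourier transform at `ζ` of the compactly supported distribution `χ u` on `ℝ²ⁿ`, where `u`
is regarded as a quasi-periodic distribution; for smooth `u` it is
`∫_{ℝ²ⁿ} χ(p) u(p) e^{-2π√-1 ζ·p} dp`. -/
def localFourier {n k : ℕ} (χ : Cutoff n) (u : DistSec n k) (ζ : Phase n) : ℂ :=
  u.1 (periodize k (waveCutoff χ ζ))

/-- The sesquilinear pairing `⟨u, v⟩ = ∫_X u v̄` of distributional sections is defined and equal to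
`c`. As in the definition of products of distributions with disjoint wavefront sets, it is computed
by Parseval's formula on localizations: for all cutoffs `χ, ψ` such that the translates of `χ ψ̄`
sum up to `1`, the integral of `F(χ u) conj(F(ψ v))` converges absolutely, with value `c`. -/
def HasPairing {n k : ℕ} (u v : DistSec n k) (c : ℂ) : Prop :=
  ∀ χ ψ : Cutoff n,
    (∀ p : Phase n,
      ∑' l : Lattice n, χ.toFun (p + latVec l) * conj (ψ.toFun (p + latVec l)) = 1) →
    Integrable (fun ζ : Phase n => localFourier χ u ζ * conj (localFourier ψ v ζ)) ∧
      ∫ ζ : Phase n, localFourier χ u ζ * conj (localFourier ψ v ζ) = c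

open scoped Classical in
/-- The pairing `⟨u, v⟩` of distributional sections (zero where it is not defined). -/
def pairing {n k : ℕ} (u v : DistSec n k) : ℂ :=
  if h : ∃! c, HasPairing u v c then h.choose else 0

/-- The pairing `⟨ρ, ρ̌⟩ = ⟨ρ̌, ρ⟩` of half-forms, the positive square root of the pairing
`2ⁿ k^{-n}` of the corresponding `n`-forms. -/
def halfForm (n k : ℕ) : ℝ := Real.sqrt (2 ^ n / (k : ℝ) ^ n)

/-- The pairing of sections twisted by the half-forms `ρ`, `ρ̌` of the two polarizations (in either
order), which extends the BKS pairing. -/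
def bksPairing {n k : ℕ} (u v : DistSec n k) : ℂ := (halfForm n k : ℂ) * pairing u v

/-! ### Toeplitz operators and the Fourier-type transform -/

/-- The projection `Π^ħ s = ∑ₘ ⟨s, σ̌^m⟩ σ^m` onto `H^ħ`. -/
def projX {n k : ℕ} [NeZero k] (s : DistSec n k) : HX n k :=
  ∑ m : Fin n → ZMod k, bksPairing s (sigmaY k m).1 • sigmaX k m

/-- The projection `Π̌^ħ s = ∑ₘ ⟨s, σ^m⟩ σ̌^m` onto `Ȟ^ħ`. -/
def projY {n k : ℕ} [NeZero k] (s : DistSec n k) : HY n k :=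
  ∑ m : Fin n → ZMod k, bksPairing s (sigmaX k m).1 • sigmaY k m

/-- The Toeplitz operator `Q_f s = Π^ħ(f s)` on `H^ħ`. -/
def toeplitzX {n k : ℕ} [NeZero k] (f : SmoothFn n) (s : HX n k) : HX n k :=
  projX (mulDist f s.1)

/-- The Toeplitz operator `Q̌_f s = Π̌^ħ(f s)` on `Ȟ^ħ`. -/
def toeplitzY {n k : ℕ} [NeZero k] (f : SmoothFn n) (s : HY n k) : HY n k :=
  projY (mulDist f s.1)

/-- All pairings in the definition of the operators `Q_f` and `Q̌_f` exist. -/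
def PairingsDefined (n k : ℕ) [NeZero k] : Prop :=
  ∀ (f : SmoothFn n) (m : Fin n → ZMod k),
    (∀ s : HX n k, ∃! c, HasPairing (mulDist f s.1) (sigmaY k m).1 c) ∧
    (∀ s : HY n k, ∃! c, HasPairing (mulDist f s.1) (sigmaX k m).1 c)

/-- `B` is the BKS map `Ȟ^ħ → H^ħ`, `B σ̌^m = σ^m`. -/
def IsBKSMap {n k : ℕ} [NeZero k] (B : HY n k ≃ₗ[ℂ] HX n k) : Prop :=
  ∀ m : Fin n → ZMod k, B (sigmaY k m) = sigmaX k m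

/-- Conjugation of operators by `B`. -/
def conjBy {n k : ℕ} (B : HY n k ≃ₗ[ℂ] HX n k) (A : HY n k → HY n k) : HX n k → HX n k :=
  fun s => B (A (B.symm s))

/-- The norm of `H^ħ`, for which the basis `σ^m` is orthonormal; the coordinates of a state `s` in
this basis are the pairings `⟨s, σ̌^m⟩` with the dual basis. -/
def stateNorm {n k : ℕ} [NeZero k] (s : HX n k) : ℝ :=
  Real.sqrt (∑ m : Fin n → ZMod k, ‖bksPairing s.1 (sigmaY k m).1‖ ^ 2)

/-- `A` is a linear operator on `H^ħ` of operator norm at most `C`. -/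
def OpNormLE {n k : ℕ} [NeZero k] (A : HX n k → HX n k) (C : ℝ) : Prop :=
  IsLinearMap ℂ A ∧ ∀ s, stateNorm (A s) ≤ C * stateNorm s

end TorusQuant

end

/-!
The theorem compares two matrices. In the basis `σ^m` the operator `Q_f` has the matrix
`k⁻ⁿ ∑ⱼ e^{2πi(m' - m)·j/k} f(j/k, m'/k)`, and in the basis `σ̌^m` the operator `Q̌_f` has the same
matrix with `f` evaluated at `(j/k, m/k)` instead (`matrixX`, `matrixY`). For the character
`f = e^{2πi(p·x + q·y)}` only the entries with `m' = m - p` are nonzero, they have modulus one, and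
the two matrices differ by the scalar `e^{2πi p·q/k}` (`matrixY_wave`). This is exactly the effect
of `e^{-ħΔ}` on that character, so the truncation at order `N` leaves the Taylor remainder of the
exponential at `2πi p·q/k`, which is at most a constant times `|p·q|^{N+1} ħ^{N+1}`. Since the matrix
of a character is unitary, the operator norm of the difference for a general `f` is at most the sum
over `(p, q)` of these remainders times `|f_{pq}|`; it is finite because `|p·q|^{N+1} |f_{pq}|` is,
up to a constant, the modulus of a Fourier coefficient of the smooth function `Δ^{N+1} f`
(`norm_mulVec_sub_le`, `summable_norm_fourierCoef`, `hasSum_fourierCoef`).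

To get to the matrices one needs two facts about distributional sections.

The first is that the unit sections of the Bohr-Sommerfeld fibres span the quantum spaces
(`HX.mem_span_fibreX`). A polarized functional `s` is invariant under parallel transport along
`∂/∂xⁱ`: it does not change when a section is averaged over the closed leaves
(`HX.apply_averageX`), and, transport once around a leaf being multiplication by `e^{-2πikyᵢ}`, it
kills the multiples of `e^{-2πikyᵢ} - 1` (`HX.apply_holonomyDefect_mul`). By Hadamard's lemma these
are all the sections vanishing on the hyperplanes `kyᵢ ∈ ℤ`, so a section may be replaced by an
extension of its restriction to them (`HX.apply_roundSec`). After doing both in all coordinates, a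
section whose integral over each fibre is zero has become zero. Hence `s` is determined by these
integrals, and it is a linear combination of the unit sections by linear algebra. The antilinear
involution `t(x, y) ↦ conj t(y, x)` carries this, and everything else, to the other polarization.

The second is the pairing of two transversal fibres (`hasPairing_fibreX_fibreY`). A localization of
`f · fibreX k m` is a finite sum of smooth densities on the subspaces `y = m/k + b`
(`exists_localFourier_fibreX`), so its Fourier transform is a sum of products of a Schwartz function
of the first frequency variable and a character of the second; for `fibreY k j` the roles are
exchanged. The integral in Parseval's formula therefore factors, and Fourier inversion turns it into
a sum over the lattice translates of the intersection point `(j/k, m/k)`, where the weights of the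
two cutoffs add up to one.
-/

noncomputable section

namespace TorusQuant

/-! ### Integrals depending on parameters and division of smooth functions -/

theorem hasFDerivAt_intervalIntegral_param {E F : Type} [NormedAddCommGroup E] [NormedSpace ℝ E]
    [ProperSpace E] [NormedAddCommGroup F] [NormedSpace ℝ F] {G : E × ℝ → F}
    (hG : ContDiff ℝ 1 G) (p : E) :
    HasFDerivAt (fun q => ∫ σ in (0 : ℝ)..1, G (q, σ))
      (∫ σ in (0 : ℝ)..1, (fderiv ℝ G (p, σ)).comp (ContinuousLinearMap.inl ℝ E ℝ)) p := by
  have hc : Continuous fun z : E × ℝ =>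
      (fderiv ℝ G z).comp (ContinuousLinearMap.inl ℝ E ℝ) :=
    (hG.continuous_fderiv (by simp)).clm_comp continuous_const
  obtain ⟨C, hC⟩ := ((isCompact_closedBall p 1).prod (isCompact_Icc (a := (0 : ℝ))
    (b := 1))).exists_bound_of_continuousOn hc.continuousOn
  have hcp : ∀ q : E, Continuous fun σ : ℝ => G (q, σ) := fun q =>
    hG.continuous.comp (by fun_prop)
  refine intervalIntegral.hasFDerivAt_integral_of_dominated_of_fderiv_le
    (F := fun q σ => G (q, σ)) (bound := fun _ => C) (Metric.ball_mem_nhds p one_pos)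
    (F' := fun q σ => (fderiv ℝ G (q, σ)).comp (ContinuousLinearMap.inl ℝ E ℝ))
    (Filter.Eventually.of_forall fun q => (hcp q).aestronglyMeasurable)
    ((hcp p).intervalIntegrable _ _)
    (hc.comp (by fun_prop : Continuous fun σ : ℝ => (p, σ))).aestronglyMeasurable
    ?_ intervalIntegrable_const ?_
  · refine Filter.Eventually.of_forall fun σ hσ q hq => hC (q, σ) ⟨Metric.ball_subset_closedBall hq, ?_⟩
    rw [Set.uIoc_of_le zero_le_one] at hσ
    exact ⟨hσ.1.le, hσ.2⟩
  · refine Filter.Eventually.of_forall fun σ _ q _ => ?_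
    have h1 := (hG.differentiable (by simp) (q, σ)).hasFDerivAt
    exact h1.comp q (hasFDerivAt_prodMk_left q σ)

theorem contDiff_intervalIntegral_param {E : Type} [NormedAddCommGroup E] [NormedSpace ℝ E]
    [ProperSpace E] {F : Type} [NormedAddCommGroup F] [NormedSpace ℝ F] {G : E × ℝ → F}
    (hG : ContDiff ℝ ∞ G) : ContDiff ℝ ∞ fun q => ∫ σ in (0 : ℝ)..1, G (q, σ) := by
  refine contDiff_infty.2 fun m => ?_
  induction m generalizing F with
  | zero =>
    exact contDiff_zero.2 (continuous_iff_continuousAt.2 fun p =>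
      (hasFDerivAt_intervalIntegral_param (hG.of_le (by simp)) p).continuousAt)
  | succ m ih =>
    rw [Nat.cast_succ, contDiff_succ_iff_hasFDerivAt]
    refine ⟨_, ?_, fun p => hasFDerivAt_intervalIntegral_param (hG.of_le (by simp)) p⟩
    exact ih (G := fun z => (fderiv ℝ G z).comp (ContinuousLinearMap.inl ℝ E ℝ))
      ((hG.fderiv_right (m := ∞) (by simp)).clm_comp contDiff_const)

/-- The quotient in Hadamard's lemma: with `h` affine and increasing at unit rate along `e`, a
smooth `g` vanishing on `{h = 0}` is `h` times a smooth function, whose value on `{h = 0}` is the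
derivative of `g` along `e`. -/
theorem exists_hadamard_quotient {E : Type} [NormedAddCommGroup E] [NormedSpace ℝ E]
    [ProperSpace E] {g : E → ℂ} (hg : ContDiff ℝ ∞ g) (e : E) {h : E → ℝ} (hh : ContDiff ℝ ∞ h)
    (h0 : ∀ p, g (p - h p • e) = 0) :
    ∃ J : E → ℂ, ContDiff ℝ ∞ J ∧ (∀ p, g p = h p * J p) ∧
      ∀ p, h p = 0 → J p = fderiv ℝ g p e := by
  let q : E × ℝ → E := fun z => z.1 - ((1 - z.2) * h z.1) • e
  have hq : ContDiff ℝ ∞ q :=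
    contDiff_fst.sub (((contDiff_const.sub contDiff_snd).mul (hh.comp contDiff_fst)).smul
      contDiff_const)
  have hG : ContDiff ℝ ∞ fun z => fderiv ℝ g (q z) e :=
    ((hg.fderiv_right (m := ∞) (by simp)).comp hq).clm_apply contDiff_const
  refine ⟨fun p => ∫ σ in (0 : ℝ)..1, fderiv ℝ g (q (p, σ)) e,
    contDiff_intervalIntegral_param hG, fun p => ?_, fun p hp => by simp [q, hp]⟩
  have hd : ∀ σ : ℝ, HasDerivAt (fun σ => g (q (p, σ))) (h p * fderiv ℝ g (q (p, σ)) e) σ := by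
    intro σ
    have h1 : HasDerivAt (fun σ : ℝ => q (p, σ)) (h p • e) σ := by
      have := ((((hasDerivAt_id σ).const_sub 1).mul_const (h p)).smul_const e).const_sub p
      simpa [q] using this
    have h2 := (hg.differentiable (by simp) (q (p, σ))).hasFDerivAt.comp_hasDerivAt σ h1
    exact h2.congr_deriv (by simp)
  have hi := intervalIntegral.integral_eq_sub_of_hasDerivAt (a := 0) (b := 1) (fun σ _ => hd σ)
    (Continuous.intervalIntegrable (continuous_const.mul (hG.continuous.comp
      (by fun_prop : Continuous fun σ : ℝ => (p, σ)))) _ _)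
  rw [intervalIntegral.integral_const_mul] at hi
  simpa [q, h0] using hi.symm

/-- The function `e^{-2πikyᵢ} - 1`, whose zero set is the union of the hyperplanes `kyᵢ ∈ ℤ`. -/
def holonomyDefect {n : ℕ} (k : ℕ) (i : Fin n) (p : Phase n) : ℂ :=
  Complex.exp ((-(2 * Real.pi * k * p.2 i) : ℝ) * Complex.I) - 1

theorem contDiff_snd_apply {n : ℕ} (i : Fin n) : ContDiff ℝ ∞ fun p : Phase n => p.2 i :=
  (contDiff_apply ℝ ℝ i).comp contDiff_snd

theorem contDiff_holonomyDefect {n : ℕ} (k : ℕ) (i : Fin n) :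
    ContDiff ℝ ∞ (holonomyDefect k i : Phase n → ℂ) := by
  unfold holonomyDefect
  refine ContDiff.sub (ContDiff.cexp (ContDiff.mul ?_ contDiff_const)) contDiff_const
  exact Complex.ofRealCLM.contDiff.comp (contDiff_const.mul (contDiff_snd_apply i)).neg

theorem holonomyDefect_eq_zero_iff {n k : ℕ} {i : Fin n} {p : Phase n} :
    holonomyDefect k i p = 0 ↔ ∃ r : ℤ, k * p.2 i = r := by
  rw [holonomyDefect, sub_eq_zero, Complex.exp_eq_one_iff]
  have hpi : (Real.pi : ℂ) ≠ 0 := by exact_mod_cast Real.pi_ne_zero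
  have key : ∀ r : ℤ, ((-(2 * Real.pi * k * p.2 i) : ℝ) * Complex.I
      = (-r : ℤ) * (2 * Real.pi * Complex.I)) ↔ k * p.2 i = r := by
    intro r
    rw [show ((-(2 * Real.pi * k * p.2 i) : ℝ) : ℂ) * Complex.I
      = (-((k * p.2 i : ℝ) : ℂ)) * (2 * Real.pi * Complex.I) by push_cast; ring]
    rw [mul_left_inj' (by simp), Int.cast_neg, neg_inj]
    exact_mod_cast Iff.rfl
  constructor
  · rintro ⟨r, hr⟩
    exact ⟨-r, (key (-r)).1 (by simpa using hr)⟩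
  · rintro ⟨r, hr⟩
    exact ⟨-r, (key r).2 hr⟩

theorem fderiv_holonomyDefect {n k : ℕ} {i : Fin n} {p : Phase n}
    (hp : holonomyDefect k i p = 0) :
    fderiv ℝ (holonomyDefect k i) p (dirY i) = -(2 * Real.pi * k * Complex.I) := by
  have h1 : HasFDerivAt (fun p : Phase n => p.2 i)
      ((ContinuousLinearMap.proj i).comp (ContinuousLinearMap.snd ℝ (Vec n) (Vec n))) p :=
    ((ContinuousLinearMap.proj i).comp (ContinuousLinearMap.snd ℝ (Vec n) (Vec n))).hasFDerivAt
  have h2 := (((Complex.ofRealCLM.hasFDerivAt.comp p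
    (h1.const_mul (2 * Real.pi * k)).neg).mul_const Complex.I).cexp).sub_const 1
  have h3 : fderiv ℝ (holonomyDefect k i) p = _ := h2.fderiv
  have h4 : Complex.exp ((-(2 * Real.pi * k * p.2 i) : ℝ) * Complex.I) = 1 := sub_eq_zero.1 hp
  rw [h3]
  change (Complex.exp ((-(2 * Real.pi * k * p.2 i) : ℝ) * Complex.I) • (_ : Phase n →L[ℝ] ℂ)) (dirY i) = _
  rw [h4]
  simp [dirY]
  ring

/-- A smooth function vanishing on the hyperplanes `kyᵢ ∈ ℤ` is divisible by
`e^{-2πikyᵢ} - 1`. -/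
theorem exists_holonomyDefect_mul {n k : ℕ} [NeZero k] {i : Fin n} {g : Phase n → ℂ}
    (hg : ContDiff ℝ ∞ g) (h0 : ∀ p, holonomyDefect k i p = 0 → g p = 0) :
    ∃ h : Phase n → ℂ, ContDiff ℝ ∞ h ∧ ∀ p, g p = holonomyDefect k i p * h p := by
  classical
  have hk : (k : ℝ) ≠ 0 := by exact_mod_cast NeZero.ne k
  let E : Phase n → ℂ := holonomyDefect k i
  have hE : ContDiff ℝ ∞ E := contDiff_holonomyDefect k i
  let h : Phase n → ℂ := fun p =>
    if E p = 0 then fderiv ℝ g p (dirY i) / fderiv ℝ E p (dirY i) else g p / E p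
  refine ⟨h, contDiff_iff_contDiffAt.2 fun p₀ => ?_, fun p => ?_⟩
  · by_cases hp : E p₀ = 0
    · obtain ⟨r, hr⟩ := holonomyDefect_eq_zero_iff.1 hp
      let δ : Phase n → ℝ := fun p => p.2 i - r / k
      have hδ : ContDiff ℝ ∞ δ := (contDiff_snd_apply i).sub contDiff_const
      have hz : ∀ p, δ p = 0 → E p = 0 := fun p hp => holonomyDefect_eq_zero_iff.2 ⟨r, by
        have : p.2 i = r / k := sub_eq_zero.1 hp
        rw [this]; field_simp⟩
      have hz' : ∀ p, E (p - δ p • dirY i) = 0 := fun p => hz _ (by simp [δ, dirY])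
      obtain ⟨J, hJ, hJ1, hJ2⟩ := exists_hadamard_quotient hg (dirY i) hδ fun p => h0 _ (hz' p)
      obtain ⟨L, hL, hL1, hL2⟩ := exists_hadamard_quotient hE (dirY i) hδ hz'
      have hδ0 : δ p₀ = 0 := by
        simp only [δ]; rw [← hr]; field_simp; ring
      have hL0 : L p₀ ≠ 0 := by
        rw [hL2 _ hδ0, fderiv_holonomyDefect hp]
        have : (k : ℂ) ≠ 0 := by exact_mod_cast NeZero.ne k
        simp [this, Real.pi_ne_zero]
      refine ((hJ.contDiffAt (x := p₀)).mul (hL.contDiffAt.inv hL0)).congr_of_eventuallyEq ?_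
      filter_upwards [hL.continuous.continuousAt.eventually_ne hL0] with p hp'
      by_cases hd : δ p = 0
      · simp [h, hz p hd, hJ2 p hd, hL2 p hd, div_eq_mul_inv]
      · have hd' : (δ p : ℂ) ≠ 0 := by exact_mod_cast hd
        have h1 : E p ≠ 0 := by rw [hL1]; exact mul_ne_zero hd' hp'
        simp only [h, if_neg h1]
        rw [hJ1, hL1, mul_div_mul_left _ _ hd', div_eq_mul_inv, Pi.inv_apply]
    · refine ((hg.contDiffAt (x := p₀)).mul (hE.contDiffAt.inv hp)).congr_of_eventuallyEq ?_
      filter_upwards [hE.continuous.continuousAt.eventually_ne hp] with p hp'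
      simp [h, hp', div_eq_mul_inv]
  · change g p = E p * h p
    by_cases hp : E p = 0
    · rw [h0 p hp, hp, zero_mul]
    · simp only [h, if_neg hp]; field_simp

/-! ### Averaging along the leaves of the polarization -/

/-- Parallel transport of the section `t` along `∂/∂xⁱ`, pulled back to the base point: the value
at `(p, σ)` is that of `t` at `p + σ ∂/∂xⁱ`, transported to `p`. -/
def transX {n : ℕ} (k : ℕ) (i : Fin n) (t : Phase n → ℂ) (z : Phase n × ℝ) : ℂ :=
  Complex.exp ((-(Real.pi * k * z.2 * z.1.2 i) : ℝ) * Complex.I) * t (z.1 + z.2 • dirX i)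

theorem contDiff_transX {n : ℕ} (k : ℕ) (i : Fin n) {t : Phase n → ℂ} (ht : ContDiff ℝ ∞ t) :
    ContDiff ℝ ∞ (transX k i t) := by
  unfold transX
  refine ContDiff.mul (ContDiff.cexp (ContDiff.mul (Complex.ofRealCLM.contDiff.comp ?_)
    contDiff_const)) (ht.comp (contDiff_fst.add (contDiff_snd.smul contDiff_const)))
  exact ((contDiff_const.mul contDiff_snd).mul ((contDiff_snd_apply i).comp contDiff_fst)).neg

theorem symp_dirX {n : ℕ} (i : Fin n) (v : Phase n) : symp (dirX i) v = -v.2 i := by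
  simp [symp, dirX]

theorem symp_dirY {n : ℕ} (i : Fin n) (v : Phase n) : symp (dirY i) v = v.1 i := by
  simp [symp, dirY]

theorem multiplier_add_smul {n : ℕ} (k : ℕ) (l : Lattice n) (u v : Phase n) (τ : ℝ) :
    multiplier k l (u + τ • v) = multiplier k l u *
      Complex.exp (-(k * Real.pi * Complex.I * (τ * symp v (latVec l) : ℝ))) := by
  simp only [multiplier, symp_add_left, symp_smul_left, mul_assoc, ← Complex.exp_add]
  congr 2
  push_cast
  ring

theorem transX_add_latVec {n k : ℕ} (i : Fin n) (t : SmoothSec n k) (u : Phase n)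
    (l : Lattice n) (σ : ℝ) :
    transX k i t.1 (u + latVec l, σ) = multiplier k l u * transX k i t.1 (u, σ) := by
  simp only [transX]
  rw [add_right_comm, t.2.2, multiplier_add_smul, symp_dirX]
  have : Complex.exp ((-(Real.pi * k * σ * (u + latVec l).2 i) : ℝ) * Complex.I) *
      Complex.exp (-(k * Real.pi * Complex.I * (σ * -(latVec l).2 i : ℝ)))
      = Complex.exp ((-(Real.pi * k * σ * u.2 i) : ℝ) * Complex.I) := by
    rw [← Complex.exp_add]
    congr 1
    simp only [Prod.snd_add, Pi.add_apply]
    push_cast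
    ring
  rw [← this]
  ring

theorem hasDerivAt_transX {n k : ℕ} (i : Fin n) (t : SmoothSec n k) (p : Phase n) (σ : ℝ) :
    HasDerivAt (fun σ => transX k i t.1 (p, σ))
      (transX k i (covDeriv (dirX i) t).1 (p, σ)) σ := by
  have h1 : HasDerivAt (fun σ : ℝ => Complex.exp ((-(Real.pi * k * σ * p.2 i) : ℝ) * Complex.I))
      (Complex.exp ((-(Real.pi * k * σ * p.2 i) : ℝ) * Complex.I) *
        ((-(Real.pi * k * p.2 i) : ℝ) * Complex.I)) σ := by
    have h := (((((hasDerivAt_id σ).const_mul (Real.pi * k)).mul_const (p.2 i)).neg).ofReal_comp.mul_const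
      Complex.I).cexp
    simpa using h
  have h2 : HasDerivAt (fun σ : ℝ => t.1 (p + σ • dirX i))
      (fderiv ℝ t.1 (p + σ • dirX i) (dirX i)) σ := by
    have h := ((hasDerivAt_id σ).smul_const (dirX i)).const_add p
    exact ((t.2.1.differentiable (by simp) (p + σ • dirX i)).hasFDerivAt.comp_hasDerivAt σ
      h).congr_deriv (by simp)
  refine (h1.mul h2).congr_deriv ?_
  simp [transX, covDeriv, dirX]
  ring

/-- The weighted average `∫₀¹ w(σ) P_σ t dσ` of the parallel transports `P_σ` along `∂/∂xⁱ`. -/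
def averageX {n k : ℕ} (i : Fin n) (w : ℝ → ℂ) (hw : ContDiff ℝ ∞ w) (t : SmoothSec n k) :
    SmoothSec n k :=
  ⟨fun p => ∫ σ in (0 : ℝ)..1, w σ * transX k i t.1 (p, σ),
    contDiff_intervalIntegral_param (G := fun z => w z.2 * transX k i t.1 z)
      ((hw.comp contDiff_snd).mul (contDiff_transX k i t.2.1)), fun u l => by
      rw [← intervalIntegral.integral_const_mul]
      refine intervalIntegral.integral_congr fun σ _ => ?_
      simp only [transX_add_latVec]
      ring⟩

theorem covDeriv_averageX {n k : ℕ} (i : Fin n) (w : ℝ → ℂ) (hw : ContDiff ℝ ∞ w)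
    (t : SmoothSec n k) (p : Phase n) :
    (covDeriv (dirX i) (averageX i w hw t)).1 p =
      ∫ σ in (0 : ℝ)..1, w σ * transX k i (covDeriv (dirX i) t).1 (p, σ) := by
  have hG : ContDiff ℝ ∞ fun z => w z.2 * transX k i t.1 z :=
    (hw.comp contDiff_snd).mul (contDiff_transX k i t.2.1)
  have h1 := (hasFDerivAt_intervalIntegral_param (hG.of_le (by simp)) p).fderiv
  have h2 : ∀ σ, fderiv ℝ (fun z => w z.2 * transX k i t.1 z) (p, σ) (dirX i, 0) =
      w σ * (Complex.exp ((-(Real.pi * k * σ * p.2 i) : ℝ) * Complex.I)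
        * fderiv ℝ t.1 (p + σ • dirX i) (dirX i)) := by
    intro σ
    have ha : HasDerivAt (fun τ : ℝ => (p + τ • dirX i, σ)) ((dirX i, 0) : Phase n × ℝ) 0 := by
      have h := ((hasDerivAt_id (0 : ℝ)).smul_const (dirX i)).const_add p
      simpa using h.prodMk (hasDerivAt_const (0 : ℝ) σ)
    have hb := HasFDerivAt.comp_hasDerivAt_of_eq (0 : ℝ)
      (hG.differentiable (by simp) (p, σ)).hasFDerivAt ha (by simp)
    have hc : HasDerivAt (fun τ : ℝ => w σ * (Complex.exp ((-(Real.pi * k * σ * p.2 i) : ℝ) *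
        Complex.I) * t.1 (p + τ • dirX i + σ • dirX i)))
        (w σ * (Complex.exp ((-(Real.pi * k * σ * p.2 i) : ℝ) * Complex.I)
        * fderiv ℝ t.1 (p + σ • dirX i) (dirX i))) 0 := by
      refine HasDerivAt.const_mul _ (HasDerivAt.const_mul _ ?_)
      have h := (((hasDerivAt_id (0 : ℝ)).smul_const (dirX i)).const_add p).add_const (σ • dirX i)
      exact (HasFDerivAt.comp_hasDerivAt_of_eq (0 : ℝ)
        (t.2.1.differentiable (by simp) (p + σ • dirX i)).hasFDerivAt h (by simp)).congr_deriv
        (by simp)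
    refine hb.unique (hc.congr_of_eventuallyEq (Filter.Eventually.of_forall fun τ => ?_))
    simp [transX, dirX]
  have hc' : Continuous fun σ : ℝ => (fderiv ℝ (fun z => w z.2 * transX k i t.1 z) (p, σ)).comp
      (ContinuousLinearMap.inl ℝ (Phase n) ℝ) :=
    ((hG.continuous_fderiv (by simp)).comp (by fun_prop)).clm_comp continuous_const
  have h3 : fderiv ℝ (averageX i w hw t).1 p (dirX i) = ∫ σ in (0 : ℝ)..1,
      w σ * (Complex.exp ((-(Real.pi * k * σ * p.2 i) : ℝ) * Complex.I)
        * fderiv ℝ t.1 (p + σ • dirX i) (dirX i)) := by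
    change fderiv ℝ (fun q => ∫ σ in (0 : ℝ)..1, w σ * transX k i t.1 (q, σ)) p (dirX i) = _
    rw [h1, ContinuousLinearMap.intervalIntegral_apply (hc'.intervalIntegrable _ _)]
    refine intervalIntegral.integral_congr fun σ _ => ?_
    simpa using h2 σ
  change fderiv ℝ (averageX i w hw t).1 p (dirX i) - k * Real.pi * Complex.I *
    ((p.2 ⬝ᵥ (dirX i).1 - p.1 ⬝ᵥ (dirX i).2 : ℝ) : ℂ) *
      (∫ σ in (0 : ℝ)..1, w σ * transX k i t.1 (p, σ)) = _
  rw [h3, ← intervalIntegral.integral_const_mul, ← intervalIntegral.integral_sub]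
  · refine intervalIntegral.integral_congr fun σ _ => ?_
    simp [transX, covDeriv, dirX]
    ring
  · refine Continuous.intervalIntegrable ?_ _ _
    have h4 : Continuous fun σ : ℝ => fderiv ℝ t.1 (p + σ • dirX i) (dirX i) :=
      ((t.2.1.continuous_fderiv (by simp)).comp (by fun_prop)).clm_apply continuous_const
    have h5 := hw.continuous
    fun_prop
  · refine Continuous.intervalIntegrable (continuous_const.mul ?_) _ _
    exact hG.continuous.comp (by fun_prop : Continuous fun σ : ℝ => (p, σ))

theorem continuous_transX_right {n k : ℕ} (i : Fin n) (t : SmoothSec n k) (p : Phase n) :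
    Continuous fun σ : ℝ => transX k i t.1 (p, σ) :=
  (contDiff_transX k i t.2.1).continuous.comp (by fun_prop)

theorem transX_zero {n k : ℕ} (i : Fin n) (t : SmoothSec n k) (p : Phase n) :
    transX k i t.1 (p, 0) = t.1 p := by
  simp [transX]

theorem transX_one_sub {n k : ℕ} (i : Fin n) (t : SmoothSec n k) (p : Phase n) :
    transX k i t.1 (p, 1) - t.1 p = holonomyDefect k i p * t.1 p := by
  have h1 := t.2.2 p (Pi.single i 1, 0)
  have h2 : latVec (Pi.single i 1, 0) = (dirX i : Phase n) := by
    ext j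
    · simp [latVec, dirX, Pi.single_apply]
    · simp [latVec, dirX]
  have h3 : multiplier k (Pi.single i 1, 0) p
      = Complex.exp ((-(Real.pi * k * 1 * p.2 i) : ℝ) * Complex.I) := by
    rw [multiplier, symp_swap, h2, symp_dirX]
    simp [semiChar]
    congr 1
    ring
  rw [h2] at h1
  simp only [transX, one_smul]
  rw [h1, h3, holonomyDefect, ← mul_assoc, ← Complex.exp_add]
  rw [show ((-(Real.pi * k * 1 * p.2 i) : ℝ) : ℂ) * Complex.I
    + ((-(Real.pi * k * 1 * p.2 i) : ℝ) : ℂ) * Complex.I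
    = ((-(2 * Real.pi * k * p.2 i) : ℝ) : ℂ) * Complex.I by push_cast; ring]
  ring

/-- The derivative along a leaf of the plain average of `t` over a closed leaf is the difference
between the transport of `t` around the leaf and `t`. -/
theorem covDeriv_averageX_one {n k : ℕ} (i : Fin n) (t : SmoothSec n k) (p : Phase n) :
    (covDeriv (dirX i) (averageX i (fun _ => 1) contDiff_const t)).1 p =
      holonomyDefect k i p * t.1 p := by
  rw [covDeriv_averageX, ← transX_one_sub, ← transX_zero i t p]
  simp only [one_mul]
  exact intervalIntegral.integral_eq_sub_of_hasDerivAt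
    (fun σ _ => hasDerivAt_transX i t p σ)
    ((continuous_transX_right i _ p).intervalIntegrable _ _)

theorem contDiff_coe_complex : ContDiff ℝ ∞ fun σ : ℝ => (σ : ℂ) :=
  Complex.ofRealCLM.contDiff

theorem covDeriv_averageX_id {n k : ℕ} (i : Fin n) (t : SmoothSec n k) (p : Phase n) :
    (covDeriv (dirX i) (averageX i (fun σ => (σ : ℂ)) contDiff_coe_complex t)).1 p =
      holonomyDefect k i p * t.1 p + t.1 p
        - (averageX i (fun _ => 1) contDiff_const t).1 p := by
  rw [covDeriv_averageX, ← transX_one_sub]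
  have h := intervalIntegral.integral_eq_sub_of_hasDerivAt (a := 0) (b := 1)
    (fun σ _ => (hasDerivAt_id σ).ofReal_comp.mul (hasDerivAt_transX i t p σ))
    (Continuous.intervalIntegrable (by
      have h1 := continuous_transX_right i t p
      have h2 := continuous_transX_right i (covDeriv (dirX i) t) p
      simp only [id]
      fun_prop) _ _)
  simp only [id, Complex.ofReal_one, one_mul] at h
  rw [intervalIntegral.integral_add] at h
  · simp only [Pi.mul_apply, Complex.ofReal_one, one_mul, Complex.ofReal_zero, zero_mul, sub_zero] at h
    rw [sub_add_cancel, ← h]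
    simp [averageX]
  · exact (continuous_transX_right i t p).intervalIntegrable _ _
  · refine Continuous.intervalIntegrable ?_ _ _
    have h2 := continuous_transX_right i (covDeriv (dirX i) t) p
    fun_prop

theorem HX.apply_averageX {n k : ℕ} (s : HX n k) (i : Fin n) (t : SmoothSec n k) :
    s.1.1 (averageX i (fun _ => 1) contDiff_const t) = s.1.1 t := by
  have h : t - averageX i (fun _ => 1) contDiff_const t =
      covDeriv (dirX i) (averageX i (fun σ => (σ : ℂ)) contDiff_coe_complex t)
        - covDeriv (dirX i) (averageX i (fun _ => 1) contDiff_const t) := by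
    ext p
    change t.1 p - (averageX i (fun _ => 1) contDiff_const t).1 p = (covDeriv _ _).1 p
      - (covDeriv _ _).1 p
    rw [covDeriv_averageX_one, covDeriv_averageX_id]
    ring
  have h1 := congrArg s.1.1 h
  rw [map_sub, map_sub, s.2, s.2, sub_zero] at h1
  exact (sub_eq_zero.1 h1).symm

/-- A polarized distributional section is supported on the Bohr-Sommerfeld fibres to first
order. -/
theorem HX.apply_holonomyDefect_mul {n k : ℕ} (s : HX n k) (i : Fin n) {t t' : SmoothSec n k}
    (h : ∀ p, t'.1 p = holonomyDefect k i p * t.1 p) : s.1.1 t' = 0 := by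
  have h1 : t' = covDeriv (dirX i) (averageX i (fun _ => 1) contDiff_const t) := by
    ext p
    exact (h p).trans (covDeriv_averageX_one i t p).symm
  rw [h1]
  exact s.2 i _

/-! ### Localization at the Bohr-Sommerfeld fibres -/

/-- A smooth cutoff on `ℝ`, equal to `1` near `0` and supported in `[-1/3, 1/3]`. -/
def unitBump : ContDiffBump (0 : ℝ) := ⟨1 / 6, 1 / 3, by norm_num, by norm_num⟩

/-- The section which on the slab around a hyperplane `kyᵢ = r`, `r ∈ ℤ`, extends the restriction
of `t` to that hyperplane by parallel transport along `∂/∂yⁱ`, cut off near the hyperplane. -/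
def roundFun {n : ℕ} (k : ℕ) (i : Fin n) (t : Phase n → ℂ) (u : Phase n) : ℂ :=
  (unitBump (k * u.2 i - round (k * u.2 i)) : ℂ) *
    Complex.exp ((-(Real.pi * (u.1 i * (k * u.2 i - round (k * u.2 i)))) : ℝ) * Complex.I) *
      t (u - ((k * u.2 i - round (k * u.2 i)) / k) • dirY i)

theorem contDiff_roundFun {n k : ℕ} (i : Fin n) {t : Phase n → ℂ} (ht : ContDiff ℝ ∞ t) :
    ContDiff ℝ ∞ (roundFun k i t) := by
  refine contDiff_iff_contDiffAt.2 fun u₀ => ?_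
  have hc : Continuous fun u : Phase n => (k : ℝ) * u.2 i :=
    continuous_const.mul (contDiff_snd_apply i).continuous
  by_cases h : |k * u₀.2 i - round (k * u₀.2 i)| < 1 / 2
  · -- near `u₀` the rounded value is constant
    have hs : ContDiff ℝ ∞ fun u : Phase n => (k * u.2 i - round (k * u₀.2 i) : ℝ) :=
      (contDiff_const.mul (contDiff_snd_apply i)).sub contDiff_const
    have hx : ContDiff ℝ ∞ fun u : Phase n => u.1 i := (contDiff_apply ℝ ℝ i).comp contDiff_fst
    have hf : ContDiff ℝ ∞ fun u : Phase n =>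
        (unitBump (k * u.2 i - round (k * u₀.2 i)) : ℂ) *
        Complex.exp ((-(Real.pi * (u.1 i * (k * u.2 i - round (k * u₀.2 i)))) : ℝ) * Complex.I) *
          t (u - ((k * u.2 i - round (k * u₀.2 i)) / k) • dirY i) := by
      refine ContDiff.mul (ContDiff.mul ?_ (ContDiff.cexp (ContDiff.mul ?_ contDiff_const)))
        (ht.comp (contDiff_id.sub ((hs.div_const _).smul contDiff_const)))
      · exact Complex.ofRealCLM.contDiff.comp (unitBump.contDiff.comp hs)
      · exact Complex.ofRealCLM.contDiff.comp (contDiff_const.mul (hx.mul hs)).neg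
    refine hf.contDiffAt.congr_of_eventuallyEq ?_
    have h1 : ∀ᶠ u : Phase n in nhds u₀, |k * u.2 i - round (k * u₀.2 i)| < 1 / 2 :=
      ((hc.sub continuous_const).abs.continuousAt).eventually (gt_mem_nhds h)
    filter_upwards [h1] with u hu
    have h2 : round (k * u.2 i) = round (k * u₀.2 i) := by
      rw [abs_lt] at hu
      rw [round_eq, Int.floor_eq_iff]
      constructor <;> linarith [hu.1, hu.2]
    simp only [roundFun, h2]
  · -- near `u₀` the cutoff vanishes
    refine (contDiffAt_const (c := (0 : ℂ))).congr_of_eventuallyEq ?_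
    have h1 : ∀ᶠ u : Phase n in nhds u₀, |k * u.2 i - k * u₀.2 i| < 1 / 6 :=
      ((hc.sub continuous_const).abs.continuousAt).eventually (gt_mem_nhds (by simp))
    filter_upwards [h1] with u hu
    have h2 : unitBump ((k : ℝ) * u.2 i - round (k * u.2 i)) = 0 := by
      refine unitBump.zero_of_le_dist ?_
      change 1 / 3 ≤ _
      rw [Real.dist_eq, sub_zero]
      by_contra hlt
      have h3 := round_le (k * u₀.2 i) (round (k * u.2 i))
      have h4 := abs_sub_le (k * u₀.2 i) (k * u.2 i) (round (k * u.2 i))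
      rw [abs_sub_comm (k * u₀.2 i) (k * u.2 i)] at h4
      push Not at h hlt
      linarith
    simp [roundFun, h2]

theorem roundFun_add_latVec {n k : ℕ} [NeZero k] (i : Fin n) (t : SmoothSec n k) (u : Phase n)
    (l : Lattice n) :
    roundFun k i t.1 (u + latVec l) = multiplier k l u * roundFun k i t.1 u := by
  have hk : (k : ℝ) ≠ 0 := by exact_mod_cast NeZero.ne k
  have hk' : (k : ℂ) ≠ 0 := by exact_mod_cast NeZero.ne k
  have h1 : k * (u + latVec l).2 i - round (k * (u + latVec l).2 i)
      = k * u.2 i - round (k * u.2 i) := by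
    have : k * (u + latVec l).2 i = k * u.2 i + ((k * l.2 i : ℤ) : ℝ) := by
      simp [latVec]; ring
    rw [this, round_add_intCast]
    push_cast
    ring
  simp only [roundFun, h1]
  set φ : ℝ := k * u.2 i - round (k * u.2 i)
  rw [add_sub_right_comm, t.2.2, sub_eq_add_neg, ← neg_smul, multiplier_add_smul, symp_dirY]
  have : Complex.exp ((-(Real.pi * ((u + latVec l).1 i * φ)) : ℝ) * Complex.I) *
      Complex.exp (-(k * Real.pi * Complex.I * (-(φ / k) * (latVec l).1 i : ℝ)))
      = Complex.exp ((-(Real.pi * (u.1 i * φ)) : ℝ) * Complex.I) := by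
    rw [← Complex.exp_add]
    congr 1
    simp only [Prod.fst_add, Pi.add_apply]
    push_cast
    field_simp
    ring
  rw [← this]
  ring

/-- `roundFun` as a smooth section. -/
def roundSec {n k : ℕ} [NeZero k] (i : Fin n) (t : SmoothSec n k) : SmoothSec n k :=
  ⟨roundFun k i t.1, contDiff_roundFun i t.2.1, roundFun_add_latVec i t⟩

theorem dense_holonomyDefect_ne_zero {n k : ℕ} [NeZero k] (i : Fin n) (p : Phase n) :
    Dense {σ : ℝ | holonomyDefect k i (p + σ • dirY i) ≠ 0} := by
  have hk : (k : ℝ) ≠ 0 := by exact_mod_cast NeZero.ne k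
  have h : (Set.range fun r : ℤ => (r / k - p.2 i : ℝ)).Countable := Set.countable_range _
  refine (h.dense_compl ℝ).mono ?_
  intro σ hσ h0
  refine hσ ?_
  obtain ⟨r, hr⟩ := holonomyDefect_eq_zero_iff.1 h0
  refine ⟨r, ?_⟩
  simp only [← hr]
  simp [dirY]
  field_simp
  ring

/-- A smooth section vanishing on the hyperplanes `kyᵢ ∈ ℤ` is divisible by
`e^{-2πikyᵢ} - 1`. -/
theorem exists_holonomyDefect_mul_sec {n k : ℕ} [NeZero k] {i : Fin n} {t : SmoothSec n k}
    (h0 : ∀ p, holonomyDefect k i p = 0 → t.1 p = 0) :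
    ∃ t' : SmoothSec n k, ∀ p, t.1 p = holonomyDefect k i p * t'.1 p := by
  obtain ⟨h, hh, hE⟩ := exists_holonomyDefect_mul t.2.1 h0
  refine ⟨⟨h, hh, fun u l => ?_⟩, hE⟩
  -- the quasi-periodicity of the quotient holds where the divisor is not zero, which is dense
  have hper : ∀ p, holonomyDefect k i (p + latVec l) = holonomyDefect k i p := by
    intro p
    simp only [holonomyDefect, Prod.snd_add, Pi.add_apply, latVec]
    congr 1
    rw [show ((-(2 * Real.pi * k * (p.2 i + (l.2 i : ℝ))) : ℝ) : ℂ) * Complex.I =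
      ((-(2 * Real.pi * k * p.2 i) : ℝ) : ℂ) * Complex.I
        + ((-(k * l.2 i) : ℤ) : ℂ) * (2 * Real.pi * Complex.I) by push_cast; ring]
    rw [Complex.exp_add, Complex.exp_int_mul_two_pi_mul_I, mul_one]
  have hd := dense_holonomyDefect_ne_zero (k := k) i u
  have hc1 : Continuous fun σ : ℝ => h (u + σ • dirY i + latVec l) :=
    hh.continuous.comp (by fun_prop)
  have hc2 : Continuous fun σ : ℝ => multiplier k l (u + σ • dirY i) * h (u + σ • dirY i) :=
    ((contDiff_multiplier k l).continuous.mul hh.continuous).comp (by fun_prop)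
  have heq := Continuous.ext_on hd hc1 hc2 fun σ hσ => by
    have h1 := t.2.2 (u + σ • dirY i) l
    rw [hE, hE, hper] at h1
    refine mul_left_cancel₀ (show holonomyDefect k i (u + σ • dirY i) ≠ 0 from hσ) ?_
    rw [h1]
    ring
  simpa using congrFun heq 0

theorem HX.apply_roundSec {n k : ℕ} [NeZero k] (s : HX n k) (i : Fin n) (t : SmoothSec n k) :
    s.1.1 (roundSec i t) = s.1.1 t := by
  obtain ⟨t', ht'⟩ := exists_holonomyDefect_mul_sec (i := i) (t := t - roundSec i t) fun p hp => by
    obtain ⟨r, hr⟩ := holonomyDefect_eq_zero_iff.1 hp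
    have h1 : unitBump (0 : ℝ) = 1 := unitBump.one_of_mem_closedBall (by simp [unitBump])
    change t.1 p - roundFun k i t.1 p = 0
    simp [roundFun, hr, h1]
  have h := HX.apply_holonomyDefect_mul s i ht'
  rw [map_sub] at h
  exact (sub_eq_zero.1 h).symm

/-- A test section may be replaced, without changing the value of any `x`-polarized functional, by one
whose values are multiples of values of `t` at points with `k y_i` integral for `i ∈ S`. Hence only the
Bohr–Sommerfeld fibres `k y ∈ ℤⁿ` matter. -/
theorem exists_round_all {n k : ℕ} [NeZero k] (t : SmoothSec n k) (S : Finset (Fin n)) :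
    ∃ t' : SmoothSec n k, (∀ s : HX n k, s.1.1 t' = s.1.1 t) ∧
      ∀ u : Phase n, ∃ (c : ℂ) (u' : Phase n), t'.1 u = c * t.1 u' ∧
        (∀ i ∈ S, ∃ r : ℤ, k * u'.2 i = r) ∧ ∀ i ∉ S, u'.2 i = u.2 i := by
  classical
  have hk : (k : ℝ) ≠ 0 := by exact_mod_cast NeZero.ne k
  induction S using Finset.induction_on with
  | empty => exact ⟨t, fun s => rfl, fun u => ⟨1, u, by simp, by simp, fun i _ => rfl⟩⟩
  | insert a S ha ih =>
    obtain ⟨t', h1, h2⟩ := ih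
    refine ⟨roundSec a t', fun s => by rw [HX.apply_roundSec, h1], fun u => ?_⟩
    set v : Phase n := u - ((k * u.2 a - round (k * u.2 a)) / k) • dirY a with hv
    obtain ⟨c, u', h3, h4, h5⟩ := h2 v
    refine ⟨(unitBump (k * u.2 a - round (k * u.2 a)) : ℂ) *
      Complex.exp ((-(Real.pi * (u.1 a * (k * u.2 a - round (k * u.2 a)))) : ℝ) * Complex.I) * c,
      u', ?_, fun i hi => ?_, fun i hi => ?_⟩
    · rw [mul_assoc, ← h3]
      rfl
    · by_cases hia : i = a
      · subst hia
        refine ⟨round (k * u.2 i), ?_⟩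
        rw [h5 i ha, hv]
        simp [dirY]
        field_simp
        ring
      · exact h4 i (by simpa [hia] using hi)
    · have : i ≠ a ∧ i ∉ S := by simpa using hi
      rw [h5 i this.2, hv]
      simp [dirY, this.1]

theorem transX_averageX_self {n k : ℕ} (i : Fin n) (t : SmoothSec n k) {p : Phase n}
    (hp : holonomyDefect k i p = 0) (τ : ℝ) :
    transX k i (averageX i (fun _ => 1) contDiff_const t).1 (p, τ) =
      (averageX i (fun _ => 1) contDiff_const t).1 p := by
  set T := averageX i (fun _ => 1) contDiff_const t
  have hd : ∀ σ, HasDerivAt (fun σ => transX k i T.1 (p, σ)) 0 σ := fun σ => by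
    refine (hasDerivAt_transX i T p σ).congr_deriv ?_
    have h : holonomyDefect k i (p + σ • dirX i) = 0 := by
      rw [← hp]; simp [holonomyDefect, dirX]
    simp only [transX]
    rw [covDeriv_averageX_one, h, zero_mul, mul_zero]
  rw [is_const_of_deriv_eq_zero (fun σ => (hd σ).differentiableAt) (fun σ => (hd σ).deriv) τ 0,
    transX_zero]

theorem transX_averageX_of_invariant {n k : ℕ} (i j : Fin n) (t : SmoothSec n k) {p : Phase n}
    {τ : ℝ} (h : ∀ σ : ℝ, transX k j t.1 (p + σ • dirX i, τ) = t.1 (p + σ • dirX i)) :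
    transX k j (averageX i (fun _ => 1) contDiff_const t).1 (p, τ) =
      (averageX i (fun _ => 1) contDiff_const t).1 p := by
  change _ * (∫ σ in (0 : ℝ)..1, _) = ∫ σ in (0 : ℝ)..1, _
  rw [← intervalIntegral.integral_const_mul]
  refine intervalIntegral.integral_congr fun σ _ => ?_
  have h1 := h σ
  simp only [transX] at h1 ⊢
  rw [← h1, add_right_comm p]
  simp [dirX]
  ring

/-- A test section may be replaced, without changing the value of any `x`-polarized functional, by one
which over the Bohr–Sommerfeld fibres is invariant under parallel transport in the directions
`x_i`, `i ∈ S`. -/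
theorem exists_average_all {n k : ℕ} (t : SmoothSec n k) (S : Finset (Fin n)) :
    ∃ t' : SmoothSec n k, (∀ s : HX n k, s.1.1 t' = s.1.1 t) ∧
      ∀ p : Phase n, (∀ i, holonomyDefect k i p = 0) →
        ∀ i ∈ S, ∀ τ : ℝ, transX k i t'.1 (p, τ) = t'.1 p := by
  classical
  induction S using Finset.induction_on with
  | empty => exact ⟨t, fun s => rfl, by simp⟩
  | insert a S ha ih =>
    obtain ⟨t', h1, h2⟩ := ih
    refine ⟨averageX a (fun _ => 1) contDiff_const t', fun s => by rw [HX.apply_averageX, h1],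
      fun p hp i hi τ => ?_⟩
    by_cases hia : i = a
    · subst hia
      exact transX_averageX_self i t' (hp i) τ
    · refine transX_averageX_of_invariant a i t' fun σ => ?_
      refine h2 _ (fun j => ?_) i (by simpa [hia] using hi) τ
      rw [← hp j]; simp [holonomyDefect, dirX]

/-- A covariantly constant section over a Bohr-Sommerfeld fibre is determined by its value at one
point. -/
theorem apply_eq_of_transX_invariant {n k : ℕ} {t : SmoothSec n k} {q : Vec n}
    (h : ∀ x : Vec n, ∀ i, ∀ τ : ℝ, transX k i t.1 ((x, q), τ) = t.1 (x, q)) (x : Vec n) :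
    t.1 (x, q) = Complex.exp ((Real.pi * k * (q ⬝ᵥ x) : ℝ) * Complex.I) * t.1 (0, q) := by
  classical
  have key : ∀ S : Finset (Fin n), t.1 (∑ i ∈ S, x i • Pi.single i 1, q) =
      Complex.exp ((Real.pi * k * ∑ i ∈ S, q i * x i : ℝ) * Complex.I) * t.1 (0, q) := by
    intro S
    induction S using Finset.induction_on with
    | empty => simp
    | insert a S ha ih =>
      have h1 := h (∑ i ∈ S, x i • Pi.single i 1) a (x a)
      have h2 : ((∑ i ∈ S, x i • Pi.single i 1, q) : Phase n) + x a • dirX a =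
          (∑ i ∈ insert a S, x i • Pi.single i 1, q) := by
        rw [Finset.sum_insert ha, add_comm (x a • _)]
        simp [dirX]
      simp only [transX] at h1
      rw [h2, ih] at h1
      rw [Finset.sum_insert ha (f := fun i => q i * x i)]
      have h3 : Complex.exp ((-(Real.pi * k * x a * q a) : ℝ) * Complex.I) ≠ 0 :=
        Complex.exp_ne_zero _
      refine mul_left_cancel₀ h3 (h1.trans ?_)
      rw [← mul_assoc, ← Complex.exp_add]
      congr 2
      push_cast
      ring
  have h1 := key Finset.univ
  rw [← pi_eq_sum_univ' x] at h1
  exact h1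

theorem fibreX_apply {n k : ℕ} [NeZero k] (m : Fin n → ZMod k) (t : SmoothSec n k) :
    (fibreX k m).1 t = ∫ x in Set.Icc (0 : Vec n) 1,
      Complex.exp ((Real.pi * (rep m ⬝ᵥ x) : ℝ) * Complex.I)
        * conj (t.1 (x, (k : ℝ)⁻¹ • rep m)) := rfl

theorem exists_eq_rep_add {n k : ℕ} [NeZero k] {y : Vec n} (h : ∀ i, ∃ r : ℤ, k * y i = r) :
    ∃ (m : Fin n → ZMod k) (l : Fin n → ℤ), y = (k : ℝ)⁻¹ • rep m + fun i => (l i : ℝ) := by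
  have hk : (k : ℝ) ≠ 0 := by exact_mod_cast NeZero.ne k
  choose r hr using h
  refine ⟨fun i => (r i : ZMod k), fun i => r i / k, ?_⟩
  ext i
  have h1 : (((r i : ZMod k).val : ℤ)) = r i % k := ZMod.val_intCast _
  have h2 : (((r i : ZMod k).val : ℝ)) = r i - k * ((r i / k : ℤ) : ℝ) := by
    have h3 : (((r i : ZMod k).val : ℤ)) = r i - k * (r i / k) := by
      rw [h1, Int.emod_def]
    exact_mod_cast h3
  simp only [Pi.add_apply, Pi.smul_apply, rep, smul_eq_mul, h2, ← hr]
  field_simp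
  ring

/-- A polarized distributional section vanishes on the smooth sections which have integral zero
over each Bohr-Sommerfeld fibre. -/
theorem HX.apply_eq_zero {n k : ℕ} [NeZero k] (s : HX n k) {t : SmoothSec n k}
    (h : ∀ m : Fin n → ZMod k, (fibreX k m).1 t = 0) : s.1.1 t = 0 := by
  have hk : (k : ℝ) ≠ 0 := by exact_mod_cast NeZero.ne k
  obtain ⟨t₁, h1, h2⟩ := exists_average_all t Finset.univ
  obtain ⟨t₂, h3, h4⟩ := exists_round_all t₁ Finset.univ
  have hinv : ∀ (m : Fin n → ZMod k) (x : Vec n), t₁.1 (x, (k : ℝ)⁻¹ • rep m) =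
      Complex.exp ((Real.pi * (rep m ⬝ᵥ x) : ℝ) * Complex.I) * t₁.1 (0, (k : ℝ)⁻¹ • rep m) := by
    intro m x
    rw [apply_eq_of_transX_invariant (fun x i τ => h2 _ (fun j =>
      holonomyDefect_eq_zero_iff.2 ⟨(m j).val, ?_⟩) i (Finset.mem_univ i) τ) x]
    · congr 3
      rw [smul_dotProduct, smul_eq_mul]
      field_simp
    · simp [rep, hk]
  have h0 : ∀ m : Fin n → ZMod k, t₁.1 (0, (k : ℝ)⁻¹ • rep m) = 0 := by
    intro m
    have h5 := (h1 ⟨fibreX k m, fibreX_mem k m⟩).trans (h m)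
    change (fibreX k m).1 t₁ = 0 at h5
    rw [fibreX_apply] at h5
    have h6 : ∀ x : Vec n, Complex.exp ((Real.pi * (rep m ⬝ᵥ x) : ℝ) * Complex.I)
        * conj (t₁.1 (x, (k : ℝ)⁻¹ • rep m)) = conj (t₁.1 (0, (k : ℝ)⁻¹ • rep m)) := by
      intro x
      rw [hinv m x, map_mul, ← mul_assoc, Complex.mul_conj, Complex.normSq_eq_norm_sq,
        Complex.norm_exp_ofReal_mul_I]
      simp
    simp only [h6] at h5
    rw [setIntegral_const, measureReal_def, Real.volume_Icc_pi] at h5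
    simpa using h5
  have h5 : t₂ = 0 := by
    ext u
    obtain ⟨c, u', h6, h7, -⟩ := h4 u
    obtain ⟨m, l, hy⟩ := exists_eq_rep_add fun i => h7 i (Finset.mem_univ i)
    have h8 : u' = ((u'.1, (k : ℝ)⁻¹ • rep m) : Phase n) + latVec (0, l) := by
      ext i
      · simp [latVec]
      · simp [latVec, hy]
    change t₂.1 u = 0
    rw [h6, h8, t₁.2.2, hinv, h0]
    simp
  rw [← h1, ← h3, h5, map_zero]

/-- The linear functional `t ↦ conj ⟨s, t⟩`. -/
def DistSec.conjLinear {n k : ℕ} (s : DistSec n k) : SmoothSec n k →ₗ[ℂ] ℂ where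
  toFun t := conj (s.1 t)
  map_add' a b := by simp
  map_smul' c a := by simp

/-- The `x`-polarized distributional sections are spanned by the fibre functionals. A section killed by
all of these is reduced by averaging and rounding to one that vanishes identically, so the claim is the
algebraic fact that a functional vanishing on a common kernel is a linear combination. -/
theorem HX.mem_span_fibreX {n k : ℕ} [NeZero k] (s : HX n k) :
    ∃ c : (Fin n → ZMod k) → ℂ, s.1 = ∑ m, c m • fibreX k m := by
  have h := mem_span_of_iInf_ker_le_ker (L := fun m : Fin n → ZMod k => DistSec.conjLinear (fibreX k m))
    (K := (DistSec.conjLinear s.1)) (fun t ht => by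
      have ht' : ∀ m : Fin n → ZMod k, DistSec.conjLinear (fibreX k m) t = 0 := by
        simpa [Submodule.mem_iInf] using ht
      change conj (s.1.1 t) = 0
      rw [HX.apply_eq_zero s fun m => (map_eq_zero (starRingEnd ℂ)).1 (ht' m), map_zero])
  obtain ⟨c, hc⟩ := (Submodule.mem_span_range_iff_exists_fun ℂ).1 h
  refine ⟨fun m => conj (c m), Subtype.ext (LinearMap.ext fun t => ?_)⟩
  have h1 := congrArg conj (LinearMap.congr_fun hc t)
  have h2 : conj ((DistSec.conjLinear s.1) t) = s.1.1 t := Complex.conj_conj _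
  rw [h2] at h1
  rw [← h1]
  simp [LinearMap.sum_apply, DistSec.conjLinear]

/-! ### The symmetry exchanging the two polarizations -/

theorem symp_swap_swap {n : ℕ} (u v : Phase n) : symp u.swap v.swap = -symp u v := by
  simp [symp]

/-- Exchanging the two components of a lattice vector. -/
def swapLat {n : ℕ} : Lattice n ≃ Lattice n := Equiv.prodComm _ _

theorem latVec_swapLat {n : ℕ} (l : Lattice n) : latVec (swapLat l) = (latVec l).swap := rfl

theorem conj_semiChar {n : ℕ} (l : Lattice n) : conj (semiChar l) = semiChar l := by
  simp [semiChar, map_zpow₀]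

theorem multiplier_swap {n : ℕ} (k : ℕ) (l : Lattice n) (u : Phase n) :
    conj (multiplier k (swapLat l) u.swap) = multiplier k l u := by
  have h : semiChar (swapLat l) = semiChar l := by
    simp only [semiChar, swapLat, Equiv.prodComm_apply, Prod.fst_swap, Prod.snd_swap, mul_comm]
  simp only [multiplier, latVec_swapLat, symp_swap_swap, map_mul, map_pow, conj_semiChar, h]
  rw [← Complex.exp_conj]
  congr 2
  simp

/-- The antilinear involution `t(x, y) ↦ conj t(y, x)` of the space of smooth sections. -/
def swapSec {n k : ℕ} : SmoothSec n k →ₗ⋆[ℂ] SmoothSec n k where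
  toFun t := ⟨fun p => conj (t.1 p.swap),
    Complex.conjCLE.contDiff.comp (t.2.1.comp (contDiff_snd.prodMk contDiff_fst)), fun u l => by
      beta_reduce
      rw [Prod.swap_add, ← latVec_swapLat, t.2.2, map_mul, multiplier_swap]⟩
  map_add' a b := by ext p; simp
  map_smul' c a := by ext p; simp

theorem swapSec_swapSec {n k : ℕ} (t : SmoothSec n k) : swapSec (swapSec t) = t := by
  ext p; simp [swapSec]

theorem norm_iteratedFDeriv_swapSec {n k : ℕ} (t : SmoothSec n k) (j : ℕ) (p : Phase n) :
    ‖iteratedFDeriv ℝ j (swapSec t).1 p‖ = ‖iteratedFDeriv ℝ j t.1 p.swap‖ := by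
  have h1 := Complex.conjLIE.norm_iteratedFDeriv_comp_left (𝕜 := ℝ)
    (t.1 ∘ LinearIsometryEquiv.prodComm ℝ (Vec n) (Vec n)) p j
  rw [LinearIsometryEquiv.norm_iteratedFDeriv_comp_right] at h1
  exact h1

/-- The involution of the space of distributional sections dual to `swapSec`. -/
def swapDist {n k : ℕ} (s : DistSec n k) : DistSec n k :=
  ⟨{ toFun := fun t => conj (s.1 (swapSec t))
     map_add' := fun a b => by simp
     map_smul' := fun c a => by simp }, by
    obtain ⟨N, C, h⟩ := s.2
    refine ⟨N, C, fun t M hM => ?_⟩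
    have h1 := h (swapSec t) M fun j hj p hp => by
      rw [norm_iteratedFDeriv_swapSec]
      exact hM j hj p.swap ⟨⟨hp.1.2, hp.1.1⟩, ⟨hp.2.2, hp.2.1⟩⟩
    simpa using h1⟩

theorem swapDist_apply {n k : ℕ} (s : DistSec n k) (t : SmoothSec n k) :
    (swapDist s).1 t = conj (s.1 (swapSec t)) := rfl

theorem swapDist_swapDist {n k : ℕ} (s : DistSec n k) : swapDist (swapDist s) = s := by
  ext t; simp [swapDist_apply, swapSec_swapSec]

theorem swapSec_covDeriv {n k : ℕ} (i : Fin n) (t : SmoothSec n k) :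
    swapSec (covDeriv (dirX i) t) = covDeriv (dirY i) (swapSec t) := by
  ext p
  have h1 := (t.2.1.differentiable (by simp) p.swap).hasFDerivAt
  have h2 := Complex.conjCLE.toContinuousLinearMap.hasFDerivAt.comp p
    (h1.comp p ((hasFDerivAt_snd (𝕜 := ℝ) (p := p)).prodMk hasFDerivAt_fst))
  have h3 : fderiv ℝ (swapSec t).1 p = _ := h2.fderiv
  change conj (fderiv ℝ t.1 p.swap (dirX i) - _) = fderiv ℝ (swapSec t).1 p (dirY i) - _
  rw [h3]
  simp [dirX, dirY, swapSec]

theorem swapDist_mem_HX {n k : ℕ} (s : HY n k) : swapDist s.1 ∈ HX n k := by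
  intro i t
  rw [swapDist_apply, swapSec_covDeriv, s.2, map_zero]

theorem swapDist_fibreX {n k : ℕ} [NeZero k] (m : Fin n → ZMod k) :
    swapDist (fibreX k m) = fibreY k m := by
  ext t
  change conj (∫ x in Set.Icc (0 : Vec n) 1, _ * conj ((swapSec t).1 (x, _)))
    = ∫ y in Set.Icc (0 : Vec n) 1, _
  rw [← integral_conj]
  refine integral_congr_ae (Filter.Eventually.of_forall fun x => ?_)
  simp only [map_mul, ← Complex.exp_conj, Complex.conj_ofReal, Complex.conj_I, swapSec]
  simp

theorem HY.mem_span_fibreY {n k : ℕ} [NeZero k] (s : HY n k) :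
    ∃ c : (Fin n → ZMod k) → ℂ, s.1 = ∑ m, c m • fibreY k m := by
  obtain ⟨c, hc⟩ := HX.mem_span_fibreX (⟨swapDist s.1, swapDist_mem_HX s⟩ : HX n k)
  refine ⟨fun m => conj (c m), ?_⟩
  rw [← swapDist_swapDist s.1, show swapDist s.1 = _ from hc]
  ext t
  simp [swapDist_apply, ← swapDist_fibreX, LinearMap.sum_apply]

/-- The antilinear involution `f(x, y) ↦ conj f(y, x)` of `C^∞(X, ℂ)`. -/
def swapFn {n : ℕ} (f : SmoothFn n) : SmoothFn n :=
  ⟨fun p => conj (f.1 p.swap),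
    Complex.conjCLE.contDiff.comp (f.2.1.comp (contDiff_snd.prodMk contDiff_fst)), fun p l => by
      beta_reduce
      rw [Prod.swap_add, ← latVec_swapLat, f.2.2]⟩

theorem swapDist_mulDist {n k : ℕ} (f : SmoothFn n) (s : DistSec n k) :
    swapDist (mulDist (swapFn f) s) = mulDist f (swapDist s) := by
  ext t
  change conj (s.1 (mulSec (conjFn (swapFn f)) (swapSec t)))
    = conj (s.1 (swapSec (mulSec (conjFn f) t)))
  congr 2
  ext p
  simp [mulSec, conjFn, swapFn, swapSec]

/-- The antilinear involution `χ(x, y) ↦ conj χ(y, x)` of the space of cutoffs. -/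
def swapCutoff {n : ℕ} (χ : Cutoff n) : Cutoff n where
  toFun p := conj (χ.toFun p.swap)
  smooth := Complex.conjCLE.contDiff.comp (χ.smooth.comp (contDiff_snd.prodMk contDiff_fst))
  compact := (χ.compact.comp_homeomorph (Homeomorph.prodComm (Vec n) (Vec n))).comp_left
    (g := fun z : ℂ => conj z) (map_zero _)

theorem swapSec_periodize {n k : ℕ} (φ : Cutoff n) :
    swapSec (periodize k φ) = periodize k (swapCutoff φ) := by
  ext p
  change conj (∑' l : Lattice n, (multiplier k l p.swap)⁻¹ * φ.toFun (p.swap + latVec l)) =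
    ∑' l : Lattice n, (multiplier k l p)⁻¹ * conj (φ.toFun (p + latVec l).swap)
  rw [Complex.conj_tsum, ← swapLat.tsum_eq]
  refine tsum_congr fun l => ?_
  rw [map_mul, map_inv₀, multiplier_swap, latVec_swapLat, Prod.swap_add]

theorem localFourier_swapDist {n k : ℕ} (χ : Cutoff n) (s : DistSec n k) (ζ : Phase n) :
    localFourier χ (swapDist s) ζ = conj (localFourier (swapCutoff χ) s (-ζ.swap)) := by
  rw [localFourier, swapDist_apply, swapSec_periodize, localFourier]
  congr 3
  simp only [waveCutoff, swapCutoff, Cutoff.mk.injEq]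
  ext p
  simp only [map_mul, ← Complex.exp_conj, Complex.conj_ofReal, Complex.conj_I, map_ofNat]
  congr 2
  simp
  ring

/-! ### Fourier inversion and unfolding -/

/-- The Fourier transform on `ℝⁿ`, with the kernel `e^{-2πi ξ·x}`. -/
def vecFourier {n : ℕ} (G : Vec n → ℂ) (ξ : Vec n) : ℂ :=
  ∫ x : Vec n, G x * Complex.exp (-(2 * Real.pi * Complex.I * ((ξ ⬝ᵥ x : ℝ) : ℂ)))

theorem inner_toLp {n : ℕ} (v w : EuclideanSpace ℝ (Fin n)) :
    inner ℝ v w = WithLp.ofLp w ⬝ᵥ WithLp.ofLp v := by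
  simp [PiLp.inner_apply, dotProduct]

/-- Fourier inversion for test functions on `ℝⁿ`. -/
theorem integrable_vecFourier {n : ℕ} {G : Vec n → ℂ} (hG : ContDiff ℝ ∞ G)
    (hG' : HasCompactSupport G) :
    Integrable (vecFourier G) ∧ ∀ a : Vec n,
      ∫ ξ : Vec n, vecFourier G ξ * Complex.exp (2 * Real.pi * Complex.I * ((ξ ⬝ᵥ a : ℝ) : ℂ))
        = G a := by
  let e : EuclideanSpace ℝ (Fin n) ≃L[ℝ] Vec n := EuclideanSpace.equiv (Fin n) ℝ
  let M : EuclideanSpace ℝ (Fin n) ≃ᵐ Vec n := (MeasurableEquiv.toLp 2 (Fin n → ℝ)).symm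
  have hM : MeasurePreserving M := EuclideanSpace.volume_preserving_symm_measurableEquiv_toLp _
  let g : EuclideanSpace ℝ (Fin n) → ℂ := G ∘ e
  have hg : ContDiff ℝ ∞ g := hG.comp e.contDiff
  have hg' : HasCompactSupport g := hG'.comp_homeomorph e.toHomeomorph
  let f := hg'.toSchwartzMap hg
  have hF : ∀ ξ, FourierTransform.fourier g ξ = vecFourier G (e ξ) := by
    intro ξ
    rw [Real.fourier_eq', vecFourier, ← hM.integral_comp']
    refine integral_congr_ae (Filter.Eventually.of_forall fun x => ?_)
    simp only [inner_toLp, smul_eq_mul]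
    rw [mul_comm]
    congr 2
    change ((-2 * Real.pi * (WithLp.ofLp ξ ⬝ᵥ WithLp.ofLp x) : ℝ) : ℂ) * Complex.I
      = -(2 * Real.pi * Complex.I * ((WithLp.ofLp ξ ⬝ᵥ WithLp.ofLp x : ℝ) : ℂ))
    push_cast
    ring
  have hI : Integrable (FourierTransform.fourier g) := by
    have h := (FourierTransform.fourier f).integrable (μ := volume)
    rw [SchwartzMap.fourier_coe] at h
    exact h
  have hI0 : Integrable g := f.integrable
  constructor
  · rw [← hM.integrable_comp_emb M.measurableEmbedding]
    refine hI.congr (Filter.Eventually.of_forall fun ξ => hF ξ)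
  · intro a
    have h1 := congrFun (hg.continuous.fourierInv_fourier_eq hI0 hI) (e.symm a)
    rw [Real.fourierInv_eq'] at h1
    have h2 : g (e.symm a) = G a := by simp [g]
    rw [← h2, ← h1, ← hM.integral_comp']
    refine integral_congr_ae (Filter.Eventually.of_forall fun ξ => ?_)
    simp only [inner_toLp, smul_eq_mul, hF]
    rw [mul_comm]
    congr 2
    change 2 * Real.pi * Complex.I * ((WithLp.ofLp ξ ⬝ᵥ a : ℝ) : ℂ)
      = ((2 * Real.pi * (a ⬝ᵥ WithLp.ofLp ξ) : ℝ) : ℂ) * Complex.I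
    rw [dotProduct_comm a]
    push_cast
    ring

/-- An integral over `ℝⁿ` is a sum of integrals over the translates of the unit cube. -/
theorem integral_eq_sum_cubes {n : ℕ} {H : Vec n → ℂ} (hH : Integrable H)
    (A : Finset (Fin n → ℤ))
    (hA : ∀ a ∉ A, ∀ x ∈ Set.Icc (0 : Vec n) 1, H (x + fun i => (a i : ℝ)) = 0) :
    ∫ x, H x = ∑ a ∈ A, ∫ x in Set.Icc (0 : Vec n) 1, H (x + fun i => (a i : ℝ)) := by
  let box : (Fin n → ℤ) → Set (Vec n) := fun a => {x | ∀ i, ⌊x i⌋ = a i}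
  have hm : ∀ a, MeasurableSet (box a) := fun a => by
    have : box a = ⋂ i, (fun x : Vec n => ⌊x i⌋) ⁻¹' {a i} := by ext x; simp [box]
    rw [this]
    exact MeasurableSet.iInter fun i =>
      (Int.measurable_floor.comp (measurable_pi_apply i)) (measurableSet_singleton _)
  have hshift : ∀ a x, x + (fun i => (a i : ℝ)) ∈ box a ↔ x ∈ box 0 := by
    intro a x; simp [box]
  have hbox0 : box 0 = Set.univ.pi fun i : Fin n => Set.Ico ((0 : Vec n) i) ((1 : Vec n) i) := by
    ext x; simp [box, Int.floor_eq_zero_iff, Set.mem_pi]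
  have hae : box 0 =ᵐ[volume] Set.Icc (0 : Vec n) 1 := by
    rw [hbox0]; exact Measure.univ_pi_Ico_ae_eq_Icc
  have hzero : ∀ x, x ∉ ⋃ a ∈ A, box a → H x = 0 := by
    intro x hx
    have h1 : (fun i => ⌊x i⌋) ∉ A := fun h => hx (by
      simp only [Set.mem_iUnion]; exact ⟨_, h, fun i => rfl⟩)
    have h2 := hA _ h1 (fun i => Int.fract (x i))
      ⟨fun i => Int.fract_nonneg _, fun i => (Int.fract_lt_one _).le⟩
    have h3 : ((fun i => Int.fract (x i)) + fun i => ((⌊x i⌋ : ℤ) : ℝ)) = x := by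
      ext i; simp [Int.fract_add_floor]
    rwa [h3] at h2
  rw [← setIntegral_eq_integral_of_forall_compl_eq_zero hzero,
    integral_biUnion_finset A (fun a _ => hm a)
      (fun a _ b _ hab => Set.disjoint_left.2 fun x hx hx' => hab (funext fun i =>
        (hx i).symm.trans (hx' i))) (fun a _ => hH.integrableOn)]
  refine Finset.sum_congr rfl fun a _ => ?_
  rw [← setIntegral_congr_set hae, ← integral_indicator (hm a), ← integral_indicator (hm 0),
    ← integral_add_right_eq_self _ (fun i => (a i : ℝ))]
  refine integral_congr_ae (Filter.Eventually.of_forall fun x => ?_)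
  simp only [Set.indicator, hshift]

/-- For the cutoff `χ`, the density of the restriction of `χ · f · fibreX k m` to the hyperplane
`y = m/k + b`, `b ∈ ℤⁿ`. -/
def sliceX {n : ℕ} (k : ℕ) (m : Fin n → ZMod k) (f : SmoothFn n) (χ : Cutoff n)
    (b : Fin n → ℤ) (x : Vec n) : ℂ :=
  Complex.exp ((Real.pi * ((rep m + (k : ℝ) • fun i => (b i : ℝ)) ⬝ᵥ x) : ℝ) * Complex.I) *
    f.1 (x, (k : ℝ)⁻¹ • rep m) * χ.toFun (x, (k : ℝ)⁻¹ • rep m + fun i => (b i : ℝ))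

theorem contDiff_dot_const {n : ℕ} (a : Vec n) : ContDiff ℝ ∞ fun x : Vec n => a ⬝ᵥ x := by
  unfold dotProduct
  exact ContDiff.sum fun i _ => contDiff_const.mul (contDiff_apply ℝ ℝ i)

theorem contDiff_sliceX {n k : ℕ} (m : Fin n → ZMod k) (f : SmoothFn n) (χ : Cutoff n)
    (b : Fin n → ℤ) : ContDiff ℝ ∞ (sliceX k m f χ b) := by
  unfold sliceX
  refine ContDiff.mul (ContDiff.mul (ContDiff.cexp (ContDiff.mul (Complex.ofRealCLM.contDiff.comp
    (contDiff_const.mul (contDiff_dot_const _))) contDiff_const)) ?_) ?_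
  · exact f.2.1.comp (contDiff_id.prodMk contDiff_const)
  · exact χ.smooth.comp (contDiff_id.prodMk contDiff_const)

theorem hasCompactSupport_sliceX {n k : ℕ} (m : Fin n → ZMod k) (f : SmoothFn n) (χ : Cutoff n)
    (b : Fin n → ℤ) : HasCompactSupport (sliceX k m f χ b) := by
  refine HasCompactSupport.intro (χ.compact.isCompact.image continuous_fst) fun x hx => ?_
  have h : χ.toFun (x, (k : ℝ)⁻¹ • rep m + fun i => (b i : ℝ)) = 0 := by
    by_contra h0
    exact hx ⟨_, subset_tsupport _ h0, rfl⟩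
  simp [sliceX, h]

theorem exp_pi_int_eq_exp_neg (r : ℤ) :
    Complex.exp (Real.pi * Complex.I * r) = Complex.exp (-(Real.pi * Complex.I * r)) := by
  rw [Complex.exp_eq_exp_iff_exists_int]
  exact ⟨r, by ring⟩

theorem conj_multiplier_inv {n : ℕ} (k : ℕ) (l : Lattice n) (u : Phase n) :
    conj (multiplier k l u)⁻¹ = multiplier k l u := by
  have h1 : ‖multiplier k l u‖ = 1 := by
    rw [multiplier, norm_mul, norm_pow, semiChar, norm_zpow]
    rw [show -(k * Real.pi * Complex.I * (symp u (latVec l) : ℂ)) =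
      ((-(k * Real.pi * symp u (latVec l)) : ℝ) : ℂ) * Complex.I by push_cast; ring,
      Complex.norm_exp_ofReal_mul_I]
    simp
  rw [Complex.inv_def, map_mul, Complex.conj_conj, Complex.normSq_eq_norm_sq, h1]
  simp

theorem semiChar_eq_exp {n : ℕ} (l : Lattice n) :
    semiChar l = Complex.exp (((∑ i, l.1 i * l.2 i : ℤ) : ℂ) * (Real.pi * Complex.I)) := by
  rw [semiChar, Complex.exp_int_mul, Complex.exp_pi_mul_I]

theorem rep_dot_int {n k : ℕ} (m : Fin n → ZMod k) (a : Fin n → ℤ) :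
    ∃ r : ℤ, rep m ⬝ᵥ (fun i => (a i : ℝ)) = r :=
  ⟨∑ i, ((m i).val : ℤ) * a i, by simp [rep, dotProduct]⟩

/-- The unit section of a Bohr-Sommerfeld fibre, continued quasi-periodically to the translate of
the fibre by `l`. -/
theorem fibre_phase_mul_multiplier {n k : ℕ} [NeZero k] (m : Fin n → ZMod k) (l : Lattice n)
    (x : Vec n) :
    Complex.exp ((Real.pi * (rep m ⬝ᵥ x) : ℝ) * Complex.I) *
        multiplier k l (x, (k : ℝ)⁻¹ • rep m) =
      Complex.exp ((Real.pi * ((rep m + (k : ℝ) • fun i => (l.2 i : ℝ)) ⬝ᵥ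
        (x + fun i => (l.1 i : ℝ))) : ℝ) * Complex.I) := by
  have hk : (k : ℝ) ≠ 0 := by exact_mod_cast NeZero.ne k
  obtain ⟨r, hr⟩ := rep_dot_int m l.1
  have h1 := exp_pi_int_eq_exp_neg r
  rw [multiplier, semiChar_eq_exp, ← Complex.exp_nat_mul, ← Complex.exp_add, ← Complex.exp_add]
  have hs : k * symp ((x, (k : ℝ)⁻¹ • rep m) : Phase n) (latVec l)
      = r - k * (x ⬝ᵥ fun i => (l.2 i : ℝ)) := by
    rw [← hr]
    simp [symp, latVec]
    field_simp
  have hl : ((∑ i, l.1 i * l.2 i : ℤ) : ℝ) = (fun i => (l.2 i : ℝ)) ⬝ᵥ fun i => (l.1 i : ℝ) := by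
    simp [dotProduct, mul_comm]
  have hd : (rep m + (k : ℝ) • fun i => (l.2 i : ℝ)) ⬝ᵥ (x + fun i => (l.1 i : ℝ)) =
      rep m ⬝ᵥ x + r + k * (x ⬝ᵥ fun i => (l.2 i : ℝ)) + k * ((∑ i, l.1 i * l.2 i : ℤ) : ℝ) := by
    rw [hl, add_dotProduct, dotProduct_add, dotProduct_add, hr, smul_dotProduct, smul_dotProduct,
      dotProduct_comm x]
    simp only [smul_eq_mul]
    ring
  have hs' : (k : ℂ) * ((symp ((x, (k : ℝ)⁻¹ • rep m) : Phase n) (latVec l) : ℝ) : ℂ)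
      = r - k * ((x ⬝ᵥ fun i => (l.2 i : ℝ) : ℝ) : ℂ) := by exact_mod_cast hs
  rw [hd]
  generalize (x ⬝ᵥ fun i => (l.2 i : ℝ)) = d at *
  generalize (∑ i, l.1 i * l.2 i : ℤ) = c at *
  generalize rep m ⬝ᵥ x = q at *
  have e1 : (((Real.pi * q : ℝ) : ℂ) * Complex.I + (k * (c * (Real.pi * Complex.I)) +
      -(k * Real.pi * Complex.I * (symp ((x, (k : ℝ)⁻¹ • rep m) : Phase n) (latVec l) : ℝ))))
      = -(Real.pi * Complex.I * r)
        + (Real.pi * Complex.I * (q + k * d + k * c)) := by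
    push_cast
    linear_combination (-(Real.pi * Complex.I)) * hs'
  have e2 : ((Real.pi * (q + r + k * d + k * (c : ℝ)) : ℝ) : ℂ) * Complex.I
      = Real.pi * Complex.I * r + (Real.pi * Complex.I * (q + k * d + k * c)) := by
    push_cast
    ring
  rw [e2, Complex.exp_add _ (Real.pi * Complex.I * (q + k * d + k * c)), h1, ← Complex.exp_add,
    ← e1]

/-- The Fourier transform of the localization of `f · fibreX k m`, which is a sum of smooth
densities on the hyperplanes `y = m/k + b`. -/
theorem exists_localFourier_fibreX {n k : ℕ} [NeZero k] (m : Fin n → ZMod k) (f : SmoothFn n)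
    (χ : Cutoff n) :
    ∃ B : Finset (Fin n → ℤ),
      (∀ b ∉ B, ∀ x, χ.toFun (x, (k : ℝ)⁻¹ • rep m + fun i => (b i : ℝ)) = 0) ∧
      ∀ ζ : Phase n, localFourier χ (mulDist f (fibreX k m)) ζ =
        ∑ b ∈ B, vecFourier (sliceX k m f χ b) ζ.1 * Complex.exp (-(2 * Real.pi * Complex.I *
          ((ζ.2 ⬝ᵥ ((k : ℝ)⁻¹ • rep m + fun i => (b i : ℝ)) : ℝ) : ℂ))) := by
  classical
  set q : Vec n := (k : ℝ)⁻¹ • rep m with hq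
  obtain ⟨R, hR⟩ := χ.compact.isCompact.isBounded.exists_norm_le
  have hqn : ‖q‖ ≤ 1 := by
    refine (pi_norm_le_iff_of_nonneg zero_le_one).2 fun i => ?_
    rw [Real.norm_of_nonneg ((rep_mem m).1 i)]
    exact (rep_mem m).2 i
  have hfin := finite_latVec_bounded (n := n) (R + 1)
  let A : Finset (Fin n → ℤ) := hfin.toFinset.image Prod.fst
  let B : Finset (Fin n → ℤ) := hfin.toFinset.image Prod.snd
  have hz1 : ∀ b ∉ B, ∀ x, χ.toFun (x, q + fun i => (b i : ℝ)) = 0 := by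
    intro b hb x
    by_contra h
    have h1 := hR _ (subset_tsupport _ h)
    refine hb (Finset.mem_image.2 ⟨(0, b), ?_, rfl⟩)
    simp only [Set.Finite.mem_toFinset, Set.mem_ofPred_eq]
    have h2 : ‖q + fun i => (b i : ℝ)‖ ≤ R := (norm_snd_le _).trans h1
    have h3 : ‖fun i => (b i : ℝ)‖ ≤ R + 1 := by
      have := norm_sub_le (q + fun i => (b i : ℝ)) q
      rw [add_sub_cancel_left] at this
      linarith
    have h4 : (latVec (0, b) : Phase n) = (0, fun i => (b i : ℝ)) := by
      ext i <;> simp [latVec]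
    rw [h4, Prod.norm_mk, norm_zero, max_eq_right (norm_nonneg _)]
    exact h3
  have hz2 : ∀ a ∉ A, ∀ x ∈ Set.Icc (0 : Vec n) 1, ∀ y,
      χ.toFun (x + fun i => (a i : ℝ), y) = 0 := by
    intro a ha x hx y
    by_contra h
    have h1 := hR _ (subset_tsupport _ h)
    refine ha (Finset.mem_image.2 ⟨(a, 0), ?_, rfl⟩)
    simp only [Set.Finite.mem_toFinset, Set.mem_ofPred_eq]
    have hx1 : ‖x‖ ≤ 1 := by
      refine (pi_norm_le_iff_of_nonneg zero_le_one).2 fun i => ?_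
      rw [Real.norm_of_nonneg (hx.1 i)]
      exact hx.2 i
    have h2 : ‖x + fun i => (a i : ℝ)‖ ≤ R := (norm_fst_le _).trans h1
    have h3 : ‖fun i => (a i : ℝ)‖ ≤ R + 1 := by
      have := norm_sub_le (x + fun i => (a i : ℝ)) x
      rw [add_sub_cancel_left] at this
      linarith
    have h4 : (latVec (a, 0) : Phase n) = (fun i => (a i : ℝ), 0) := by
      ext i <;> simp [latVec]
    rw [h4, Prod.norm_mk, norm_zero, max_eq_left (norm_nonneg _)]
    exact h3
  refine ⟨B, hz1, fun ζ => ?_⟩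
  let W : (Fin n → ℤ) → Vec n → ℂ := fun b x => sliceX k m f χ b x *
    Complex.exp (-(2 * Real.pi * Complex.I * ((ζ.1 ⬝ᵥ x : ℝ) : ℂ)))
  let E : (Fin n → ℤ) → ℂ := fun b => Complex.exp (-(2 * Real.pi * Complex.I *
    ((ζ.2 ⬝ᵥ (q + fun i => (b i : ℝ)) : ℝ) : ℂ)))
  have hWc : ∀ b, Continuous (W b) := fun b => by
    have h1 := (contDiff_sliceX m f χ b).continuous
    have h2 := (contDiff_dot_const ζ.1).continuous
    fun_prop
  have hWi : ∀ b, Integrable (W b) := fun b =>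
    (hWc b).integrable_of_hasCompactSupport (hasCompactSupport_sliceX m f χ b).mul_right
  -- the integrand of the pairing with a periodized plane wave
  have hterm : ∀ (x : Vec n) (l : Lattice n),
      Complex.exp ((Real.pi * (rep m ⬝ᵥ x) : ℝ) * Complex.I) * (f.1 (x, q) *
        conj ((multiplier k l (x, q))⁻¹ * (waveCutoff χ ζ).toFun ((x, q) + latVec l))) =
      W l.2 (x + fun i => (l.1 i : ℝ)) * E l.2 := by
    intro x l
    have h1 := fibre_phase_mul_multiplier m l x
    have h2 : ((x, q) : Phase n) + latVec l
        = (x + fun i => (l.1 i : ℝ), q + fun i => (l.2 i : ℝ)) := rfl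
    have h3 : f.1 (x + fun i => (l.1 i : ℝ), q) = f.1 (x, q) := by
      have h : ((x, q) : Phase n) + latVec (l.1, 0) = (x + fun i => (l.1 i : ℝ), q) := by
        ext i <;> simp [latVec]
      rw [← h, f.2.2]
    have h4 : conj (Complex.exp (2 * Real.pi * Complex.I *
        ((ζ.1 ⬝ᵥ (x + fun i => (l.1 i : ℝ)) + ζ.2 ⬝ᵥ (q + fun i => (l.2 i : ℝ)) : ℝ) : ℂ))) =
        Complex.exp (-(2 * Real.pi * Complex.I *
          ((ζ.1 ⬝ᵥ (x + fun i => (l.1 i : ℝ)) : ℝ) : ℂ))) * E l.2 := by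
      rw [← Complex.exp_conj, ← Complex.exp_add]
      congr 1
      simp only [map_mul, Complex.conj_ofReal, Complex.conj_I, map_ofNat]
      push_cast
      ring
    simp only [waveCutoff, h2, map_mul, conj_multiplier_inv, Complex.conj_conj, h4, W, sliceX,
      ← hq, h3]
    rw [← hq] at h1
    rw [← h1]
    ring
  have hsum : ∀ x ∈ Set.Icc (0 : Vec n) 1,
      Complex.exp ((Real.pi * (rep m ⬝ᵥ x) : ℝ) * Complex.I) *
        conj ((mulSec (conjFn f) (periodize k (waveCutoff χ ζ))).1 (x, q)) =
      ∑ b ∈ B, ∑ a ∈ A, W b (x + fun i => (a i : ℝ)) * E b := by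
    intro x hx
    change _ * conj (conj (f.1 (x, q)) * ∑' l : Lattice n, (multiplier k l (x, q))⁻¹ *
      (waveCutoff χ ζ).toFun ((x, q) + latVec l)) = _
    rw [map_mul, Complex.conj_conj, Complex.conj_tsum, ← tsum_mul_left, ← tsum_mul_left]
    simp only [hterm]
    rw [tsum_eq_sum (s := A ×ˢ B) fun l hl => ?_, Finset.sum_product_right]
    have h0 : W l.2 (x + fun i => (l.1 i : ℝ)) = 0 := by
      rw [Finset.mem_product, not_and_or] at hl
      simp only [W, sliceX]
      rcases hl with hl | hl
      · rw [hz2 _ hl x hx]; simp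
      · rw [hz1 _ hl]; simp
    rw [h0, zero_mul]
  have hstart : localFourier χ (mulDist f (fibreX k m)) ζ = ∫ x in Set.Icc (0 : Vec n) 1,
      Complex.exp ((Real.pi * (rep m ⬝ᵥ x) : ℝ) * Complex.I) *
        conj ((mulSec (conjFn f) (periodize k (waveCutoff χ ζ))).1 (x, q)) := rfl
  have hshift : ∀ b (a : Fin n → ℤ), IntegrableOn (fun x => W b (x + fun i => (a i : ℝ)) * E b)
      (Set.Icc (0 : Vec n) 1) := fun b a => by
    refine Continuous.integrableOn_Icc ?_
    have := hWc b
    fun_prop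
  rw [hstart, setIntegral_congr_fun measurableSet_Icc hsum,
    integral_finsetSum _ fun b _ => integrable_finsetSum _ fun a _ => hshift b a]
  refine Finset.sum_congr rfl fun b _ => ?_
  rw [integral_finsetSum _ fun a _ => hshift b a]
  have h5 : vecFourier (sliceX k m f χ b) ζ.1 = ∫ x, W b x := rfl
  rw [h5, integral_eq_sum_cubes (hWi b) A fun a ha x hx => by
    simp [W, sliceX, hz2 a ha x hx], Finset.sum_mul]
  refine Finset.sum_congr rfl fun a _ => ?_
  rw [← integral_mul_const]

/-! ### The pairing of Bohr-Sommerfeld fibres -/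

theorem norm_exp_two_pi_I_mul (r : ℝ) : ‖Complex.exp (2 * Real.pi * Complex.I * (r : ℂ))‖ = 1 := by
  rw [show 2 * Real.pi * Complex.I * (r : ℂ) = ((2 * Real.pi * r : ℝ) : ℂ) * Complex.I by
    push_cast; ring]
  exact Complex.norm_exp_ofReal_mul_I _

theorem integrable_vecFourier_mul_exp {n : ℕ} {G : Vec n → ℂ} (hG : ContDiff ℝ ∞ G)
    (hG' : HasCompactSupport G) (a : Vec n) :
    Integrable fun ξ : Vec n =>
      vecFourier G ξ * Complex.exp (2 * Real.pi * Complex.I * ((ξ ⬝ᵥ a : ℝ) : ℂ)) := by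
  have h := (integrable_vecFourier hG hG').1
  have hc : Continuous fun ξ : Vec n =>
      Complex.exp (2 * Real.pi * Complex.I * ((ξ ⬝ᵥ a : ℝ) : ℂ)) := by
    unfold dotProduct; fun_prop
  refine h.mono (h.aestronglyMeasurable.mul hc.aestronglyMeasurable)
    (Filter.Eventually.of_forall fun ξ => ?_)
  rw [norm_mul, norm_exp_two_pi_I_mul, mul_one]

/-- The product of the Fourier transforms of densities carried by two transversal affine
subspaces: Parseval's formula gives the product of the densities at the intersection. -/
theorem integral_vecFourier_prod {n : ℕ} {G H : Vec n → ℂ} (hG : ContDiff ℝ ∞ G)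
    (hG' : HasCompactSupport G) (hH : ContDiff ℝ ∞ H) (hH' : HasCompactSupport H) (a b : Vec n) :
    Integrable (fun ζ : Phase n =>
      (vecFourier G ζ.1 * Complex.exp (2 * Real.pi * Complex.I * ((ζ.1 ⬝ᵥ a : ℝ) : ℂ))) *
      (vecFourier H (-ζ.2) * Complex.exp (2 * Real.pi * Complex.I * ((-ζ.2 ⬝ᵥ b : ℝ) : ℂ)))) ∧
    ∫ ζ : Phase n,
      (vecFourier G ζ.1 * Complex.exp (2 * Real.pi * Complex.I * ((ζ.1 ⬝ᵥ a : ℝ) : ℂ))) *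
      (vecFourier H (-ζ.2) * Complex.exp (2 * Real.pi * Complex.I * ((-ζ.2 ⬝ᵥ b : ℝ) : ℂ)))
      = G a * H b := by
  have h1 := integrable_vecFourier_mul_exp hG hG' a
  have h2 := (integrable_vecFourier_mul_exp hH hH' b).comp_neg
  refine ⟨h1.mul_prod h2, ?_⟩
  have h3 := integral_prod_mul (μ := (volume : Measure (Vec n))) (ν := (volume : Measure (Vec n)))
    (fun ξ => vecFourier G ξ * Complex.exp (2 * Real.pi * Complex.I * ((ξ ⬝ᵥ a : ℝ) : ℂ)))
    (fun ξ => vecFourier H (-ξ) * Complex.exp (2 * Real.pi * Complex.I * ((-ξ ⬝ᵥ b : ℝ) : ℂ)))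
  refine h3.trans ?_
  rw [(integrable_vecFourier hG hG').2 a, integral_neg_eq_self (fun ξ : Vec n =>
    vecFourier H ξ * Complex.exp (2 * Real.pi * Complex.I * ((ξ ⬝ᵥ b : ℝ) : ℂ))),
    (integrable_vecFourier hH hH').2 b]

/-- The intersection point `(j/k, m/k)` of the fibres `{y = m/k}` and `{x = j/k}`. -/
def fibrePoint {n : ℕ} (k : ℕ) (m j : Fin n → ZMod k) : Phase n :=
  ((k : ℝ)⁻¹ • rep j, (k : ℝ)⁻¹ • rep m)

/-- The phase `e^{2πi m·j/k}`. -/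
def dftPhase {n k : ℕ} (m j : Fin n → ZMod k) : ℂ :=
  Complex.exp (2 * Real.pi * Complex.I * ((rep m ⬝ᵥ rep j : ℝ) : ℂ) / k)

/-- At a point where an `x`-fibre meets a `y`-fibre, the product of the two fibre phases is
`e^{2πi m·j/k}`, whatever lattice representative of the point is taken. -/
theorem fibre_phase_mul_phase {n k : ℕ} [NeZero k] (m j : Fin n → ZMod k) (a b : Fin n → ℤ) :
    Complex.exp ((Real.pi * ((rep m + (k : ℝ) • fun i => (b i : ℝ)) ⬝ᵥ
        ((k : ℝ)⁻¹ • rep j + fun i => (a i : ℝ))) : ℝ) * Complex.I) *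
      Complex.exp ((Real.pi * ((rep j + (k : ℝ) • fun i => (a i : ℝ)) ⬝ᵥ
        ((k : ℝ)⁻¹ • rep m + fun i => (b i : ℝ))) : ℝ) * Complex.I) = dftPhase m j := by
  have hk : (k : ℝ) ≠ 0 := by exact_mod_cast NeZero.ne k
  have hk' : (k : ℂ) ≠ 0 := by exact_mod_cast NeZero.ne k
  obtain ⟨r, hr⟩ := rep_dot_int m a
  obtain ⟨r', hr'⟩ := rep_dot_int j b
  have hba : (fun i => (b i : ℝ)) ⬝ᵥ (fun i => (a i : ℝ)) = ((∑ i, b i * a i : ℤ) : ℝ) := by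
    simp [dotProduct]
  have hab : (fun i => (a i : ℝ)) ⬝ᵥ (fun i => (b i : ℝ)) = ((∑ i, b i * a i : ℤ) : ℝ) := by
    rw [dotProduct_comm, hba]
  have ham : (fun i => (a i : ℝ)) ⬝ᵥ rep m = r := by rw [dotProduct_comm, hr]
  have hbj : (fun i => (b i : ℝ)) ⬝ᵥ rep j = r' := by rw [dotProduct_comm, hr']
  have hjm := dotProduct_comm (rep j) (rep m)
  rw [← Complex.exp_add, dftPhase, Complex.exp_eq_exp_iff_exists_int]
  refine ⟨r + r' + k * ∑ i, b i * a i, ?_⟩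
  simp only [add_dotProduct, dotProduct_add, smul_dotProduct, dotProduct_smul, hr, hr', hba, hab,
    ham, hbj, hjm, smul_eq_mul]
  generalize rep m ⬝ᵥ rep j = c at *
  generalize (∑ i, b i * a i : ℤ) = d at *
  push_cast
  field_simp
  ring

/-- The fibres `{y = m/k}` and `{x = j/k}` meet transversally in one point of the torus, and their
pairing is the product of the values there. -/
theorem hasPairing_fibreX_fibreY {n k : ℕ} [NeZero k] (f g : SmoothFn n) (m j : Fin n → ZMod k) :
    HasPairing (mulDist f (fibreX k m)) (mulDist g (fibreY k j))
      (dftPhase m j * f.1 (fibrePoint k m j) * conj (g.1 (fibrePoint k m j))) := by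
  intro χ ψ hχψ
  obtain ⟨B, hB, hχ⟩ := exists_localFourier_fibreX m f χ
  obtain ⟨A, hA, hψ⟩ := exists_localFourier_fibreX j (swapFn g) (swapCutoff ψ)
  let G := sliceX k m f χ
  let H := sliceX k j (swapFn g) (swapCutoff ψ)
  let pa : (Fin n → ℤ) → Vec n := fun a => (k : ℝ)⁻¹ • rep j + fun i => (a i : ℝ)
  let pb : (Fin n → ℤ) → Vec n := fun b => (k : ℝ)⁻¹ • rep m + fun i => (b i : ℝ)
  have hint : ∀ ζ : Phase n, localFourier χ (mulDist f (fibreX k m)) ζ *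
      conj (localFourier ψ (mulDist g (fibreY k j)) ζ) = ∑ b ∈ B, ∑ a ∈ A,
      (vecFourier (G b) ζ.1 * Complex.exp (2 * Real.pi * Complex.I * ((ζ.1 ⬝ᵥ pa a : ℝ) : ℂ))) *
      (vecFourier (H a) (-ζ.2) *
        Complex.exp (2 * Real.pi * Complex.I * ((-ζ.2 ⬝ᵥ pb b : ℝ) : ℂ))) := by
    intro ζ
    rw [← swapDist_fibreX, ← swapDist_mulDist, localFourier_swapDist, Complex.conj_conj, hχ, hψ,
      Finset.sum_mul_sum]
    refine Finset.sum_congr rfl fun b _ => Finset.sum_congr rfl fun a _ => ?_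
    have h1 : -(2 * Real.pi * Complex.I * ((ζ.2 ⬝ᵥ pb b : ℝ) : ℂ))
        = 2 * Real.pi * Complex.I * ((-ζ.2 ⬝ᵥ pb b : ℝ) : ℂ) := by
      rw [neg_dotProduct]; push_cast; ring
    have h2 : -(2 * Real.pi * Complex.I * (((-ζ.swap).2 ⬝ᵥ pa a : ℝ) : ℂ))
        = 2 * Real.pi * Complex.I * ((ζ.1 ⬝ᵥ pa a : ℝ) : ℂ) := by
      simp only [Prod.snd_neg, Prod.snd_swap, neg_dotProduct]; push_cast; ring
    have h3 : (-ζ.swap).1 = -ζ.2 := rfl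
    rw [h1, h2, h3]
    ring
  have hpair := fun b a => integral_vecFourier_prod (contDiff_sliceX m f χ b)
    (hasCompactSupport_sliceX m f χ b) (contDiff_sliceX j (swapFn g) (swapCutoff ψ) a)
    (hasCompactSupport_sliceX j (swapFn g) (swapCutoff ψ) a) (pa a) (pb b)
  simp only [hint]
  refine ⟨integrable_finsetSum _ fun b _ => integrable_finsetSum _ fun a _ => (hpair b a).1, ?_⟩
  rw [integral_finsetSum _ fun b _ => integrable_finsetSum _ fun a _ => (hpair b a).1]
  have hval : ∀ b a, G b (pa a) * H a (pb b) = dftPhase m j * f.1 (fibrePoint k m j) *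
      conj (g.1 (fibrePoint k m j)) * (χ.toFun (fibrePoint k m j + latVec (a, b)) *
        conj (ψ.toFun (fibrePoint k m j + latVec (a, b)))) := by
    intro b a
    have h1 := fibre_phase_mul_phase m j a b
    have h2 : fibrePoint k m j + latVec (a, b) = (pa a, pb b) := rfl
    have h3 : f.1 (pa a, (k : ℝ)⁻¹ • rep m) = f.1 (fibrePoint k m j) := by
      have h : fibrePoint k m j + latVec (a, 0) = (pa a, (k : ℝ)⁻¹ • rep m) := by
        ext i <;> simp [latVec, fibrePoint, pa]
      rw [← h, f.2.2]
    have h4 : (swapFn g).1 (pb b, (k : ℝ)⁻¹ • rep j) = conj (g.1 (fibrePoint k m j)) := by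
      have h : fibrePoint k m j + latVec (0, b) = ((k : ℝ)⁻¹ • rep j, pb b) := by
        ext i <;> simp [latVec, fibrePoint, pb]
      change conj (g.1 ((k : ℝ)⁻¹ • rep j, pb b)) = _
      rw [← h, g.2.2]
    have h5 : (swapCutoff ψ).toFun (pb b, (k : ℝ)⁻¹ • rep j + fun i => (a i : ℝ)) =
      conj (ψ.toFun (pa a, pb b)) := rfl
    simp only [G, H, sliceX]
    rw [h2, h3, h4, h5, ← h1]
    ring
  have h6 := hχψ (fibrePoint k m j)
  rw [tsum_eq_sum (s := A ×ˢ B) fun l hl => ?_, Finset.sum_product_right] at h6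
  · calc _ = ∑ b ∈ B, ∑ a ∈ A, G b (pa a) * H a (pb b) := by
          refine Finset.sum_congr rfl fun b _ => ?_
          rw [integral_finsetSum _ fun a _ => (hpair b a).1]
          exact Finset.sum_congr rfl fun a _ => (hpair b a).2
      _ = _ := by
          simp only [hval, ← Finset.mul_sum]
          rw [h6, mul_one]
  · rw [Finset.mem_product, not_and_or] at hl
    rcases hl with hl | hl
    · have h7 := hA _ hl ((k : ℝ)⁻¹ • rep m + fun i => (l.2 i : ℝ))
      have h8 : conj (ψ.toFun (fibrePoint k m j + latVec l)) = 0 := h7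
      rw [h8, mul_zero]
    · have h7 := hB _ hl ((k : ℝ)⁻¹ • rep j + fun i => (l.1 i : ℝ))
      have h8 : χ.toFun (fibrePoint k m j + latVec l) = 0 := h7
      rw [h8, zero_mul]

/-! ### Algebra of the pairing -/

theorem exists_cutoff_pair (n : ℕ) : ∃ χ ψ : Cutoff n, ∀ p : Phase n,
    ∑' l : Lattice n, χ.toFun (p + latVec l) * conj (ψ.toFun (p + latVec l)) = 1 := by
  let β : ContDiffBump (0 : Phase n) := ⟨2, 3, by norm_num, by norm_num⟩
  let γ : ContDiffBump (0 : Phase n) := ⟨3, 4, by norm_num, by norm_num⟩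
  let b : Cutoff n := ⟨fun p => (β p : ℂ), Complex.ofRealCLM.contDiff.comp β.contDiff,
    β.hasCompactSupport.comp_left (g := fun r : ℝ => (r : ℂ)) Complex.ofReal_zero⟩
  -- for `k = 0` the multipliers are trivial, so that `periodize 0 b` is the periodization of `b`
  let S : Phase n → ℂ := (periodize 0 b).1
  have hS : ∀ p, S p = ((∑' l : Lattice n, β (p + latVec l) : ℝ) : ℂ) := by
    intro p
    rw [Complex.ofReal_tsum]
    refine tsum_congr fun l => ?_
    simp [multiplier, b]
  have hSper : ∀ p l, S (p + latVec l) = S p := by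
    intro p l
    have := (periodize 0 b).2.2 p l
    simpa [multiplier] using this
  have hS0 : ∀ p, S p ≠ 0 := by
    intro p
    rw [hS]
    have hfin : (Function.support fun l : Lattice n => β (p + latVec l)).Finite := by
      refine (finite_latVec_bounded (n := n) (3 + ‖p‖)).subset fun l hl => ?_
      have h1 : p + latVec l ∈ Function.support β := hl
      rw [β.support_eq, mem_ball_zero_iff] at h1
      have h2 := norm_sub_le (p + latVec l) p
      rw [add_sub_cancel_left] at h2
      have h3 : ‖p + latVec l‖ < 3 := h1
      simp only [Set.mem_ofPred_eq]
      linarith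
    let l₀ : Lattice n := (fun i => -⌊p.1 i⌋, fun i => -⌊p.2 i⌋)
    have h1 : β (p + latVec l₀) = 1 := by
      refine β.one_of_mem_closedBall ?_
      rw [mem_closedBall_zero_iff]
      refine le_trans ?_ (show (1 : ℝ) ≤ 2 by norm_num)
      have hfr : ∀ r : ℝ, ‖r + ((-⌊r⌋ : ℤ) : ℝ)‖ ≤ 1 := fun r => by
        have : r + ((-⌊r⌋ : ℤ) : ℝ) = Int.fract r := by rw [Int.fract]; push_cast; ring
        rw [this, Real.norm_of_nonneg (Int.fract_nonneg _)]
        exact (Int.fract_lt_one _).le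
      exact norm_prod_le_iff.2 ⟨(pi_norm_le_iff_of_nonneg zero_le_one).2 fun i => hfr _,
        (pi_norm_le_iff_of_nonneg zero_le_one).2 fun i => hfr _⟩
    have h2 : 0 < ∑' l : Lattice n, β (p + latVec l) :=
      (summable_of_hasFiniteSupport hfin).tsum_pos (fun l => β.nonneg) l₀ (by rw [h1]; exact one_pos)
    exact_mod_cast h2.ne'
  have hSc : ContDiff ℝ ∞ S := (periodize 0 b).2.1
  refine ⟨⟨fun p => b.toFun p * (S p)⁻¹, b.smooth.mul (hSc.inv hS0), b.compact.mul_right⟩,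
    ⟨fun p => (γ p : ℂ), Complex.ofRealCLM.contDiff.comp γ.contDiff,
    γ.hasCompactSupport.comp_left (g := fun r : ℝ => (r : ℂ)) Complex.ofReal_zero⟩, fun p => ?_⟩
  have hterm : ∀ l : Lattice n, b.toFun (p + latVec l) * (S (p + latVec l))⁻¹ *
      conj (γ (p + latVec l) : ℂ) = ((β (p + latVec l) : ℝ) : ℂ) * (S p)⁻¹ := by
    intro l
    rw [hSper, Complex.conj_ofReal]
    by_cases h : β (p + latVec l) = 0
    · simp [b, h]
    · have h1 : p + latVec l ∈ Function.support β := h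
      rw [β.support_eq] at h1
      rw [γ.one_of_mem_closedBall (Metric.ball_subset_closedBall h1)]
      simp [b]
  simp only [hterm]
  rw [tsum_mul_right, ← Complex.ofReal_tsum, ← hS, mul_inv_cancel₀ (hS0 p)]

theorem HasPairing.unique {n k : ℕ} {u v : DistSec n k} {c c' : ℂ} (h : HasPairing u v c)
    (h' : HasPairing u v c') : c = c' := by
  obtain ⟨χ, ψ, hχψ⟩ := exists_cutoff_pair n
  exact (h χ ψ hχψ).2.symm.trans (h' χ ψ hχψ).2

theorem HasPairing.existsUnique {n k : ℕ} {u v : DistSec n k} {c : ℂ} (h : HasPairing u v c) :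
    ∃! c, HasPairing u v c :=
  ⟨c, h, fun _ h' => h'.unique h⟩

theorem HasPairing.pairing_eq {n k : ℕ} {u v : DistSec n k} {c : ℂ} (h : HasPairing u v c) :
    pairing u v = c := by
  rw [pairing, dif_pos h.existsUnique]
  exact (Exists.choose_spec h.existsUnique).1.unique h

theorem localFourier_sum_smul {n k : ℕ} {ι : Type*} [Fintype ι] (χ : Cutoff n) (c : ι → ℂ)
    (u : ι → DistSec n k) (ζ : Phase n) :
    localFourier χ (∑ i, c i • u i) ζ = ∑ i, c i * localFourier χ (u i) ζ := by
  simp [localFourier, LinearMap.sum_apply]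

theorem HasPairing.sum_left {n k : ℕ} {ι : Type*} [Fintype ι] {u : ι → DistSec n k}
    {v : DistSec n k} {d : ι → ℂ} (c : ι → ℂ) (h : ∀ i, HasPairing (u i) v (d i)) :
    HasPairing (∑ i, c i • u i) v (∑ i, c i * d i) := by
  intro χ ψ hχψ
  have h1 := fun i => h i χ ψ hχψ
  simp only [localFourier_sum_smul, Finset.sum_mul, mul_assoc]
  refine ⟨integrable_finsetSum _ fun i _ => (h1 i).1.const_mul _, ?_⟩
  rw [integral_finsetSum _ fun i _ => (h1 i).1.const_mul _]
  refine Finset.sum_congr rfl fun i _ => ?_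
  rw [integral_const_mul, (h1 i).2]

theorem HasPairing.symm {n k : ℕ} {u v : DistSec n k} {c : ℂ} (h : HasPairing u v c) :
    HasPairing v u (conj c) := by
  intro χ ψ hχψ
  have h0 : ∀ p : Phase n, ∑' l : Lattice n,
      ψ.toFun (p + latVec l) * conj (χ.toFun (p + latVec l)) = 1 := by
    intro p
    rw [← map_one (starRingEnd ℂ), ← hχψ p, Complex.conj_tsum]
    refine tsum_congr fun l => ?_
    rw [map_mul, Complex.conj_conj, mul_comm]
  have h1 := h ψ χ h0
  have h2 : ∀ ζ, localFourier χ v ζ * conj (localFourier ψ u ζ) =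
      conj (localFourier ψ u ζ * conj (localFourier χ v ζ)) := fun ζ => by
    rw [map_mul, Complex.conj_conj, mul_comm]
  simp only [h2]
  exact ⟨(Complex.conjCLE.toContinuousLinearMap.integrable_comp h1.1), by rw [integral_conj, h1.2]⟩

theorem HasPairing.sum_right {n k : ℕ} {ι : Type*} [Fintype ι] {u : DistSec n k}
    {v : ι → DistSec n k} {d : ι → ℂ} (c : ι → ℂ) (h : ∀ i, HasPairing u (v i) (d i)) :
    HasPairing u (∑ i, c i • v i) (∑ i, conj (c i) * d i) := by
  have h1 := (HasPairing.sum_left c fun i => (h i).symm).symm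
  simpa using h1

theorem HasPairing.smul_left {n k : ℕ} {u v : DistSec n k} {d : ℂ} (c : ℂ)
    (h : HasPairing u v d) : HasPairing (c • u) v (c * d) := by
  simpa using HasPairing.sum_left (ι := Unit) (fun _ => c) fun _ => h

theorem HasPairing.smul_right {n k : ℕ} {u v : DistSec n k} {d : ℂ} (c : ℂ)
    (h : HasPairing u v d) : HasPairing u (c • v) (conj c * d) := by
  simpa using HasPairing.sum_right (ι := Unit) (fun _ => c) fun _ => h

/-! ### Matrix coefficients in the bases `σ^m` and `σ̌^m` -/

theorem mulDist_sum_smul {n k : ℕ} {ι : Type*} [Fintype ι] (f : SmoothFn n) (c : ι → ℂ)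
    (u : ι → DistSec n k) : mulDist f (∑ i, c i • u i) = ∑ i, c i • mulDist f (u i) := by
  ext t
  simp [mulDist, LinearMap.sum_apply]

theorem mulDist_one {n k : ℕ} (u : DistSec n k) : mulDist 1 u = u := by
  ext t
  change u.1 (mulSec (conjFn 1) t) = u.1 t
  congr 1
  ext p
  simp [mulSec, conjFn]

/-- The additive character `e^{2πi·/k}` of `ℤ/k`, evaluated at the product of `a` and `b`. -/
def dftChar {n k : ℕ} [NeZero k] (a b : Fin n → ZMod k) : ℂ := ZMod.stdAddChar (a ⬝ᵥ b)

theorem dftPhase_eq {n k : ℕ} [NeZero k] (m j : Fin n → ZMod k) : dftPhase m j = dftChar m j := by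
  have h1 : m ⬝ᵥ j = ((∑ i, ((m i).val : ℤ) * (j i).val : ℤ) : ZMod k) := by
    simp [dotProduct]
  have h2 : rep m ⬝ᵥ rep j = ((∑ i, ((m i).val : ℤ) * (j i).val : ℤ) : ℝ) := by
    simp [dotProduct, rep]
  rw [dftChar, h1, ZMod.stdAddChar_coe, dftPhase, h2]
  congr 1

theorem dftChar_add_left {n k : ℕ} [NeZero k] (a a' b : Fin n → ZMod k) :
    dftChar (a + a') b = dftChar a b * dftChar a' b := by
  simp [dftChar, add_dotProduct, AddChar.map_add_eq_mul]

theorem dftChar_add_right {n k : ℕ} [NeZero k] (a b b' : Fin n → ZMod k) :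
    dftChar a (b + b') = dftChar a b * dftChar a b' := by
  simp [dftChar, dotProduct_add, AddChar.map_add_eq_mul]

theorem conj_dftChar {n k : ℕ} [NeZero k] (a b : Fin n → ZMod k) :
    conj (dftChar a b) = dftChar (-a) b := by
  rw [dftChar, dftChar, neg_dotProduct, AddChar.map_neg_eq_conj]

theorem norm_dftChar {n k : ℕ} [NeZero k] (a b : Fin n → ZMod k) : ‖dftChar a b‖ = 1 :=
  AddChar.norm_apply _ _

theorem addChar_sum {ι A M : Type*} [AddCommMonoid A] [CommMonoid M] (ψ : AddChar A M)
    (S : Finset ι) (f : ι → A) : ψ (∑ i ∈ S, f i) = ∏ i ∈ S, ψ (f i) := by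
  classical
  induction S using Finset.induction_on with
  | empty => simp
  | insert a S ha ih =>
    rw [Finset.sum_insert ha, Finset.prod_insert ha, AddChar.map_add_eq_mul, ih]

theorem sum_dftChar {n k : ℕ} [NeZero k] (a : Fin n → ZMod k) :
    ∑ j, dftChar a j = if a = 0 then (k : ℂ) ^ n else 0 := by
  classical
  have h1 : ∀ j, dftChar a j = ∏ i, ZMod.stdAddChar (j i * a i) := by
    intro j
    rw [dftChar, dotProduct, addChar_sum]
    simp only [mul_comm]
  have h2 := Finset.prod_univ_sum (fun _ : Fin n => (Finset.univ : Finset (ZMod k)))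
    (fun i x => (ZMod.stdAddChar (x * a i) : ℂ))
  rw [Fintype.piFinset_univ] at h2
  simp only [h1]
  rw [← h2]
  simp only [AddChar.sum_mulShift _ (ZMod.isPrimitive_stdAddChar k), ZMod.card]
  split_ifs with ha
  · simp [ha]
  · obtain ⟨i, hi⟩ := Function.ne_iff.1 ha
    exact Finset.prod_eq_zero (Finset.mem_univ i) (by simp [show a i ≠ 0 from hi])

/-- The scalar factor of `σ^m` relative to the unit section of the fibre. -/
def sigmaXScale (n k : ℕ) : ℝ :=
  ((2 : ℝ) ^ ((n : ℝ) / 4) * (k : ℝ) ^ ((n : ℝ) / 2)) * (2 * k : ℝ) ^ (-(n : ℝ) / 2)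

/-- The scalar factor of `σ̌^m` relative to the sum of the unit sections of the fibres. -/
def sigmaYScale (n k : ℕ) : ℝ :=
  ((2 : ℝ) ^ ((n : ℝ) / 4) * (k : ℝ) ^ ((n : ℝ) / 2)) * (2 : ℝ) ^ (-(n : ℝ) / 2) * ((k : ℝ) ^ n)⁻¹

theorem halfForm_mul_scale (n k : ℕ) [NeZero k] :
    halfForm n k * (sigmaXScale n k * sigmaYScale n k) = ((k : ℝ) ^ n)⁻¹ := by
  have hk : (0 : ℝ) < k := by exact_mod_cast Nat.pos_of_ne_zero (NeZero.ne k)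
  have h2 : (0 : ℝ) < 2 := two_pos
  have hh : halfForm n k = (2 : ℝ) ^ ((n : ℝ) / 2) * (k : ℝ) ^ (-(n : ℝ) / 2) := by
    rw [halfForm, Real.sqrt_eq_rpow, Real.div_rpow (by positivity) (by positivity),
      ← Real.rpow_natCast, ← Real.rpow_natCast, ← Real.rpow_mul h2.le, ← Real.rpow_mul hk.le,
      div_eq_mul_inv, ← Real.rpow_neg hk.le]
    congr 2 <;> ring
  rw [hh, sigmaXScale, sigmaYScale, Real.mul_rpow h2.le hk.le]
  have e2 : (2 : ℝ) ^ ((n : ℝ) / 2) * ((2 : ℝ) ^ ((n : ℝ) / 4) * (2 : ℝ) ^ (-(n : ℝ) / 2) *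
      ((2 : ℝ) ^ ((n : ℝ) / 4) * (2 : ℝ) ^ (-(n : ℝ) / 2))) = 1 := by
    simp only [← Real.rpow_add h2]
    rw [← Real.rpow_zero (2 : ℝ)]
    congr 1
    ring
  have ek : (k : ℝ) ^ (-(n : ℝ) / 2) * ((k : ℝ) ^ ((n : ℝ) / 2) * (k : ℝ) ^ (-(n : ℝ) / 2) *
      (k : ℝ) ^ ((n : ℝ) / 2)) = 1 := by
    simp only [← Real.rpow_add hk]
    rw [← Real.rpow_zero (k : ℝ)]
    congr 1
    ring
  linear_combination ((k : ℝ) ^ n)⁻¹ * ((k : ℝ) ^ (-(n : ℝ) / 2) * ((k : ℝ) ^ ((n : ℝ) / 2) *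
    (k : ℝ) ^ (-(n : ℝ) / 2) * (k : ℝ) ^ ((n : ℝ) / 2))) * e2 + ((k : ℝ) ^ n)⁻¹ * ek

theorem sigmaXScale_ne_zero (n k : ℕ) [NeZero k] : sigmaXScale n k ≠ 0 := by
  have hk : (0 : ℝ) < k := by exact_mod_cast Nat.pos_of_ne_zero (NeZero.ne k)
  unfold sigmaXScale; positivity

theorem sigmaYScale_ne_zero (n k : ℕ) [NeZero k] : sigmaYScale n k ≠ 0 := by
  have hk : (0 : ℝ) < k := by exact_mod_cast Nat.pos_of_ne_zero (NeZero.ne k)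
  unfold sigmaYScale; positivity

theorem sigmaX_val {n k : ℕ} [NeZero k] (m : Fin n → ZMod k) :
    (sigmaX k m).1 = (sigmaXScale n k : ℂ) • fibreX k m := by
  simp only [sigmaX, thetaX, sigmaXScale, Submodule.coe_smul, smul_smul]
  congr 1
  push_cast
  ring

theorem sigmaY_val {n k : ℕ} [NeZero k] (m : Fin n → ZMod k) :
    (sigmaY k m).1 = (sigmaYScale n k : ℂ) • ∑ j, dftChar m j • fibreY k j := by
  have h : ∀ j, Complex.exp (2 * Real.pi * Complex.I * ((rep m ⬝ᵥ rep j : ℝ) : ℂ) / k)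
      = dftChar m j := fun j => dftPhase_eq m j
  simp only [sigmaY, thetaY, sigmaYScale, Submodule.coe_smul, smul_smul, h]
  rw [Submodule.coe_sum]
  congr 1
  push_cast
  ring

/-- The matrix of the Toeplitz operator `Q_f` in the basis `σ^m`. -/
def matrixX {n : ℕ} (k : ℕ) [NeZero k] (f : SmoothFn n) :
    Matrix (Fin n → ZMod k) (Fin n → ZMod k) ℂ := fun m m' =>
  ((k : ℂ) ^ n)⁻¹ * ∑ j, dftChar (m' - m) j * f.1 (fibrePoint k m' j)

/-- The matrix of the Toeplitz operator `Q̌_f` in the basis `σ̌^m`. It differs from that of `Q_f`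
in the point of evaluation of `f`. -/
def matrixY {n : ℕ} (k : ℕ) [NeZero k] (f : SmoothFn n) :
    Matrix (Fin n → ZMod k) (Fin n → ZMod k) ℂ := fun m m' =>
  ((k : ℂ) ^ n)⁻¹ * ∑ j, dftChar (m' - m) j * f.1 (fibrePoint k m j)

theorem hasPairing_fibreX_sigmaY {n k : ℕ} [NeZero k] (f : SmoothFn n) (m m' : Fin n → ZMod k) :
    HasPairing (mulDist f (fibreX k m')) (sigmaY k m).1
      (sigmaYScale n k * ∑ j, dftChar (m' - m) j * f.1 (fibrePoint k m' j)) := by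
  have h1 := (HasPairing.sum_right (fun j => dftChar m j) fun j =>
    hasPairing_fibreX_fibreY f 1 m' j).smul_right (sigmaYScale n k : ℂ)
  simp only [mulDist_one] at h1
  rw [sigmaY_val]
  convert h1 using 2
  · rw [Complex.conj_ofReal]
  · refine Finset.sum_congr rfl fun j _ => ?_
    rw [sub_eq_neg_add, dftChar_add_left, ← conj_dftChar, dftPhase_eq]
    simp
    ring

theorem hasPairing_fibreY_sigmaX {n k : ℕ} [NeZero k] (f : SmoothFn n) (m j : Fin n → ZMod k) :
    HasPairing (mulDist f (fibreY k j)) (sigmaX k m).1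
      (sigmaXScale n k * (dftChar (-m) j * f.1 (fibrePoint k m j))) := by
  have h1 := ((hasPairing_fibreX_fibreY 1 f m j).smul_left (sigmaXScale n k : ℂ)).symm
  rw [mulDist_one, ← sigmaX_val] at h1
  convert h1 using 1
  rw [← conj_dftChar, dftPhase_eq]
  simp

theorem bksPairing_sigmaX_sigmaY {n k : ℕ} [NeZero k] (f : SmoothFn n) (c : (Fin n → ZMod k) → ℂ)
    (m : Fin n → ZMod k) :
    bksPairing (mulDist f (∑ m', c m' • sigmaX k m' : HX n k).1) (sigmaY k m).1
      = (matrixX k f).mulVec c m := by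
  have h1 : (∑ m', c m' • sigmaX k m' : HX n k).1
      = ∑ m', (c m' * sigmaXScale n k) • fibreX k m' := by
    rw [Submodule.coe_sum]
    refine Finset.sum_congr rfl fun m' _ => ?_
    rw [Submodule.coe_smul, sigmaX_val, smul_smul]
  have h2 := HasPairing.sum_left (fun m' => c m' * sigmaXScale n k) fun m' =>
    hasPairing_fibreX_sigmaY f m m'
  have h3 : (halfForm n k : ℂ) * (sigmaXScale n k * sigmaYScale n k) = ((k : ℂ) ^ n)⁻¹ := by
    rw [← Complex.ofReal_mul, ← Complex.ofReal_mul, halfForm_mul_scale]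
    push_cast
    rfl
  rw [h1, mulDist_sum_smul, bksPairing, h2.pairing_eq, Finset.mul_sum]
  refine Finset.sum_congr rfl fun m' _ => ?_
  change _ = ((k : ℂ) ^ n)⁻¹ * (∑ j, _) * c m'
  rw [← h3]
  ring

theorem bksPairing_sigmaY_sigmaX {n k : ℕ} [NeZero k] (f : SmoothFn n) (c : (Fin n → ZMod k) → ℂ)
    (m : Fin n → ZMod k) :
    bksPairing (mulDist f (∑ m', c m' • sigmaY k m' : HY n k).1) (sigmaX k m).1
      = (matrixY k f).mulVec c m := by
  have h1 : (∑ m', c m' • sigmaY k m' : HY n k).1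
      = ∑ j, (∑ m', c m' * sigmaYScale n k * dftChar m' j) • fibreY k j := by
    rw [Submodule.coe_sum]
    simp only [Finset.sum_smul]
    rw [Finset.sum_comm]
    refine Finset.sum_congr rfl fun m' _ => ?_
    rw [Submodule.coe_smul, sigmaY_val, smul_smul, Finset.smul_sum]
    simp only [smul_smul]
  have h2 := HasPairing.sum_left (fun j => ∑ m', c m' * sigmaYScale n k * dftChar m' j) fun j =>
    hasPairing_fibreY_sigmaX f m j
  have h3 : (halfForm n k : ℂ) * (sigmaXScale n k * sigmaYScale n k) = ((k : ℂ) ^ n)⁻¹ := by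
    rw [← Complex.ofReal_mul, ← Complex.ofReal_mul, halfForm_mul_scale]
    push_cast
    rfl
  rw [h1, mulDist_sum_smul, bksPairing, h2.pairing_eq]
  simp only [Finset.mul_sum, Finset.sum_mul, Matrix.mulVec, dotProduct, matrixY, ← h3]
  rw [Finset.sum_comm]
  refine Finset.sum_congr rfl fun m' _ => Finset.sum_congr rfl fun j _ => ?_
  rw [sub_eq_add_neg, dftChar_add_left]
  ring

theorem matrixX_one {n k : ℕ} [NeZero k] : matrixX k (1 : SmoothFn n) = 1 := by
  have hk : (k : ℂ) ≠ 0 := by exact_mod_cast NeZero.ne k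
  ext m m'
  simp only [matrixX, OneMemClass.coe_one, Pi.one_apply, mul_one, sum_dftChar, sub_eq_zero,
    Matrix.one_apply, eq_comm (a := m')]
  split_ifs <;> simp [hk]

theorem matrixY_one {n k : ℕ} [NeZero k] : matrixY k (1 : SmoothFn n) = 1 := matrixX_one

/-- The linear combinations of the basis states `σ^m`. -/
def combX (n k : ℕ) [NeZero k] : ((Fin n → ZMod k) → ℂ) →ₗ[ℂ] HX n k :=
  Fintype.linearCombination ℂ (sigmaX k)

/-- The linear combinations of the basis states `σ̌^m`. -/
def combY (n k : ℕ) [NeZero k] : ((Fin n → ZMod k) → ℂ) →ₗ[ℂ] HY n k :=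
  Fintype.linearCombination ℂ (sigmaY k)

theorem bksPairing_combX {n k : ℕ} [NeZero k] (c : (Fin n → ZMod k) → ℂ) (m : Fin n → ZMod k) :
    bksPairing (combX n k c).1 (sigmaY k m).1 = c m := by
  have h := bksPairing_sigmaX_sigmaY 1 c m
  rwa [mulDist_one, matrixX_one, Matrix.one_mulVec] at h

theorem bksPairing_combY {n k : ℕ} [NeZero k] (c : (Fin n → ZMod k) → ℂ) (m : Fin n → ZMod k) :
    bksPairing (combY n k c).1 (sigmaX k m).1 = c m := by
  have h := bksPairing_sigmaY_sigmaX 1 c m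
  rwa [mulDist_one, matrixY_one, Matrix.one_mulVec] at h

theorem bijective_combX (n k : ℕ) [NeZero k] : Function.Bijective (combX n k) := by
  have hα : (sigmaXScale n k : ℂ) ≠ 0 := by exact_mod_cast sigmaXScale_ne_zero n k
  refine ⟨fun c c' h => funext fun m => ?_, fun s => ?_⟩
  · rw [← bksPairing_combX c, h, bksPairing_combX]
  · obtain ⟨c, hc⟩ := HX.mem_span_fibreX s
    refine ⟨fun m => c m * (sigmaXScale n k : ℂ)⁻¹, Subtype.ext ?_⟩
    rw [hc]
    change (∑ m, (c m * (sigmaXScale n k : ℂ)⁻¹) • sigmaX k m : HX n k).1 = _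
    rw [Submodule.coe_sum]
    refine Finset.sum_congr rfl fun m _ => ?_
    rw [Submodule.coe_smul, sigmaX_val, smul_smul, mul_assoc, inv_mul_cancel₀ hα, mul_one]

/-- Inversion of the discrete Fourier transform expresses the fibres in the basis `σ̌^m`. -/
theorem fibreY_eq_sum_sigmaY {n k : ℕ} [NeZero k] (j : Fin n → ZMod k) :
    fibreY k j = ∑ m, ((sigmaYScale n k : ℂ)⁻¹ * ((k : ℂ) ^ n)⁻¹ * dftChar (-j) m) •
      (sigmaY k m).1 := by
  have hβ : (sigmaYScale n k : ℂ) ≠ 0 := by exact_mod_cast sigmaYScale_ne_zero n k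
  have hk : (k : ℂ) ≠ 0 := by exact_mod_cast NeZero.ne k
  have hcomm : ∀ a b : Fin n → ZMod k, dftChar a b = dftChar b a := fun a b => by
    rw [dftChar, dftChar, dotProduct_comm]
  simp only [sigmaY_val, Finset.smul_sum, smul_smul]
  rw [Finset.sum_comm]
  simp only [← Finset.sum_smul]
  have h : ∀ j', ∑ m, (sigmaYScale n k : ℂ)⁻¹ * ((k : ℂ) ^ n)⁻¹ * dftChar (-j) m *
      sigmaYScale n k * dftChar m j' = if j' = j then 1 else 0 := by
    intro j'
    have h1 : ∀ m, (sigmaYScale n k : ℂ)⁻¹ * ((k : ℂ) ^ n)⁻¹ * dftChar (-j) m *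
      sigmaYScale n k * dftChar m j' = ((k : ℂ) ^ n)⁻¹ * dftChar (j' - j) m := by
      intro m
      rw [hcomm m j', sub_eq_neg_add, dftChar_add_left]
      field_simp
    simp only [h1, ← Finset.mul_sum, sum_dftChar, sub_eq_zero]
    split_ifs <;> simp [hk]
  have h' : ∀ j', ∑ m, (sigmaYScale n k : ℂ)⁻¹ * ((k : ℂ) ^ n)⁻¹ * dftChar (-j) m *
      (sigmaYScale n k * dftChar m j') = if j' = j then 1 else 0 := fun j' => by
    rw [← h j']; simp only [mul_assoc]
  simp [h']

theorem bijective_combY (n k : ℕ) [NeZero k] : Function.Bijective (combY n k) := by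
  refine ⟨fun c c' h => funext fun m => ?_, fun s => ?_⟩
  · rw [← bksPairing_combY c, h, bksPairing_combY]
  · obtain ⟨c, hc⟩ := HY.mem_span_fibreY s
    refine ⟨fun m => ∑ j, c j * ((sigmaYScale n k : ℂ)⁻¹ * ((k : ℂ) ^ n)⁻¹ * dftChar (-j) m),
      Subtype.ext ?_⟩
    rw [hc]
    change (∑ m, (∑ j, c j * _) • sigmaY k m : HY n k).1 = _
    rw [Submodule.coe_sum]
    simp only [Finset.sum_smul, Submodule.coe_sum, Submodule.coe_smul]
    rw [Finset.sum_comm]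
    refine Finset.sum_congr rfl fun j _ => ?_
    conv_rhs => rw [fibreY_eq_sum_sigmaY, Finset.smul_sum]
    simp only [smul_smul]

theorem toeplitzX_combX {n k : ℕ} [NeZero k] (f : SmoothFn n) (c : (Fin n → ZMod k) → ℂ) :
    toeplitzX f (combX n k c) = combX n k ((matrixX k f).mulVec c) := by
  refine Finset.sum_congr rfl fun m _ => ?_
  exact congrArg (· • sigmaX k m) (bksPairing_sigmaX_sigmaY f c m)

theorem toeplitzY_combY {n k : ℕ} [NeZero k] (f : SmoothFn n) (c : (Fin n → ZMod k) → ℂ) :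
    toeplitzY f (combY n k c) = combY n k ((matrixY k f).mulVec c) := by
  refine Finset.sum_congr rfl fun m _ => ?_
  exact congrArg (· • sigmaY k m) (bksPairing_sigmaY_sigmaX f c m)

theorem stateNorm_combX {n k : ℕ} [NeZero k] (c : (Fin n → ZMod k) → ℂ) :
    stateNorm (combX n k c) = Real.sqrt (∑ m, ‖c m‖ ^ 2) := by
  simp only [stateNorm, bksPairing_combX]

theorem pairingsDefined (n k : ℕ) [NeZero k] : PairingsDefined n k := by
  refine fun f m => ⟨fun s => ?_, fun s => ?_⟩
  · obtain ⟨c, hc⟩ := HX.mem_span_fibreX s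
    rw [hc, mulDist_sum_smul]
    exact (HasPairing.sum_left c fun m' => hasPairing_fibreX_sigmaY f m m').existsUnique
  · obtain ⟨c, hc⟩ := HY.mem_span_fibreY s
    rw [hc, mulDist_sum_smul]
    exact (HasPairing.sum_left c fun j => hasPairing_fibreY_sigmaX f m j).existsUnique

theorem combX_single {n k : ℕ} [NeZero k] [DecidableEq (Fin n → ZMod k)] (m : Fin n → ZMod k) :
    combX n k (Pi.single m 1) = sigmaX k m := by
  simp [combX]

theorem combY_single {n k : ℕ} [NeZero k] [DecidableEq (Fin n → ZMod k)] (m : Fin n → ZMod k) :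
    combY n k (Pi.single m 1) = sigmaY k m := by
  simp [combY]

theorem IsBKSMap.apply_combY {n k : ℕ} [NeZero k] {B : HY n k ≃ₗ[ℂ] HX n k} (hB : IsBKSMap B)
    (c : (Fin n → ZMod k) → ℂ) : B (combY n k c) = combX n k c := by
  simp only [combX, combY, Fintype.linearCombination_apply, map_sum, map_smul]
  exact Finset.sum_congr rfl fun m _ => by rw [hB m]

theorem existsUnique_isBKSMap (n k : ℕ) [NeZero k] :
    ∃! B : HY n k ≃ₗ[ℂ] HX n k, IsBKSMap B := by
  classical
  let eX := LinearEquiv.ofBijective _ (bijective_combX n k)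
  let eY := LinearEquiv.ofBijective _ (bijective_combY n k)
  have h : IsBKSMap (eY.symm.trans eX) := fun m => by
    have h1 : eY.symm (sigmaY k m) = Pi.single m 1 :=
      eY.symm_apply_eq.2 (combY_single m).symm
    rw [LinearEquiv.trans_apply, h1]
    exact combX_single m
  refine ⟨_, h, fun B hB => LinearEquiv.ext fun s => ?_⟩
  obtain ⟨c, rfl⟩ := (bijective_combY n k).2 s
  rw [hB.apply_combY, h.apply_combY]

theorem isLinearMap_combX_mulVec {n k : ℕ} [NeZero k]
    (D : Matrix (Fin n → ZMod k) (Fin n → ZMod k) ℂ) {A : HX n k → HX n k}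
    (hA : ∀ c, A (combX n k c) = combX n k (D.mulVec c)) : IsLinearMap ℂ A := by
  constructor
  · intro s s'
    obtain ⟨c, rfl⟩ := (bijective_combX n k).2 s
    obtain ⟨c', rfl⟩ := (bijective_combX n k).2 s'
    rw [← map_add, hA, hA, hA, Matrix.mulVec_add, map_add]
  · intro a s
    obtain ⟨c, rfl⟩ := (bijective_combX n k).2 s
    rw [← map_smul, hA, hA, Matrix.mulVec_smul, map_smul]

/-! ### Fourier series on the torus -/

theorem int_dot_int {n : ℕ} (a b : Fin n → ℤ) :
    (fun i => (a i : ℝ)) ⬝ᵥ (fun i => (b i : ℝ)) = ((∑ i, a i * b i : ℤ) : ℝ) := by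
  simp [dotProduct]

/-- The character `e^{2πi(p·x + q·y)}` of the torus, for `l = (p, q)`. -/
def wave {n : ℕ} (l : Lattice n) : SmoothFn n :=
  ⟨fun z => Complex.exp (2 * Real.pi * Complex.I *
    (((latVec l).1 ⬝ᵥ z.1 + (latVec l).2 ⬝ᵥ z.2 : ℝ) : ℂ)), by
    refine ⟨ContDiff.cexp (contDiff_const.mul (Complex.ofRealCLM.contDiff.comp
      ((contDiff_dot contDiff_const contDiff_fst).add
        (contDiff_dot contDiff_const contDiff_snd)))), fun z l' => ?_⟩
    rw [Complex.exp_eq_exp_iff_exists_int]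
    refine ⟨∑ i, l.1 i * l'.1 i + ∑ i, l.2 i * l'.2 i, ?_⟩
    have h1 := int_dot_int l.1 l'.1
    have h2 := int_dot_int l.2 l'.2
    simp only [Prod.fst_add, Prod.snd_add, dotProduct_add, latVec, h1, h2]
    push_cast
    ring⟩

theorem wave_apply {n : ℕ} (l : Lattice n) (z : Phase n) :
    (wave l).1 z = Complex.exp (2 * Real.pi * Complex.I *
      (((latVec l).1 ⬝ᵥ z.1 + (latVec l).2 ⬝ᵥ z.2 : ℝ) : ℂ)) := rfl

theorem norm_wave {n : ℕ} (l : Lattice n) (z : Phase n) : ‖(wave l).1 z‖ = 1 :=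
  norm_exp_two_pi_I_mul _

/-- The Fourier coefficients of a smooth function on the torus. -/
def fourierCoef {n : ℕ} (f : SmoothFn n) (l : Lattice n) : ℂ :=
  ∫ z in Set.Icc (0 : Phase n) 1, (wave (-l)).1 z * f.1 z

theorem continuous_smoothFn {n : ℕ} (f : SmoothFn n) : Continuous f.1 := f.2.1.continuous

theorem integrableOn_smoothFn {n : ℕ} (f : SmoothFn n) :
    IntegrableOn f.1 (Set.Icc (0 : Phase n) 1) :=
  (continuous_smoothFn f).continuousOn.integrableOn_compact isCompact_Icc

theorem fourierCoef_add {n : ℕ} (f g : SmoothFn n) (l : Lattice n) :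
    fourierCoef (f + g) l = fourierCoef f l + fourierCoef g l := by
  have h := integral_add (integrableOn_smoothFn (wave (-l) * f))
    (integrableOn_smoothFn (wave (-l) * g))
  refine Eq.trans ?_ h
  refine integral_congr_ae (Filter.Eventually.of_forall fun z => ?_)
  simp [mul_add]

theorem fourierCoef_smul {n : ℕ} (c : ℂ) (f : SmoothFn n) (l : Lattice n) :
    fourierCoef (c • f) l = c * fourierCoef f l := by
  rw [fourierCoef, fourierCoef, ← integral_const_mul]
  refine integral_congr_ae (Filter.Eventually.of_forall fun z => ?_)
  simp
  ring

/-- The Fourier coefficient as a linear functional. -/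
def fourierCoefLin {n : ℕ} (l : Lattice n) : SmoothFn n →ₗ[ℂ] ℂ where
  toFun f := fourierCoef f l
  map_add' f g := fourierCoef_add f g l
  map_smul' c f := fourierCoef_smul c f l

/-- The coordinate vector fields of `ℝ²ⁿ`, indexed together. -/
def dirSum {n : ℕ} : Fin n ⊕ Fin n → Phase n := Sum.elim dirX dirY

/-- The components of a lattice vector, indexed together. -/
def latSum {n : ℕ} (l : Lattice n) : Fin n ⊕ Fin n → ℤ := Sum.elim l.1 l.2

theorem integral_derivFn {n : ℕ} (j : Fin n ⊕ Fin n) (g : SmoothFn n) :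
    ∫ z in Set.Icc (0 : Phase n) 1, (derivFn (dirSum j) g).1 z = 0 := by
  have hI := integrableOn_smoothFn (derivFn (dirSum j) g)
  have hprod : Set.Icc (0 : Phase n) 1 = Set.Icc (0 : Vec n) 1 ×ˢ Set.Icc (0 : Vec n) 1 :=
    (Set.Icc_prod_Icc 0 1 0 1).symm
  have hg : ∀ z, HasFDerivAt g.1 (fderiv ℝ g.1 z) z := fun z =>
    (g.2.1.differentiable (by simp) z).hasFDerivAt
  rw [hprod] at hI ⊢
  rw [Measure.volume_eq_prod] at hI ⊢
  cases j with
  | inl i =>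
    rw [← Measure.prod_restrict, integral_prod_symm _ (by rwa [Measure.prod_restrict])]
    refine integral_eq_zero_of_ae (Filter.Eventually.of_forall fun y => ?_)
    have h1 := integral_fderiv_periodic (fun x => g.1 (x, y))
      ((g.2.1.of_le (by exact_mod_cast le_top)).comp (contDiff_id.prodMk contDiff_const)) i
      (fun x => by
        have h : ((x, y) : Phase n) + latVec (Pi.single i 1, 0) = (x + Pi.single i 1, y) := by
          ext a <;> simp [latVec, Pi.single_apply]
        rw [← h, g.2.2])
    refine Eq.trans (integral_congr_ae (Filter.Eventually.of_forall fun x => ?_)) h1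
    have h2 := (hg (x, y)).comp x ((hasFDerivAt_id (𝕜 := ℝ) x).prodMk (hasFDerivAt_const y x))
    have h3 : fderiv ℝ (fun x => g.1 (x, y)) x = _ := h2.fderiv
    simp only [h3]
    simp [derivFn, dirSum, dirX]
  | inr i =>
    rw [← Measure.prod_restrict, integral_prod _ (by rwa [Measure.prod_restrict])]
    refine integral_eq_zero_of_ae (Filter.Eventually.of_forall fun x => ?_)
    have h1 := integral_fderiv_periodic (fun y => g.1 (x, y))
      ((g.2.1.of_le (by exact_mod_cast le_top)).comp (contDiff_const.prodMk contDiff_id)) i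
      (fun y => by
        have h : ((x, y) : Phase n) + latVec (0, Pi.single i 1) = (x, y + Pi.single i 1) := by
          ext a <;> simp [latVec, Pi.single_apply]
        rw [← h, g.2.2])
    refine Eq.trans (integral_congr_ae (Filter.Eventually.of_forall fun y => ?_)) h1
    have h2 := (hg (x, y)).comp y ((hasFDerivAt_const x y).prodMk (hasFDerivAt_id (𝕜 := ℝ) y))
    have h3 : fderiv ℝ (fun y => g.1 (x, y)) y = _ := h2.fderiv
    simp only [h3]
    simp [derivFn, dirSum, dirY]

theorem derivFn_mul {n : ℕ} (v : Phase n) (f g : SmoothFn n) :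
    derivFn v (f * g) = derivFn v f * g + f * derivFn v g := by
  ext z
  have hf := f.2.1.differentiable (by simp) z
  have hg := g.2.1.differentiable (by simp) z
  change fderiv ℝ (fun z => f.1 z * g.1 z) z v =
    fderiv ℝ f.1 z v * g.1 z + f.1 z * fderiv ℝ g.1 z v
  rw [fderiv_fun_mul hf hg]
  simp
  ring

theorem derivFn_wave {n : ℕ} (j : Fin n ⊕ Fin n) (l : Lattice n) :
    derivFn (dirSum j) (wave l) = (2 * Real.pi * Complex.I * latSum l j) • wave l := by
  ext z
  obtain ⟨A, hA, hA'⟩ := hasFDerivAt_dot (latVec l).1 z.1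
  obtain ⟨B, hB, hB'⟩ := hasFDerivAt_dot (latVec l).2 z.2
  have h1 := ((Complex.ofRealCLM.hasFDerivAt.comp z ((hA.comp z hasFDerivAt_fst).add
    (hB.comp z hasFDerivAt_snd))).const_mul (2 * Real.pi * Complex.I)).cexp
  have h2 : fderiv ℝ (wave l).1 z = _ := h1.fderiv
  change fderiv ℝ (wave l).1 z (dirSum j) = (2 * Real.pi * Complex.I * latSum l j) * (wave l).1 z
  rw [h2, wave_apply]
  cases j with
  | inl i => simp [dirSum, dirX, latSum, hA', latVec]; ring
  | inr i => simp [dirSum, dirY, latSum, hB', latVec]; ring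

theorem fourierCoef_derivFn {n : ℕ} (j : Fin n ⊕ Fin n) (f : SmoothFn n) (l : Lattice n) :
    fourierCoef (derivFn (dirSum j) f) l = (2 * Real.pi * Complex.I * latSum l j) *
      fourierCoef f l := by
  have h1 := integral_derivFn j (wave (-l) * f)
  have h2 : derivFn (dirSum j) (wave (-l) * f) =
      (-(2 * Real.pi * Complex.I * latSum l j)) • (wave (-l) * f)
        + wave (-l) * derivFn (dirSum j) f := by
    have h3 : latSum (-l) j = -latSum l j := by cases j <;> simp [latSum]
    rw [derivFn_mul, derivFn_wave, h3, smul_mul_assoc]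
    congr 2
    push_cast
    ring
  rw [h2] at h1
  have h3 := integral_add
    (integrableOn_smoothFn ((-(2 * Real.pi * Complex.I * latSum l j)) • (wave (-l) * f)))
    (integrableOn_smoothFn (wave (-l) * derivFn (dirSum j) f))
  have h4 := h3.symm.trans h1
  have h5 : ∫ z in Set.Icc (0 : Phase n) 1,
      ((-(2 * Real.pi * Complex.I * latSum l j)) • (wave (-l) * f)).1 z
      = -(2 * Real.pi * Complex.I * latSum l j) * fourierCoef f l := by
    rw [fourierCoef, ← integral_const_mul]
    rfl
  rw [h5] at h4
  have h6 : fourierCoef (derivFn (dirSum j) f) l =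
    ∫ z in Set.Icc (0 : Phase n) 1, (wave (-l) * derivFn (dirSum j) f).1 z := rfl
  rw [h6]
  linear_combination h4

theorem exists_norm_fourierCoef_le {n : ℕ} (f : SmoothFn n) :
    ∃ C, ∀ l, ‖fourierCoef f l‖ ≤ C := by
  refine ⟨∫ z in Set.Icc (0 : Phase n) 1, ‖f.1 z‖, fun l => ?_⟩
  refine (norm_integral_le_integral_norm _).trans (le_of_eq ?_)
  refine integral_congr_ae (Filter.Eventually.of_forall fun z => ?_)
  simp only [norm_mul, norm_wave, one_mul]

/-- Applying `1 - ∂_j²` for each `j ∈ S` multiplies the Fourier coefficients by polynomial weights; this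
gives their summability. -/
theorem exists_fourierCoef_eq_prod {n : ℕ} (f : SmoothFn n) (S : Finset (Fin n ⊕ Fin n)) :
    ∃ g : SmoothFn n, ∀ l, fourierCoef g l =
      (∏ j ∈ S, (1 + (2 * Real.pi * latSum l j) ^ 2 : ℝ) : ℝ) * fourierCoef f l := by
  classical
  induction S using Finset.induction_on with
  | empty => exact ⟨f, by simp⟩
  | insert a S ha ih =>
    obtain ⟨g, hg⟩ := ih
    refine ⟨g + (-1 : ℂ) • derivFn (dirSum a) (derivFn (dirSum a) g), fun l => ?_⟩
    rw [fourierCoef_add, fourierCoef_smul, fourierCoef_derivFn, fourierCoef_derivFn, hg,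
      Finset.prod_insert ha]
    push_cast
    linear_combination (-(2 * Real.pi * latSum l a) ^ 2 *
      (∏ j ∈ S, (1 + (2 * Real.pi * latSum l j) ^ 2 : ℂ)) * fourierCoef f l) * Complex.I_sq

theorem summable_pi_prod {n : ℕ} {w : ℤ → ℝ} (hw : Summable w) (h0 : ∀ r, 0 ≤ w r) :
    Summable fun a : Fin n → ℤ => ∏ i, w (a i) := by
  induction n with
  | zero => exact (hasSum_fintype _).summable
  | succ n ih =>
    rw [← (Fin.consEquiv fun _ : Fin (n + 1) => ℤ).summable_iff]
    have h := hw.mul_of_nonneg ih h0 fun a => Finset.prod_nonneg fun i _ => h0 _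
    refine h.congr fun a => ?_
    simp [Fin.prod_univ_succ, Fin.consEquiv]

theorem summable_inv_one_add_sq : Summable fun r : ℤ => (1 + (2 * Real.pi * r) ^ 2 : ℝ)⁻¹ := by
  refine Summable.of_nonneg_of_le (fun r => by positivity) (fun r => ?_)
    ((Real.summable_one_div_int_pow (p := 2)).2 (by norm_num) |>.add
      (hasSum_ite_eq (0 : ℤ) (1 : ℝ)).summable)
  by_cases hr : r = 0
  · simp [hr]
  · have hr' : (0 : ℝ) < (r : ℝ) ^ 2 := by positivity
    simp only [hr, if_false, add_zero, one_div]
    refine inv_anti₀ hr' ?_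
    have h1 : (1 : ℝ) ≤ (2 * Real.pi) ^ 2 := by nlinarith [Real.pi_gt_three]
    nlinarith

/-- The Fourier coefficients of a smooth function are absolutely summable. -/
theorem summable_norm_fourierCoef {n : ℕ} (f : SmoothFn n) :
    Summable fun l => ‖fourierCoef f l‖ := by
  obtain ⟨g, hg⟩ := exists_fourierCoef_eq_prod f Finset.univ
  obtain ⟨C, hC⟩ := exists_norm_fourierCoef_le g
  let w : ℤ → ℝ := fun r => (1 + (2 * Real.pi * r) ^ 2 : ℝ)⁻¹
  have hw0 : ∀ r, 0 ≤ w r := fun r => by simp only [w]; positivity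
  have hs : Summable fun l : Lattice n => C * ((∏ i, w (l.1 i)) * ∏ i, w (l.2 i)) :=
    ((summable_pi_prod summable_inv_one_add_sq hw0).mul_of_nonneg
      (summable_pi_prod summable_inv_one_add_sq hw0)
      (fun a => Finset.prod_nonneg fun i _ => hw0 _)
      (fun a => Finset.prod_nonneg fun i _ => hw0 _)).mul_left C
  refine Summable.of_nonneg_of_le (fun l => norm_nonneg _) (fun l => ?_) hs
  have hP : (0 : ℝ) < ∏ j, (1 + (2 * Real.pi * latSum l j) ^ 2 : ℝ) :=
    Finset.prod_pos fun j _ => by positivity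
  have h1 := hC l
  rw [hg, norm_mul, Complex.norm_real, Real.norm_of_nonneg hP.le] at h1
  have h2 : (∏ i, w (l.1 i)) * ∏ i, w (l.2 i)
      = (∏ j, (1 + (2 * Real.pi * latSum l j) ^ 2 : ℝ))⁻¹ := by
    rw [Fintype.prod_sum_type, mul_inv, ← Finset.prod_inv_distrib, ← Finset.prod_inv_distrib]
    rfl
  rw [h2, ← div_eq_mul_inv, le_div_iff₀ hP, mul_comm]
  exact h1

theorem mFourier_coe {n : ℕ} (ν : Fin n ⊕ Fin n → ℤ) (x : Fin n ⊕ Fin n → ℝ) :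
    UnitAddTorus.mFourier ν (fun i => (x i : UnitAddCircle)) =
      (wave ((fun i => ν (Sum.inl i), fun i => ν (Sum.inr i)) : Lattice n)).1
        (fun i => x (Sum.inl i), fun i => x (Sum.inr i)) := by
  change ∏ i, fourier (ν i) (x i : UnitAddCircle) = _
  simp only [fourier_coe_apply]
  rw [← Complex.exp_sum, wave_apply, Fintype.sum_sum_type]
  congr 1
  simp only [latVec, dotProduct]
  push_cast
  rw [mul_add, Finset.mul_sum, Finset.mul_sum]
  congr 1 <;> exact Finset.sum_congr rfl fun i _ => by simp; ring

/-- A smooth function on the torus is the sum of its Fourier series. -/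
theorem hasSum_fourierCoef {n : ℕ} (f : SmoothFn n) (z : Phase n) :
    HasSum (fun l => fourierCoef f l * (wave l).1 z) (f.1 z) := by
  let d := Fin n ⊕ Fin n
  let M : (d → ℝ) ≃ᵐ Phase n := MeasurableEquiv.sumPiEquivProdPi fun _ : d => ℝ
  have hM : MeasurePreserving M := volume_measurePreserving_sumPiEquivProdPi _
  let e : (d → ℤ) ≃ Lattice n := Equiv.sumArrowEquivProdArrow _ _ _
  let π : C(d → ℝ, UnitAddTorus d) := ⟨fun x i => (x i : UnitAddCircle),
    continuous_pi fun i => (AddCircle.continuous_mk' 1).comp (continuous_apply i)⟩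
  have hπ : IsOpenQuotientMap π :=
    IsOpenQuotientMap.piMap fun _ : d => QuotientAddGroup.isOpenQuotientMap_mk
  let f₀ : C(d → ℝ, ℂ) := ⟨fun x => f.1 (fun i => x (Sum.inl i), fun i => x (Sum.inr i)),
    (continuous_smoothFn f).comp (by fun_prop)⟩
  have hf₀ : ∀ x y, π x = π y → f₀ x = f₀ y := by
    intro x y hxy
    have h1 : ∀ i, ∃ r : ℤ, y i + r = x i := fun i => by
      have h2 : ((x i : ℝ) : UnitAddCircle) = (y i : UnitAddCircle) := congrFun hxy i
      obtain ⟨r, hr⟩ := AddSubgroup.mem_zmultiples_iff.1 (QuotientAddGroup.eq.1 h2.symm)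
      refine ⟨r, ?_⟩
      rw [zsmul_one] at hr
      rw [hr]
      ring
    choose r hr using h1
    have h3 : ((fun i => y (Sum.inl i), fun i => y (Sum.inr i)) : Phase n) + latVec (e r)
        = (fun i => x (Sum.inl i), fun i => x (Sum.inr i)) :=
      Prod.ext (funext fun i => hr _) (funext fun i => hr _)
    change f.1 (fun i => x (Sum.inl i), fun i => x (Sum.inr i)) = f.1 _
    rw [← h3, f.2.2]
  let F : C(UnitAddTorus d, ℂ) := hπ.isQuotientMap.lift f₀ fun x y h => hf₀ x y h
  have hF : ∀ x, F (π x) = f₀ x := fun x => by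
    have := hπ.isQuotientMap.lift_comp f₀ fun x y h => hf₀ x y h
    exact congrFun (congrArg DFunLike.coe this) x
  have hcoef : ∀ ν, UnitAddTorus.mFourierCoeff F ν = fourierCoef f (e ν) := by
    intro ν
    rw [UnitAddTorus.mFourierCoeff_eq_integral _ _ 0]
    have hset : {x : d → ℝ | ∀ i, x i ∈ Set.Ioc ((0 : d → ℝ) i) ((0 : d → ℝ) i + 1)} =
        Set.univ.pi fun i : d => Set.Ioc ((0 : d → ℝ) i) ((1 : d → ℝ) i) := by
      ext x; simp [Set.mem_pi]
    have hpre : Set.Icc (0 : d → ℝ) 1 = M ⁻¹' Set.Icc (0 : Phase n) 1 := by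
      ext x
      constructor
      · rintro ⟨h1, h2⟩
        exact ⟨⟨fun i => h1 (Sum.inl i), fun i => h1 (Sum.inr i)⟩,
          ⟨fun i => h2 (Sum.inl i), fun i => h2 (Sum.inr i)⟩⟩
      · rintro ⟨⟨h1, h2⟩, ⟨h3, h4⟩⟩
        exact ⟨Sum.rec h1 h2, Sum.rec h3 h4⟩
    have hae : (Set.univ.pi fun i : d => Set.Ioc ((0 : d → ℝ) i) ((1 : d → ℝ) i))
        =ᵐ[volume] Set.Icc (0 : d → ℝ) 1 := Measure.univ_pi_Ioc_ae_eq_Icc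
    rw [hset, setIntegral_congr_set hae, hpre, fourierCoef,
      ← hM.setIntegral_preimage_emb M.measurableEmbedding]
    refine integral_congr_ae (Filter.Eventually.of_forall fun x => ?_)
    have h1 := mFourier_coe (-ν) x
    have h2 : F (fun i => (x i : UnitAddCircle)) = f₀ x := hF x
    beta_reduce
    rw [h1, h2]
    rfl
  have hsum : Summable (UnitAddTorus.mFourierCoeff F) := by
    refine Summable.of_norm ?_
    have h1 := e.summable_iff.2 (summable_norm_fourierCoef f)
    refine h1.congr fun ν => ?_
    rw [hcoef]
    rfl
  have h := UnitAddTorus.hasSum_mFourier_series_apply_of_summable hsum (π (M.symm z))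
  rw [hF] at h
  rw [← e.hasSum_iff]
  have hz : f₀ (M.symm z) = f.1 z := rfl
  rw [hz] at h
  refine h.congr_fun fun ν => ?_
  have h1 := mFourier_coe ν (M.symm z)
  rw [hcoef, smul_eq_mul]
  exact congrArg (fourierCoef f (e ν) * ·) h1.symm

/-! ### Comparison of the two Toeplitz operators -/

/-- The pairing `p · q` of the two components of the lattice vector `(p, q)`. -/
def latDot {n : ℕ} (l : Lattice n) : ℤ := ∑ i, l.1 i * l.2 i

theorem fourierCoef_sum {n : ℕ} {ι : Type*} (S : Finset ι) (g : ι → SmoothFn n) (l : Lattice n) :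
    fourierCoef (∑ i ∈ S, g i) l = ∑ i ∈ S, fourierCoef (g i) l :=
  map_sum (fourierCoefLin l) g S

theorem fourierCoef_laplace {n : ℕ} (f : SmoothFn n) (l : Lattice n) :
    fourierCoef (laplace n f) l = -(2 * Real.pi * Complex.I * latDot l) * fourierCoef f l := by
  have hpi : (Real.pi : ℂ) ≠ 0 := by exact_mod_cast Real.pi_ne_zero
  have h1 : laplace n f = (Complex.I / (2 * Real.pi)) •
      ∑ i : Fin n, derivFn (dirSum (Sum.inl i)) (derivFn (dirSum (Sum.inr i)) f) := by
    simp [laplace, dirSum, LinearMap.sum_apply]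
  rw [h1, fourierCoef_smul, fourierCoef_sum]
  simp only [fourierCoef_derivFn, latSum, Sum.elim_inl, Sum.elim_inr, latDot]
  push_cast
  rw [Finset.mul_sum, Finset.mul_sum, ← Finset.sum_neg_distrib, Finset.sum_mul]
  refine Finset.sum_congr rfl fun i _ => ?_
  field_simp
  linear_combination ((l.1 i : ℂ) * l.2 i * fourierCoef f l) * Complex.I_sq

theorem fourierCoef_smul_laplace_pow {n : ℕ} (c : ℂ) (i : ℕ) (f : SmoothFn n) (l : Lattice n) :
    fourierCoef (((-c • laplace n) ^ i) f) l =
      (2 * Real.pi * Complex.I * latDot l * c) ^ i * fourierCoef f l := by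
  induction i with
  | zero => simp
  | succ i ih =>
    rw [pow_succ', Module.End.mul_apply, LinearMap.smul_apply, fourierCoef_smul,
      fourierCoef_laplace, ih]
    ring

theorem fourierCoef_truncDQ {n : ℕ} (N : ℕ) (h : ℝ) (f : SmoothFn n) (l : Lattice n) :
    fourierCoef (truncDQ n N h f) l =
      (∑ i ∈ Finset.range (N + 1), (2 * Real.pi * Complex.I * latDot l * h) ^ i / i.factorial) *
        fourierCoef f l := by
  rw [truncDQ, LinearMap.sum_apply, fourierCoef_sum, Finset.sum_mul]
  refine Finset.sum_congr rfl fun i _ => ?_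
  rw [LinearMap.smul_apply, fourierCoef_smul, fourierCoef_smul_laplace_pow]
  ring

/-- Reduction of an integral vector modulo `k`. -/
def redMod {n : ℕ} (k : ℕ) (a : Fin n → ℤ) : Fin n → ZMod k := fun i => (a i : ZMod k)

theorem dftChar_redMod {n k : ℕ} [NeZero k] (a : Fin n → ℤ) (b : Fin n → ZMod k) :
    dftChar (redMod k a) b = Complex.exp (2 * Real.pi * Complex.I *
      (((fun i => (a i : ℝ)) ⬝ᵥ ((k : ℝ)⁻¹ • rep b) : ℝ) : ℂ)) := by
  have h1 : redMod k a ⬝ᵥ b = ((∑ i, a i * (b i).val : ℤ) : ZMod k) := by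
    simp [dotProduct, redMod]
  have h2 : (fun i => (a i : ℝ)) ⬝ᵥ ((k : ℝ)⁻¹ • rep b)
      = (k : ℝ)⁻¹ * ((∑ i, a i * (b i).val : ℤ) : ℝ) := by
    simp [dotProduct, rep, Finset.mul_sum, mul_left_comm]
  rw [dftChar, h1, ZMod.stdAddChar_coe, h2]
  congr 1
  push_cast
  ring

theorem dftChar_redMod_redMod {n k : ℕ} [NeZero k] (l : Lattice n) :
    dftChar (redMod k l.2) (redMod k l.1) =
      Complex.exp (2 * Real.pi * Complex.I * latDot l * ((1 / (k : ℝ) : ℝ) : ℂ)) := by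
  have h1 : redMod k l.2 ⬝ᵥ redMod k l.1 = ((latDot l : ℤ) : ZMod k) := by
    simp [dotProduct, redMod, latDot, mul_comm]
  rw [dftChar, h1, ZMod.stdAddChar_coe]
  congr 1
  push_cast
  ring

theorem wave_fibrePoint {n k : ℕ} [NeZero k] (l : Lattice n) (m j : Fin n → ZMod k) :
    (wave l).1 (fibrePoint k m j) = dftChar (redMod k l.1) j * dftChar (redMod k l.2) m := by
  rw [wave_apply, dftChar_redMod, dftChar_redMod, ← Complex.exp_add]
  congr 1
  simp only [fibrePoint, latVec]
  push_cast
  ring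

theorem matrixX_wave {n k : ℕ} [NeZero k] (l : Lattice n) (m m' : Fin n → ZMod k) :
    matrixX k (wave l) m m' =
      if m' = m - redMod k l.1 then dftChar (redMod k l.2) m' else 0 := by
  have hk : (k : ℂ) ≠ 0 := by exact_mod_cast NeZero.ne k
  have h1 : ∀ j, dftChar (m' - m) j * (wave l).1 (fibrePoint k m' j) =
      dftChar (redMod k l.2) m' * dftChar (m' - m + redMod k l.1) j := fun j => by
    rw [wave_fibrePoint, dftChar_add_left]; ring
  have h2 : m' - m + redMod k l.1 = 0 ↔ m' = m - redMod k l.1 := by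
    rw [← sub_eq_zero (a := m'), sub_sub_eq_add_sub, sub_add_eq_add_sub]
  simp only [matrixX, h1, ← Finset.mul_sum, sum_dftChar, h2]
  split_ifs
  · field_simp
  · simp

/-- On a character of the torus the two Toeplitz operators differ by a phase. -/
theorem matrixY_wave {n k : ℕ} [NeZero k] (l : Lattice n) (m m' : Fin n → ZMod k) :
    matrixY k (wave l) m m' =
      Complex.exp (2 * Real.pi * Complex.I * latDot l * ((1 / (k : ℝ) : ℝ) : ℂ)) *
        matrixX k (wave l) m m' := by
  have hk : (k : ℂ) ≠ 0 := by exact_mod_cast NeZero.ne k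
  have h1 : ∀ j, dftChar (m' - m) j * (wave l).1 (fibrePoint k m j) =
      dftChar (redMod k l.2) m * dftChar (m' - m + redMod k l.1) j := fun j => by
    rw [wave_fibrePoint, dftChar_add_left]; ring
  have h2 : m' - m + redMod k l.1 = 0 ↔ m' = m - redMod k l.1 := by
    rw [← sub_eq_zero (a := m'), sub_sub_eq_add_sub, sub_add_eq_add_sub]
  rw [matrixX_wave]
  simp only [matrixY, h1, ← Finset.mul_sum, sum_dftChar, h2]
  split_ifs with h
  · rw [← dftChar_redMod_redMod, ← dftChar_add_right, h, add_sub_cancel]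
    field_simp
  · simp

theorem hasSum_matrixX {n k : ℕ} [NeZero k] (f : SmoothFn n) (m m' : Fin n → ZMod k) :
    HasSum (fun l => fourierCoef f l * matrixX k (wave l) m m') (matrixX k f m m') := by
  have h := (hasSum_sum fun (j : Fin n → ZMod k) (_ : j ∈ Finset.univ) =>
    (hasSum_fourierCoef f (fibrePoint k m' j)).mul_left (dftChar (m' - m) j)).mul_left
    ((k : ℂ) ^ n)⁻¹
  refine h.congr_fun fun l => ?_
  simp only [matrixX, Finset.mul_sum]
  refine Finset.sum_congr rfl fun j _ => ?_
  ring

theorem hasSum_matrixY {n k : ℕ} [NeZero k] (f : SmoothFn n) (m m' : Fin n → ZMod k) :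
    HasSum (fun l => fourierCoef f l * matrixY k (wave l) m m') (matrixY k f m m') := by
  have h := (hasSum_sum fun (j : Fin n → ZMod k) (_ : j ∈ Finset.univ) =>
    (hasSum_fourierCoef f (fibrePoint k m j)).mul_left (dftChar (m' - m) j)).mul_left
    ((k : ℂ) ^ n)⁻¹
  refine h.congr_fun fun l => ?_
  simp only [matrixY, Finset.mul_sum]
  refine Finset.sum_congr rfl fun j _ => ?_
  ring

/-- The Taylor remainder of the exponential series at `z`. -/
def expRemainder (N : ℕ) (z : ℂ) : ℂ :=
  Complex.exp z - ∑ i ∈ Finset.range (N + 1), z ^ i / i.factorial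

theorem exists_norm_expRemainder_le (N : ℕ) :
    ∃ C : ℝ, 0 ≤ C ∧ ∀ z : ℂ, z.re = 0 → ‖expRemainder N z‖ ≤ C * ‖z‖ ^ (N + 1) := by
  let C₁ : ℝ := ((N + 1).succ : ℝ) * (((N + 1).factorial * (N + 1 : ℕ) : ℝ))⁻¹
  have hC₁ : 0 ≤ C₁ := by positivity
  refine ⟨C₁ + (N + 2), by positivity, fun z hz => ?_⟩
  have hp : 0 ≤ ‖z‖ ^ (N + 1) := by positivity
  rcases le_total ‖z‖ 1 with h | h
  · have h1 := Complex.exp_bound h (Nat.succ_pos N)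
    refine h1.trans ?_
    change ‖z‖ ^ (N + 1) * C₁ ≤ _
    nlinarith [mul_nonneg (show (0 : ℝ) ≤ N + 2 by positivity) hp]
  · have h1 : ‖Complex.exp z‖ ≤ ‖z‖ ^ (N + 1) := by
      rw [Complex.norm_exp, hz, Real.exp_zero]
      exact one_le_pow₀ h
    have h2 : ‖∑ i ∈ Finset.range (N + 1), z ^ i / i.factorial‖ ≤ (N + 1) * ‖z‖ ^ (N + 1) := by
      have h4 : ∑ _i ∈ Finset.range (N + 1), ‖z‖ ^ (N + 1) = (N + 1) * ‖z‖ ^ (N + 1) := by simp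
      rw [← h4]
      refine norm_sum_le_of_le _ fun i hi => ?_
      rw [norm_div, norm_pow, Complex.norm_natCast]
      have h3 : (1 : ℝ) ≤ i.factorial := by exact_mod_cast i.factorial_pos
      exact (div_le_self (by positivity) h3).trans
        (pow_le_pow_right₀ h (Finset.mem_range.1 hi).le)
    refine (norm_sub_le _ _).trans ?_
    nlinarith [mul_nonneg hC₁ hp]

/-- The Toeplitz operator of a character is unitary. -/
theorem norm_mulVec_matrixX_wave {n k : ℕ} [NeZero k] (l : Lattice n)
    (c : (Fin n → ZMod k) → ℂ) :
    ‖WithLp.toLp 2 ((matrixX k (wave l)).mulVec c)‖ = ‖WithLp.toLp 2 c‖ := by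
  have h1 : ∀ m, (matrixX k (wave l)).mulVec c m =
      dftChar (redMod k l.2) (m - redMod k l.1) * c (m - redMod k l.1) := by
    intro m
    simp [Matrix.mulVec, dotProduct, matrixX_wave]
  rw [EuclideanSpace.norm_eq, EuclideanSpace.norm_eq]
  congr 1
  simp only [h1, norm_mul, norm_dftChar, one_mul]
  exact (Equiv.subRight (redMod k l.1)).sum_comp fun m => ‖c m‖ ^ 2

/-- The operator estimate in coordinates: expanding in Fourier modes, each mode contributes a weighted
shift on `(ℤ/k)ⁿ`, with weight the Taylor remainder of the exponential at an imaginary argument. -/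
theorem norm_mulVec_sub_le {n k : ℕ} [NeZero k] (f : SmoothFn n) (N : ℕ) {C : ℝ}
    (hexp : ∀ z : ℂ, z.re = 0 → ‖expRemainder N z‖ ≤ C * ‖z‖ ^ (N + 1))
    (c : (Fin n → ZMod k) → ℂ) :
    ‖WithLp.toLp 2 ((matrixY k f - matrixX k (truncDQ n N (1 / (k : ℝ)) f)).mulVec c)‖ ≤
      (C * ∑' l, ‖fourierCoef ((laplace n ^ (N + 1)) f) l‖) * (1 / (k : ℝ)) ^ (N + 1) *
        ‖WithLp.toLp 2 c‖ := by
  let θ : Lattice n → ℂ := fun l =>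
    2 * Real.pi * Complex.I * latDot l * ((1 / (k : ℝ) : ℝ) : ℂ)
  let a : Lattice n → ℂ := fun l => expRemainder N (θ l) * fourierCoef f l
  let b : Lattice n → ℝ := fun l => ‖fourierCoef ((laplace n ^ (N + 1)) f) l‖
  have hb : Summable b := summable_norm_fourierCoef _
  have hk : (0 : ℝ) ≤ 1 / (k : ℝ) := by positivity
  have hpow : ∀ l, b l = ‖(2 * Real.pi * Complex.I * latDot l : ℂ)‖ ^ (N + 1)
      * ‖fourierCoef f l‖ := by
    intro l
    have h1 := fourierCoef_smul_laplace_pow (-1) (N + 1) f l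
    rw [neg_neg, one_smul] at h1
    simp only [b, h1, norm_mul, norm_pow, mul_neg, mul_one, norm_neg]
  have ha : ∀ l, ‖a l‖ ≤ C * (1 / (k : ℝ)) ^ (N + 1) * b l := by
    intro l
    have h1 := hexp (θ l) (by simp [θ])
    rw [norm_mul, hpow]
    refine (mul_le_mul_of_nonneg_right h1 (norm_nonneg _)).trans (le_of_eq ?_)
    have h2 : ‖θ l‖ = ‖(2 * Real.pi * Complex.I * latDot l : ℂ)‖ * (1 / (k : ℝ)) := by
      rw [norm_mul, Complex.norm_real, Real.norm_of_nonneg hk]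
    rw [h2, mul_pow]
    ring
  -- the Fourier expansion of the matrix of the difference
  have hD : ∀ m m', HasSum (fun l => a l * matrixX k (wave l) m m')
      ((matrixY k f - matrixX k (truncDQ n N (1 / (k : ℝ)) f)) m m') := by
    intro m m'
    refine ((hasSum_matrixY f m m').sub
      (hasSum_matrixX (truncDQ n N (1 / (k : ℝ)) f) m m')).congr_fun fun l => ?_
    rw [matrixY_wave, fourierCoef_truncDQ]
    simp only [a, expRemainder, θ]
    ring
  have hDc : ∀ m, HasSum (fun l => a l * (matrixX k (wave l)).mulVec c m)
      ((matrixY k f - matrixX k (truncDQ n N (1 / (k : ℝ)) f)).mulVec c m) := by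
    intro m
    refine (hasSum_sum fun m' (_ : m' ∈ Finset.univ) => (hD m m').mul_right (c m')).congr_fun
      fun l => ?_
    simp only [Matrix.mulVec, dotProduct, Finset.mul_sum, mul_assoc]
  let v : Lattice n → EuclideanSpace ℂ (Fin n → ZMod k) := fun l =>
    a l • WithLp.toLp 2 ((matrixX k (wave l)).mulVec c)
  have hv : ∀ l, ‖v l‖ ≤ C * (1 / (k : ℝ)) ^ (N + 1) * b l * ‖WithLp.toLp 2 c‖ := by
    intro l
    rw [norm_smul, norm_mulVec_matrixX_wave]
    exact mul_le_mul_of_nonneg_right (ha l) (norm_nonneg _)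
  have hs := (hb.hasSum.mul_left (C * (1 / (k : ℝ)) ^ (N + 1))).mul_right
    ‖(WithLp.toLp 2 c : EuclideanSpace ℂ (Fin n → ZMod k))‖
  have hvs : Summable v := Summable.of_norm_bounded hs.summable hv
  have heq : WithLp.toLp 2 ((matrixY k f - matrixX k (truncDQ n N (1 / (k : ℝ)) f)).mulVec c)
      = ∑' l, v l := by
    ext m
    exact (hDc m).unique (hvs.hasSum.mapL (EuclideanSpace.proj (𝕜 := ℂ) m))
  rw [heq]
  refine (tsum_of_norm_bounded hs hv).trans (le_of_eq ?_)
  ring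

/-- The difference of the two operators, conjugated to coordinates, is the difference of their
matrices. -/
theorem opNormLE_conjBy_sub {n k : ℕ} [NeZero k] (f g : SmoothFn n) {B : HY n k ≃ₗ[ℂ] HX n k}
    (hB : IsBKSMap B) {C : ℝ}
    (h : ∀ c, ‖WithLp.toLp 2 ((matrixY k f - matrixX k g).mulVec c)‖ ≤ C * ‖WithLp.toLp 2 c‖) :
    OpNormLE (fun s => conjBy B (toeplitzY f) s - toeplitzX g s) C := by
  have hA : ∀ c, conjBy B (toeplitzY f) (combX n k c) - toeplitzX g (combX n k c) =
      combX n k ((matrixY k f - matrixX k g).mulVec c) := by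
    intro c
    have h1 : B.symm (combX n k c) = combY n k c := by
      rw [LinearEquiv.symm_apply_eq, hB.apply_combY]
    rw [conjBy, h1, toeplitzY_combY, hB.apply_combY, toeplitzX_combX, Matrix.sub_mulVec, map_sub]
  refine ⟨isLinearMap_combX_mulVec _ hA, fun s => ?_⟩
  obtain ⟨c, rfl⟩ := (bijective_combX n k).2 s
  beta_reduce
  rw [hA, stateNorm_combX, stateNorm_combX]
  have h1 := h c
  rwa [EuclideanSpace.norm_eq, EuclideanSpace.norm_eq] at h1

end TorusQuant

end

theorem theorem1p2 (n : ℕ) (f : TorusQuant.SmoothFn n) (N : ℕ) :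
    (∀ (k : ℕ) [NeZero k], TorusQuant.PairingsDefined n k ∧
      ∃! B : TorusQuant.HY n k ≃ₗ[ℂ] TorusQuant.HX n k, TorusQuant.IsBKSMap B) ∧
    ∃ K : ℝ, 0 < K ∧
      ∀ (k : ℕ) [NeZero k] (B : TorusQuant.HY n k ≃ₗ[ℂ] TorusQuant.HX n k),
        TorusQuant.IsBKSMap B →
        TorusQuant.OpNormLE
          (fun s => TorusQuant.conjBy B (TorusQuant.toeplitzY f) s
            - TorusQuant.toeplitzX (TorusQuant.truncDQ n N (1 / (k : ℝ)) f) s)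
          (K * (1 / (k : ℝ)) ^ (N + 1)) := by
  refine ⟨fun k _ => ⟨TorusQuant.pairingsDefined n k, TorusQuant.existsUnique_isBKSMap n k⟩, ?_⟩
  obtain ⟨C, hC, hexp⟩ := TorusQuant.exists_norm_expRemainder_le N
  let S : ℝ := ∑' l, ‖TorusQuant.fourierCoef ((TorusQuant.laplace n ^ (N + 1)) f) l‖
  have hS : 0 ≤ S := tsum_nonneg fun l => norm_nonneg _
  -- the summand `1` only serves to make the constant positive
  refine ⟨C * S + 1, by positivity, fun k _ B hB =>
    TorusQuant.opNormLE_conjBy_sub f _ hB fun c => ?_⟩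
  refine (TorusQuant.norm_mulVec_sub_le f N hexp c).trans ?_
  gcongr
  exact (lt_add_one (C * S)).le
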